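/- **Abstract categorial grammars.** Linear implicational types over a set $P$ are built from atoms $p\in P$ by $A\multimap B$. A $\lambda$-signature $\Sigma=(P,C,\mathfrak T)$ consists of a finite set $P$ of atomic types, a finite set $C$ of constants, and a type $\mathfrak T(c)$ for each $c\in C$. Write $\Gamma\vdash_\Sigma t:A$ for derivability in linear $\lambda$-calculus (natural deduction for implicational linear logic, decorated with terms) from the axioms $\vdash c:\mathfrak T(c)$. For a finite alphabet $T$, the string signature $Str_{\lambda,T}$ has the single atomic type $O$ and constants $c\in T$ of type $O\multimap O$; a word $w=a_1\ldots a_n\in T^*$ is represented by $\rho(w)=\lambda x.a_1(\ldots(a_nx)\ldots)$. A string ACG $G=(\Sigma,T,\phi,S)$ consists of a $\lambda$-signature $\Sigma$, a finite alphabet $T$, a map $\phi:\Sigma\to Str_{\lambda,T}$ (a map of types with $\phi(A\multimap B)=\phi(A)\multimap\phi(B)$ and a map of constants to terms with $\vdash_{Str_{\lambda,T}}\phi(c):\phi(\mathfrak T(c))$, extended homomorphically to terms) and an atomic type $S$ of $\Sigma$ with $\phi(S)=O\multimap O$. Its language is $$L(G)=\{w\in T^*\mid \exists t\;\; \rho(w)\sim_{\beta\eta}\phi(t),\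 \vdash_\Sigma t:S\}.$$ **Tensor grammars.** Fix an infinite set of indices. Tensor terms over $T$ are products of elements $[w]^i_j$ and $[w]$ ($w\in T^*$; $i$, $j$ indices), in which an index occurs at most once as an upper and at most once as a lower index, modulo associativity, commutativity, $[u]^j_i[v]^k_j\equiv[uv]^k_i$, $[u]^i_i\equiv[u]$ and $[a_1\ldots a_n]\equiv[a_na_1\ldots a_{n-1}]$; an index is free if it occurs once. Put $\delta^{i_1\ldots i_n}_{j_1\ldots j_n}=[\epsilon]^{i_1}_{j_1}\cdots[\epsilon]^{i_n}_{j_n}$. Given positive atomic symbols $p\in P$ with valencies $v(p)\in\mathbf N^2$, a dual literal $\overline p$ has the swapped valency, and tensor types are built by $\otimes$ and $\wp$ from literals $p^I_J$ with $(|I|,|J|)=v(p)$, no index occurring twice. A type symbol is a type with its indices erased; $A^I_J$ is the type with symbol $A$ and ordered upper and lower indices $I$, $J$. Duality is $\overline{p^I_J}=\overline p^{\overline J}_{\overline I}$ (with $\overline I$ the reversed sequence), $\overline{A\otimes B}=\overline B\wp\overline A$, $\overline{A\wp B}=\overline B\otimes\overline A$. A typing judgement $t\vdash\Gamma$ consists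 of a term $t$ and a finite collection $\Gamma$ of types without common indices, such that the free upper (lower) indices of $t$ are the lower (upper) indices of $\Gamma$; judgements are identified up to renaming of indices. The rules of tensor type calculus are $$\delta^{I'\overline J}_{\overline IJ'}\vdash\overline p^I_J,p^{J'}_{I'},\qquad \frac{t\vdash\Gamma,A\quad s\vdash\overline A,\Theta}{ts\vdash\Gamma,\Theta},\qquad \frac{t\vdash\Gamma,A,B}{t\vdash\Gamma,A\wp B},\qquad \frac{t\vdash\Gamma,A\quad s\vdash B,\Theta}{ts\vdash\Gamma,A\otimes B,\Theta},$$ where representatives are chosen without index collisions. A tensor grammar consists of $P$, $v$, a finite alphabet $T$, a finite set $\Xi$ of typing judgements (axioms), and $S\in P$ with $v(S)=(1,1)$. Its language is the set of $w\in T^*$ such that $[w]^j_i\vdash S^i_j$ is derivable by the rules from elements of $\Xi$. **Tensor representation.** Implicational types are identified with type symbols by $A\multimap B=B\wp\overline A$. Given valencies of the atomic types and, for each constant $c$, a translation of the axiom $\vdash c:\mathfrak T(c)$ of the form $e\vdash \mathfrak T(c)^I_J$, a derivable $\lambda$-judgement $x_1:A_1,\ldots,x_n:A_n\vdash t:A$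 is translated, by induction on its derivation, to a typing judgement with type symbols $\overline{A_1},\ldots,\overline{A_n},A$: the judgement $x:A\vdash x:A$ becomes $\delta^{I'\overline J}_{\overline IJ'}\vdash\overline A^I_J,A^{J'}_{I'}$; $\lambda$-abstraction is the $\wp$-rule that introduces $B\wp\overline A$; application of $t:A\multimap B$ to $s:A$ replaces $B\wp\overline A$ by $B,\overline A$ in the translation for $t$ and cuts the result with the translation for $s$ on $A$. For the string signature take $v(O)=(1,0)$ and translate $\vdash c:O\multimap O$ as $[c]^j_i\vdash O^i\wp\overline O_j$. For a string ACG $G=(\Sigma,T,\phi,S)$ give $p\in P$ the valency $v(\phi(p))$; for a constant $c$ of $\Sigma$ with $A=\mathfrak T(c)$, let $e\vdash\phi(A)^I_J$ be the translation of $\vdash\phi(c):\phi(A)$ in the string signature, and take $e\vdash A^I_J$ as an axiom. With $S$ as the distinguished symbol this gives the tensor representation $\widetilde G$ of $G$. **Statement.** For every string ACG $G$, the above defines a tensor grammar $\widetilde G$ (in particular, its set of axioms is finite), and $$L(G)=L(\widetilde G).$$ -/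

import Mathlib

/-! ## Linear λ-calculus and abstract categorial grammars -/

/-- Linear implicational types over the set `P` of atomic types. -/
inductive ImpType (P : Type*) where
  | atom (p : P) : ImpType P
  | imp (A B : ImpType P) : ImpType P

/-- λ-terms up to α-equivalence (de Bruijn indices) with constants from `C`.
Linearity of a term is enforced by the typing rules below. -/
inductive LamTerm (C : Type*) where
  | var (n : ℕ) : LamTerm C
  | const (c : C) : LamTerm C
  | app (t s : LamTerm C) : LamTerm C
  | lam (t : LamTerm C) : LamTerm C

namespace LamTerm

variable {C D : Type*}

/-- Extend a renaming of variables under a binder. -/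
def liftRen (f : ℕ → ℕ) : ℕ → ℕ
  | 0 => 0
  | n + 1 => f n + 1

/-- Renaming of free variables. -/
def rename : (ℕ → ℕ) → LamTerm C → LamTerm C
  | f, var n => var (f n)
  | _, const c => const c
  | f, app t s => app (rename f t) (rename f s)
  | f, lam t => lam (rename (liftRen f) t)

/-- Extend a substitution under a binder. -/
def liftSub (f : ℕ → LamTerm C) : ℕ → LamTerm C
  | 0 => var 0
  | n + 1 => rename Nat.succ (f n)

/-- Simultaneous capture-avoiding substitution. -/
def subst : (ℕ → LamTerm C) → LamTerm C → LamTerm C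
  | f, var n => f n
  | _, const c => const c
  | f, app t s => app (subst f t) (subst f s)
  | f, lam t => lam (subst (liftSub f) t)

/-- The substitution that replaces the variable `0` by `s` and lowers all other variables. -/
def headSub (s : LamTerm C) : ℕ → LamTerm C
  | 0 => s
  | n + 1 => var n

/-- βη-equivalence of λ-terms. -/
inductive BetaEta : LamTerm C → LamTerm C → Prop
  | beta (t s : LamTerm C) : BetaEta (app (lam t) s) (subst (headSub s) t)
  | eta (t : LamTerm C) : BetaEta (lam (app (rename Nat.succ t) (var 0))) t
  | refl (t : LamTerm C) : BetaEta t t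
  | symm {t s : LamTerm C} : BetaEta t s → BetaEta s t
  | trans {t s u : LamTerm C} : BetaEta t s → BetaEta s u → BetaEta t u
  | app {t t' s s' : LamTerm C} : BetaEta t t' → BetaEta s s' → BetaEta (app t s) (app t' s')
  | lam {t t' : LamTerm C} : BetaEta t t' → BetaEta (lam t) (lam t')

/-- The homomorphic extension to terms of a map from constants to (closed) terms. -/
def mapConst (g : C → LamTerm D) : LamTerm C → LamTerm D
  | var n => var n
  | const c => g c
  | app t s => app (mapConst g t) (mapConst g s)
  | lam t => lam (mapConst g t)

/-- The λ-term `ρ(a₁…aₙ) = λ x. a₁ (… (aₙ x) …)` representing a word. -/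
def ofWord (w : List C) : LamTerm C :=
  lam (w.foldr (fun a t => app (const a) t) (var 0))

end LamTerm

/-- A λ-signature with atomic types `P` and constants `C`: an assignment of a type to every
constant.  (`P` and `C` are finite; this is imposed where signatures are used.) -/
structure LamSignature (P C : Type*) where
  typ : C → ImpType P

/-- Derivability of linear λ-typing judgements in a signature.  A typing context is a finite
multiset of typing assumptions, a variable being a de Bruijn index; all variables in the context of
a derivable judgement are distinct, by the side condition in `app`. -/
inductive LamSignature.Derivable {P C : Type*} (sig : LamSignature P C) :
    Multiset (ℕ × ImpType P) → LamTerm C → ImpType P → Prop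
  | var (n : ℕ) (A : ImpType P) : sig.Derivable {(n, A)} (.var n) A
  | const (c : C) : sig.Derivable 0 (.const c) (sig.typ c)
  | app {X Y : Multiset (ℕ × ImpType P)} {t s : LamTerm C} {A B : ImpType P}
      (hdisj : ∀ x ∈ X, ∀ y ∈ Y, x.1 ≠ y.1) :
      sig.Derivable X t (.imp A B) → sig.Derivable Y s A → sig.Derivable (X + Y) (.app t s) B
  | lam {X : Multiset (ℕ × ImpType P)} {t : LamTerm C} {A B : ImpType P} :
      sig.Derivable ((0, A) ::ₘ X.map (fun x => (x.1 + 1, x.2))) t B →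
      sig.Derivable X (.lam t) (.imp A B)

/-- Maps of λ-signatures. -/
structure LamSignature.Hom {P C P' C' : Type*}
    (sig : LamSignature P C) (sig' : LamSignature P' C') where
  onType : ImpType P → ImpType P'
  onType_imp : ∀ A B, onType (.imp A B) = .imp (onType A) (onType B)
  onConst : C → LamTerm C'
  derivable : ∀ c, sig'.Derivable 0 (onConst c) (onType (sig.typ c))

/-- The λ-string signature over `T`: one atomic type `O = ImpType.atom ()`, and every letter is a
constant of type `O ⊸ O`. -/
def stringSignature (T : Type*) : LamSignature Unit T where
  typ := fun _ => .imp (.atom ()) (.atom ())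

/-- String abstract categorial grammars with atomic types `P`, constants `C` and terminal
alphabet `T`. -/
structure StringACG (P C T : Type*) [Finite P] [Finite C] [Finite T] where
  sig : LamSignature P C
  lexicon : sig.Hom (stringSignature T)
  start : P
  lexicon_start : lexicon.onType (.atom start) = .imp (.atom ()) (.atom ())

/-- The string language of a string ACG. -/
def StringACG.language {P C T : Type*} [Finite P] [Finite C] [Finite T]
    (G : StringACG P C T) : Set (List T) :=
  {w | ∃ t : LamTerm C, LamTerm.BetaEta (LamTerm.ofWord w) (t.mapConst G.lexicon.onConst) ∧
    G.sig.Derivable 0 t (.atom G.start)}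

/-! ## Tensor terms -/

/-- Raw term expressions over terminals `T` and indices `Ind`: `edge w i j` is `[w]` with upper
index `i` and lower index `j`, and `loop w` is `[w]` without indices. -/
inductive TensorExpr (T Ind : Type*) where
  | edge (w : List T) (i j : Ind) : TensorExpr T Ind
  | loop (w : List T) : TensorExpr T Ind
  | mul (t s : TensorExpr T Ind) : TensorExpr T Ind

namespace TensorExpr

variable {T Ind : Type*}

/-- The set of upper indices. -/
def sup : TensorExpr T Ind → Set Ind
  | edge _ i _ => {i}
  | loop _ => ∅
  | mul t s => sup t ∪ sup s

/-- The set of lower indices. -/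
def sub : TensorExpr T Ind → Set Ind
  | edge _ _ j => {j}
  | loop _ => ∅
  | mul t s => sub t ∪ sub s

/-- All indices, free or bound. -/
def ind (t : TensorExpr T Ind) : Set Ind := t.sup ∪ t.sub

/-- The free upper indices. -/
def fsup (t : TensorExpr T Ind) : Set Ind := t.sup \ t.sub

/-- The free lower indices. -/
def fsub (t : TensorExpr T Ind) : Set Ind := t.sub \ t.sup

/-- The raw expressions that are term expressions: no index is repeated as an upper index, or as a
lower index. -/
def WF : TensorExpr T Ind → Prop
  | edge _ _ _ => True
  | loop _ => True
  | mul t s => WF t ∧ WF s ∧ Disjoint t.sup s.sup ∧ Disjoint t.sub s.sub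

/-- Congruence: the smallest equivalence relation on well-formed term expressions that satisfies
the listed relations whenever both sides are well-formed. -/
inductive Cong : TensorExpr T Ind → TensorExpr T Ind → Prop
  | refl {t : TensorExpr T Ind} : t.WF → Cong t t
  | symm {t s : TensorExpr T Ind} : Cong t s → Cong s t
  | trans {t s k : TensorExpr T Ind} : Cong t s → Cong s k → Cong t k
  | assoc {t s k : TensorExpr T Ind} :
      (mul (mul t s) k).WF → Cong (mul (mul t s) k) (mul t (mul s k))
  | comm {t s : TensorExpr T Ind} : (mul t s).WF → Cong (mul t s) (mul s t)
  | mul {t s k : TensorExpr T Ind} :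
      Cong t s → (mul t k).WF → (mul s k).WF → Cong (mul t k) (mul s k)
  | concat {u v : List T} {i j k : Ind} : (mul (edge u j i) (edge v k j)).WF →
      Cong (mul (edge u j i) (edge v k j)) (edge (u ++ v) k i)
  | close {u : List T} {i : Ind} : Cong (edge u i i) (loop u)
  | cycle {u : List T} {a : T} : Cong (loop (u ++ [a])) (loop (a :: u))

/-- Apply a map to all indices. -/
def mapInd (f : Ind → Ind) : TensorExpr T Ind → TensorExpr T Ind
  | edge w i j => edge w (f i) (f j)
  | loop w => loop w
  | mul t s => mul (mapInd f t) (mapInd f s)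

/-- The Kronecker delta with the given sequences of upper and lower indices.  There is no empty
product of term expressions, so the delta of two empty sequences is undefined. -/
def delta : List Ind → List Ind → Option (TensorExpr T Ind)
  | [i], [j] => some (edge [] i j)
  | i :: I, j :: J => (delta I J).map (mul (edge [] i j))
  | _, _ => none

end TensorExpr

/-! ## Tensor types -/

/-- Literals: atomic type symbols and their duals. -/
inductive Literal (P : Type*) where
  | pos (p : P) : Literal P
  | neg (p : P) : Literal P

namespace Literal

variable {P : Type*}

/-- The dual literal. -/
def dual : Literal P → Literal P
  | pos p => neg p
  | neg p => pos p

/-- Valency of literals (number of upper indices, number of lower indices). -/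
def valency (v : P → ℕ × ℕ) : Literal P → ℕ × ℕ
  | pos p => v p
  | neg p => (v p).swap

end Literal

/-- Tensor type symbols (tensor types with all indices erased). -/
inductive TensorSymbol (P : Type*) where
  | lit (l : Literal P) : TensorSymbol P
  | tensor (A B : TensorSymbol P) : TensorSymbol P
  | par (A B : TensorSymbol P) : TensorSymbol P

/-- Raw tensor types: `lit l I J` is the literal `l` with upper indices `I` and lower
indices `J`. -/
inductive TensorType (P Ind : Type*) where
  | lit (l : Literal P) (I J : List Ind) : TensorType P Ind
  | tensor (A B : TensorType P Ind) : TensorType P Ind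
  | par (A B : TensorType P Ind) : TensorType P Ind

namespace TensorSymbol

variable {P : Type*}

/-- Duality of type symbols; it reverses the order of factors. -/
def dual : TensorSymbol P → TensorSymbol P
  | lit l => lit l.dual
  | tensor A B => par B.dual A.dual
  | par A B => tensor B.dual A.dual

/-- Valency of type symbols. -/
def valency (v : P → ℕ × ℕ) : TensorSymbol P → ℕ × ℕ
  | lit l => l.valency v
  | tensor A B => A.valency v + B.valency v
  | par A B => A.valency v + B.valency v

/-- The tensor type `A^I_J` with symbol `A`, ordered upper indices `I` and ordered lower
indices `J`. -/
def decorate (v : P → ℕ × ℕ) {Ind : Type*} :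
    TensorSymbol P → List Ind → List Ind → TensorType P Ind
  | lit l, I, J => .lit l I J
  | tensor A B, I, J =>
      .tensor (decorate v A (I.take (A.valency v).1) (J.take (A.valency v).2))
        (decorate v B (I.drop (A.valency v).1) (J.drop (A.valency v).2))
  | par A B, I, J =>
      .par (decorate v A (I.take (A.valency v).1) (J.take (A.valency v).2))
        (decorate v B (I.drop (A.valency v).1) (J.drop (A.valency v).2))

end TensorSymbol

namespace TensorType

variable {P Ind : Type*}

/-- The set of upper indices. -/
def sup : TensorType P Ind → Set Ind
  | lit _ I _ => {i | i ∈ I}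
  | tensor A B => sup A ∪ sup B
  | par A B => sup A ∪ sup B

/-- The set of lower indices. -/
def sub : TensorType P Ind → Set Ind
  | lit _ _ J => {j | j ∈ J}
  | tensor A B => sub A ∪ sub B
  | par A B => sub A ∪ sub B

/-- All indices. -/
def ind (A : TensorType P Ind) : Set Ind := A.sup ∪ A.sub

/-- The raw types that are tensor types: literals carry as many indices as their valency says, and
no index occurs twice. -/
def WF (v : P → ℕ × ℕ) : TensorType P Ind → Prop
  | lit l I J => I.length = (l.valency v).1 ∧ J.length = (l.valency v).2 ∧ (I ++ J).Nodup
  | tensor A B => WF v A ∧ WF v B ∧ Disjoint A.ind B.ind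
  | par A B => WF v A ∧ WF v B ∧ Disjoint A.ind B.ind

/-- Duality of tensor types. -/
def dual : TensorType P Ind → TensorType P Ind
  | lit l I J => lit l.dual J.reverse I.reverse
  | tensor A B => par B.dual A.dual
  | par A B => tensor B.dual A.dual

/-- Apply a map to all indices. -/
def mapInd (f : Ind → Ind) : TensorType P Ind → TensorType P Ind
  | lit l I J => lit l (I.map f) (J.map f)
  | tensor A B => tensor (mapInd f A) (mapInd f B)
  | par A B => par (mapInd f A) (mapInd f B)

end TensorType

/-! ## Typing judgements and tensor type calculus -/

/-- Syntactic tensor typing judgements `t ⊢ Γ`. -/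
structure SynJudgement {P : Type*} (v : P → ℕ × ℕ) (T Ind : Type*) where
  term : TensorExpr T Ind
  types : Multiset (TensorType P Ind)
  term_wf : term.WF
  types_wf : ∀ A ∈ types, A.WF v
  types_disjoint : types.Pairwise (fun A B => Disjoint A.ind B.ind)
  fsup_eq : term.fsup = {i | ∃ A ∈ types, i ∈ A.sub}
  fsub_eq : term.fsub = {i | ∃ A ∈ types, i ∈ A.sup}

namespace SynJudgement

variable {P : Type*} {v : P → ℕ × ℕ} {T Ind : Type*}

open Classical in
/-- The map on indices that replaces `i` by `i'`. -/
noncomputable def replace (i i' : Ind) : Ind → Ind := fun k => if k = i then i' else k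

/-- The two generators of congruence of syntactic typing judgements. -/
inductive Step : SynJudgement v T Ind → SynJudgement v T Ind → Prop
  | alpha {a b : SynJudgement v T Ind} {i i' : Ind} (hi : i ∈ a.term.fsup ∪ a.term.fsub)
      (hi' : i' ∉ a.term.ind) (hterm : b.term = a.term.mapInd (replace i i'))
      (htypes : b.types = a.types.map (TensorType.mapInd (replace i i'))) : Step a b
  | term {a b : SynJudgement v T Ind} (hterm : a.term.Cong b.term) (htypes : a.types = b.types) :
      Step a b

/-- Congruence: the smallest equivalence relation containing the generators. -/
instance setoid (v : P → ℕ × ℕ) (T Ind : Type*) : Setoid (SynJudgement v T Ind) :=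
  Relation.EqvGen.setoid Step

end SynJudgement

/-- Tensor typing judgements: congruence classes of syntactic ones. -/
def TypingJudgement {P : Type*} (v : P → ℕ × ℕ) (T Ind : Type*) : Type _ :=
  Quotient (SynJudgement.setoid v T Ind)

/-- The typing judgement represented by a syntactic typing judgement. -/
def SynJudgement.toJudgement {P : Type*} {v : P → ℕ × ℕ} {T Ind : Type*}
    (a : SynJudgement v T Ind) : TypingJudgement v T Ind :=
  Quotient.mk (SynJudgement.setoid v T Ind) a

/-- `DerivableFrom X σ`: there is a derivation tree of `σ` by the rules of tensor type calculus
whose leaves are axioms of the calculus and the elements of `X`, each used exactly once.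
The rules operate on representatives; the requirement that the conclusion is a syntactic typing
judgement rules out collisions of indices. -/
inductive DerivableFrom {P : Type*} {v : P → ℕ × ℕ} {T Ind : Type*} :
    Multiset (TypingJudgement v T Ind) → TypingJudgement v T Ind → Prop
  | leaf (a : TypingJudgement v T Ind) : DerivableFrom {a} a
  | id (p : P) (I J I' J' : List Ind) (c : SynJudgement v T Ind)
      (hterm : TensorExpr.delta (I' ++ J.reverse) (I.reverse ++ J') = some c.term)
      (htypes : c.types = {.lit (.neg p) I J, .lit (.pos p) J' I'}) :
      DerivableFrom 0 c.toJudgement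
  | cut {X Y : Multiset (TypingJudgement v T Ind)} {a b c : SynJudgement v T Ind}
      {Γ Θ : Multiset (TensorType P Ind)} {A : TensorType P Ind}
      (ha : a.types = A ::ₘ Γ) (hb : b.types = A.dual ::ₘ Θ)
      (hterm : c.term = a.term.mul b.term) (htypes : c.types = Γ + Θ) :
      DerivableFrom X a.toJudgement → DerivableFrom Y b.toJudgement →
      DerivableFrom (X + Y) c.toJudgement
  | par {X : Multiset (TypingJudgement v T Ind)} {a c : SynJudgement v T Ind}
      {Γ : Multiset (TensorType P Ind)} {A B : TensorType P Ind}
      (ha : a.types = A ::ₘ B ::ₘ Γ)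
      (hterm : c.term = a.term) (htypes : c.types = .par A B ::ₘ Γ) :
      DerivableFrom X a.toJudgement → DerivableFrom X c.toJudgement
  | tensor {X Y : Multiset (TypingJudgement v T Ind)} {a b c : SynJudgement v T Ind}
      {Γ Θ : Multiset (TensorType P Ind)} {A B : TensorType P Ind}
      (ha : a.types = A ::ₘ Γ) (hb : b.types = B ::ₘ Θ)
      (hterm : c.term = a.term.mul b.term) (htypes : c.types = .tensor A B ::ₘ (Γ + Θ)) :
      DerivableFrom X a.toJudgement → DerivableFrom Y b.toJudgement →
      DerivableFrom (X + Y) c.toJudgement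

/-- Tensor signatures with positive atomic type symbols `P` and terminals `T`. -/
structure TensorSignature (P T Ind : Type*) where
  valency : P → ℕ × ℕ
  axioms : Set (TypingJudgement valency T Ind)

/-- Derivability in a tensor signature. -/
def TensorSignature.Derivable {P T Ind : Type*} (sig : TensorSignature P T Ind)
    (a : TypingJudgement sig.valency T Ind) : Prop :=
  ∃ X : Multiset (TypingJudgement sig.valency T Ind), (∀ x ∈ X, x ∈ sig.axioms) ∧
    DerivableFrom X a

/-- Tensor grammars. -/
structure TensorGrammar (P T Ind : Type*) [Finite T] where
  sig : TensorSignature P T Ind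
  axioms_finite : sig.axioms.Finite
  start : P
  valency_start : sig.valency start = (1, 1)

/-- The language of a tensor grammar: all words `w` such that `[w]_i^j ⊢ S_j^i` is derivable. -/
def TensorGrammar.language {P T Ind : Type*} [Finite T] (G : TensorGrammar P T Ind) :
    Set (List T) :=
  {w | ∃ (i j : Ind) (a : SynJudgement G.sig.valency T Ind), a.term = .edge w j i ∧
    a.types = {.lit (.pos G.start) [i] [j]} ∧ G.sig.Derivable a.toJudgement}

/-! ## Tensor translation -/

/-- The translation of implicational types to tensor type symbols, `A ⊸ B` being `B ⅋ Ā`. -/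
def ImpType.tr {P : Type*} : ImpType P → TensorSymbol P
  | .atom p => .lit (.pos p)
  | .imp A B => .par B.tr A.tr.dual

/-- The tensor translation of derivable λ-typing judgements, given the valency `v` of atomic types
and, for every constant `c`, the translation `ax c` of the axiom `⊢ c : typ c`.

`Translates sig v ax L t A F e` says: there is a derivation in `sig` of the judgement
`x₁ : A₁, …, xₙ : Aₙ ⊢ t : A` whose tensor translation is represented by the syntactic typing
judgement `e ⊢ F₁, …, Fₙ, F`, where `L` consists of the triples `(xₖ, Aₖ, Fₖ)`.  Here `F` is a
tensor type with symbol `A.tr`, and `Fₖ` is a tensor type with symbol `Aₖ.tr.dual`, the link of the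
variable `xₖ`. -/
inductive Translates {P C T Ind : Type*} (sig : LamSignature P C) (v : P → ℕ × ℕ)
    (ax : C → Set (TypingJudgement v T Ind)) :
    Multiset (ℕ × ImpType P × TensorType P Ind) → LamTerm C → ImpType P →
      TensorType P Ind → TensorExpr T Ind → Prop
  | var (n : ℕ) (A : ImpType P) (I J I' J' : List Ind) (a : SynJudgement v T Ind)
      (hterm : TensorExpr.delta (I' ++ J.reverse) (I.reverse ++ J') = some a.term)
      (htypes : a.types = {A.tr.dual.decorate v I J, A.tr.decorate v J' I'}) :
      Translates sig v ax {(n, A, A.tr.dual.decorate v I J)} (.var n) A (A.tr.decorate v J' I')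
        a.term
  | const (c : C) (I J : List Ind) (a : SynJudgement v T Ind) (ha : a.toJudgement ∈ ax c)
      (htypes : a.types = {(sig.typ c).tr.decorate v I J}) :
      Translates sig v ax 0 (.const c) (sig.typ c) ((sig.typ c).tr.decorate v I J) a.term
  | app {L M : Multiset (ℕ × ImpType P × TensorType P Ind)} {t s : LamTerm C} {A B : ImpType P}
      {F H : TensorType P Ind} {d e : TensorExpr T Ind}
      (hdisj : ∀ x ∈ L, ∀ y ∈ M, x.1 ≠ y.1) (a : SynJudgement v T Ind)
      (hterm : a.term = d.mul e)
      (htypes : a.types = H ::ₘ (L.map (fun x => x.2.2) + M.map (fun x => x.2.2))) :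
      Translates sig v ax L t (.imp A B) (.par H F.dual) d → Translates sig v ax M s A F e →
      Translates sig v ax (L + M) (.app t s) B H (d.mul e)
  | lam {L : Multiset (ℕ × ImpType P × TensorType P Ind)} {t : LamTerm C} {A B : ImpType P}
      {F H : TensorType P Ind} {e : TensorExpr T Ind} :
      Translates sig v ax ((0, A, F) ::ₘ L.map (fun x => (x.1 + 1, x.2))) t B H e →
      Translates sig v ax L (.lam t) (.imp A B) (.par H F) e

/-- The valency of the atomic type `O` of strings. -/
def stringValency : Unit → ℕ × ℕ := fun _ => (1, 0)

/-- The axiom `[c]_i^j ⊢ O^i ⅋ Ō_j` of the tensor string signature, for a letter `c`.  (The set has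
one element, since typing judgements are taken up to renaming of indices.) -/
def stringAxiom {T : Type*} (Ind : Type*) (c : T) : Set (TypingJudgement stringValency T Ind) :=
  {b | ∃ (i j : Ind) (a : SynJudgement stringValency T Ind), b = a.toJudgement ∧
    a.term = .edge [c] j i ∧
    a.types = {.par (.lit (.pos ()) [i] []) (.lit (.neg ()) [] [j])}}

namespace StringACG

variable {P C T : Type*} [Finite P] [Finite C] [Finite T]

/-- An atomic type gets the valency of its image under the lexicon. -/
def valency (G : StringACG P C T) (p : P) : ℕ × ℕ :=
  (G.lexicon.onType (.atom p)).tr.valency stringValency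

/-- The tensor translation of the axiom `⊢ c : A` of the abstract signature: if the translation of
`⊢ φ(c) : φ(A)` in the string signature is `e ⊢ φ(A)^I_J`, it is the judgement `e ⊢ A^I_J`. -/
def axiomTranslation (G : StringACG P C T) (Ind : Type*) (c : C) :
    Set (TypingJudgement G.valency T Ind) :=
  {b | ∃ (I J : List Ind) (e : TensorExpr T Ind) (a : SynJudgement G.valency T Ind),
    Translates (stringSignature T) stringValency (stringAxiom Ind) 0 (G.lexicon.onConst c)
      (G.lexicon.onType (G.sig.typ c))
      ((G.lexicon.onType (G.sig.typ c)).tr.decorate stringValency I J) e ∧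
    b = a.toJudgement ∧ a.term = e ∧ a.types = {(G.sig.typ c).tr.decorate G.valency I J}}

/-- The tensor signature whose axioms are the translations of the axioms of the abstract
signature. -/
def tensorSignature (G : StringACG P C T) (Ind : Type*) : TensorSignature P T Ind where
  valency := G.valency
  axioms := {b | ∃ c : C, b ∈ G.axiomTranslation Ind c}

theorem valency_start (G : StringACG P C T) : G.valency G.start = (1, 1) := by
  simp [valency, G.lexicon_start, ImpType.tr, TensorSymbol.valency, TensorSymbol.dual,
    Literal.dual, Literal.valency, stringValency]

/-- The tensor representation of a string ACG. -/
def tensorRepresentation (G : StringACG P C T) (Ind : Type*)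
    (hfin : (G.tensorSignature Ind).axioms.Finite) : TensorGrammar P T Ind where
  sig := G.tensorSignature Ind
  axioms_finite := hfin
  start := G.start
  valency_start := G.valency_start

end StringACG

/-! ## Substitution and βη-equivalence -/

namespace LamTerm

variable {C D : Type*}

/-! The proof is semantic; normalisation is used for neither calculus. Fix relations `R w` between
values such that `R (u ++ v)` is the composite of `R u` and `R v`. An assignment of values to
indices satisfies a tensor term if every edge `[w]^i_j` relates the value of `j` to the value of `i`
by `R w`. The values that the types of a judgement take under satisfying assignments depend only on
its congruence class (`TensorExpr.Cong.satFree_iff`, `SynJudgement.values_eq`). Two models are used.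
In the word model `R w x y` means `x = w ++ y`, so an index is a position in a word, given by the
suffix that begins there. In the order model values are rationals and every edge decreases them
strictly, so that a satisfiable term has no cycles and is congruent to a product of edges without
bound indices.

For `L(G) ⊆ L(G̃)`, a derivation in the tensor calculus is built along a typing derivation of an
abstract term `t` (`exists_represents`), and its tensor term is controlled by a logical predicate in
each model. In the order model the predicate forces sets of values to be nonempty; the tensor term
of a closed `t : S` is therefore acyclic, hence congruent to one edge `[w']^j_i`
(`TensorExpr.exists_cong_edge`). In the word model the predicate says that `φ(t)` maps the position
after `w'` to the position before it, so that `φ(t)` is βη-equivalent to `ρ(w')`. If also `ρ(w) ∼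
φ(t)`, then `w = w'` by `LamTerm.ofWord_injective_betaEta`, where an extensional graph model takes
the place of confluence.

For `L(G̃) ⊆ L(G)`, the difficulty is that a tensor derivation may pass through judgements that
translate no λ-judgement. An assignment in the word model turns types into implicational types whose
atoms are decorated with words. These are interpreted in a phase space whose pole is derivability in
linear natural deduction, with the decorated types realized by constants as axioms. Every rule of
the tensor calculus preserves validity (`DerivableFrom.valid`); by completeness a valid
implicational type has a natural deduction proof (`TensorType.natDed_of_valid`); and such a proof
yields an abstract term together with a realization by its image (`ImpType.NatDed.exists_term`).

The set of axioms is finite because a translation of `φ(c)` is acyclic and its words have total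
length equal to the number of constants in `φ(c)`. Its normal form is a product of edges between the
indices of a fixed type, with words of bounded length. -/

theorem liftRen_comp (f g : ℕ → ℕ) : liftRen f ∘ liftRen g = liftRen (f ∘ g) := by
  funext n; cases n <;> rfl

theorem rename_rename (f g : ℕ → ℕ) (t : LamTerm C) :
    rename f (rename g t) = rename (f ∘ g) t := by
  induction t generalizing f g with
  | var n => rfl
  | const c => rfl
  | app t s iht ihs => simp only [rename, iht, ihs]
  | lam t ih => simp only [rename, ih, liftRen_comp]

theorem subst_rename (σ : ℕ → LamTerm C) (f : ℕ → ℕ) (t : LamTerm C) :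
    subst σ (rename f t) = subst (σ ∘ f) t := by
  induction t generalizing σ f with
  | var n => rfl
  | const c => rfl
  | app t s iht ihs => simp only [rename, subst, iht, ihs]
  | lam t ih =>
    simp only [rename, subst, ih]
    congr 2
    funext n; cases n <;> rfl

theorem rename_subst (f : ℕ → ℕ) (σ : ℕ → LamTerm C) (t : LamTerm C) :
    rename f (subst σ t) = subst (fun n => rename f (σ n)) t := by
  induction t generalizing σ f with
  | var n => rfl
  | const c => rfl
  | app t s iht ihs => simp only [rename, subst, iht, ihs]
  | lam t ih =>
    simp only [rename, subst, ih]
    congr 2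
    funext n
    cases n with
    | zero => rfl
    | succ n => simp only [liftSub, rename_rename]; rfl

theorem subst_subst (τ σ : ℕ → LamTerm C) (t : LamTerm C) :
    subst τ (subst σ t) = subst (fun n => subst τ (σ n)) t := by
  induction t generalizing σ τ with
  | var n => rfl
  | const c => rfl
  | app t s iht ihs => simp only [subst, iht, ihs]
  | lam t ih =>
    simp only [subst, ih]
    congr 2
    funext n
    cases n with
    | zero => rfl
    | succ n => simp only [liftSub, rename_subst, subst_rename]; rfl

theorem subst_var (t : LamTerm C) : subst var t = t := by
  induction t with
  | var n => rfl
  | const c => rfl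
  | app t s iht ihs => simp only [subst, iht, ihs]
  | lam t ih =>
    have h : liftSub (var : ℕ → LamTerm C) = var := by funext n; cases n <;> rfl
    simp only [subst, h, ih]

theorem subst_var_comp (f : ℕ → ℕ) (t : LamTerm C) : subst (var ∘ f) t = rename f t := by
  rw [← subst_rename, subst_var]

/-- Extend a substitution by a term for the variable `0`. -/
def consSub (s : LamTerm C) (σ : ℕ → LamTerm C) : ℕ → LamTerm C
  | 0 => s
  | n + 1 => σ n

/-- The β-reduct of a substituted abstraction is one simultaneous substitution. Inductions over
typing derivations can therefore quantify over a single substitution throughout. -/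
theorem subst_headSub_liftSub (s : LamTerm C) (σ : ℕ → LamTerm C) (t : LamTerm C) :
    subst (headSub s) (subst (liftSub σ) t) = subst (consSub s σ) t := by
  rw [subst_subst]
  congr 1
  funext n
  cases n with
  | zero => rfl
  | succ n =>
    simp only [liftSub, subst_rename, consSub]
    exact subst_var (σ n)

theorem mapConst_const (t : LamTerm C) : t.mapConst const = t := by
  induction t with
  | var n => rfl
  | const c => rfl
  | app t s iht ihs => simp only [mapConst, iht, ihs]
  | lam t ih => simp only [mapConst, ih]

/-- The body `a₁ (… (aₙ x) …)` of the representation of a word, applied to the variable `0`. -/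
def wordBody (w : List C) : LamTerm C := w.foldr (fun a t => app (const a) t) (var 0)

/-- The number of occurrences of constants. -/
def numConst : LamTerm C → ℕ
  | var _ => 0
  | const _ => 1
  | app t s => numConst t + numConst s
  | lam t => numConst t

/-! ### Logical predicates on terms -/

/-- The logical predicate over implicational types generated by a family of predicates indexed by
the atoms. -/
def Realizes {Q : Type*} (base : Q → LamTerm C → Prop) : ImpType Q → LamTerm C → Prop
  | .atom q, u => base q u
  | .imp A B, u => ∀ s, Realizes base A s → Realizes base B (app u s)

theorem Realizes.of_betaEta {Q : Type*} {base : Q → LamTerm C → Prop}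
    (hbase : ∀ q u u', BetaEta u u' → base q u → base q u') {A : ImpType Q} {u u' : LamTerm C}
    (h : BetaEta u u') (hu : Realizes base A u) : Realizes base A u' := by
  induction A generalizing u u' with
  | atom q => exact hbase q u u' h hu
  | imp A B _ ihB => exact fun s hs => ihB (.app h (.refl s)) (hu s hs)

/-- Closure under βη-equivalence, used as closure under β-expansion. -/
theorem Realizes.lam {Q : Type*} {base : Q → LamTerm C → Prop}
    (hbase : ∀ q u u', BetaEta u u' → base q u → base q u') {A B : ImpType Q} {t : LamTerm C}
    {σ : ℕ → LamTerm C}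
    (h : ∀ s, Realizes base A s → Realizes base B (subst (consSub s σ) t)) :
    Realizes base (.imp A B) (subst σ (.lam t)) := by
  intro s hs
  refine Realizes.of_betaEta hbase (.symm (.beta _ _)) ?_
  rw [subst_headSub_liftSub]
  exact h s hs

end LamTerm

/-! ## An extensional graph model -/

/-- The points of an extensional graph model of the λ-calculus: basic points labelled by words and
step functions. -/
inductive GraphPoint (T : Type*) where
  | base (x : List T) : GraphPoint T
  | arr (l : List (GraphPoint T)) (b : GraphPoint T) : GraphPoint T

namespace GraphPoint

variable {T : Type*}

/-- The word in the target of a point. -/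
def target : GraphPoint T → List T
  | base x => x
  | arr _ b => target b

/-- The preorder of points; a basic point is identified with a constant function. -/
inductive Le : GraphPoint T → GraphPoint T → Prop
  | refl (a : GraphPoint T) : Le a a
  | trans {a b c : GraphPoint T} : Le a b → Le b c → Le a c
  | arr {l l' : List (GraphPoint T)} {b b' : GraphPoint T} (f : GraphPoint T → GraphPoint T)
      (hf : ∀ a ∈ l, f a ∈ l') (hle : ∀ a ∈ l, Le (f a) a) : Le b b' → Le (arr l b) (arr l' b')
  | base_arr (x : List T) (l : List (GraphPoint T)) : Le (base x) (arr l (base x))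
  | arr_base (x : List T) : Le (arr [] (base x)) (base x)

/-- Comparable points end in the same word; this invariant is what separates distinct words in
`interp_wordBody`. -/
theorem Le.target_eq {a b : GraphPoint T} (h : Le a b) : a.target = b.target := by
  induction h with
  | refl a => rfl
  | trans _ _ h₁ h₂ => exact h₁.trans h₂
  | arr f hf hle _ _ ih => exact ih
  | base_arr x l => rfl
  | arr_base x => rfl

/-- The upward closure of a list of points. -/
def up (l : List (GraphPoint T)) : Set (GraphPoint T) := {b | ∃ a ∈ l, Le a b}

/-- Upward closed sets of points. -/
def Closed (X : Set (GraphPoint T)) : Prop := ∀ a ∈ X, ∀ b, Le a b → b ∈ X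

theorem closed_up (l : List (GraphPoint T)) : Closed (up l) :=
  fun _ ⟨c, hc, hca⟩ _ hab => ⟨c, hc, hca.trans hab⟩

theorem up_subset {l : List (GraphPoint T)} {X : Set (GraphPoint T)} (hX : Closed X)
    (h : ∀ a ∈ l, a ∈ X) : up l ⊆ X :=
  fun _ ⟨c, hc, hca⟩ => hX c (h c hc) _ hca

theorem up_mono {l l' : List (GraphPoint T)} (h : ∀ a ∈ l, a ∈ l') : up l ⊆ up l' :=
  fun _ ⟨c, hc, hca⟩ => ⟨c, h c hc, hca⟩

/-- Application of sets of points. -/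
def app (X Y : Set (GraphPoint T)) : Set (GraphPoint T) :=
  {b | ∃ l, (∀ a ∈ l, a ∈ Y) ∧ arr l b ∈ X}

/-- Abstraction of a function on sets of points. -/
def abs (f : Set (GraphPoint T) → Set (GraphPoint T)) : Set (GraphPoint T) :=
  {a | match a with
    | base x => base x ∈ f (up [])
    | arr l b => b ∈ f (up l)}

theorem closed_app {X Y : Set (GraphPoint T)} (hX : Closed X) : Closed (app X Y) :=
  fun _ ⟨l, hl, h⟩ _ hab =>
    ⟨l, hl, hX _ h _ (.arr id (fun _ h => h) (fun a _ => .refl a) hab)⟩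

/-- The two rules that identify `base x` with a constant function respect `abs`, since `abs`
evaluates `base x` at `up []`, as it does `arr [] (base x)`. -/
theorem closed_abs {f : Set (GraphPoint T) → Set (GraphPoint T)} (hf : Monotone f)
    (hc : ∀ Y, Closed Y → Closed (f Y)) : Closed (abs f) := by
  intro a ha b hab
  induction hab with
  | refl a => exact ha
  | trans _ _ h₁ h₂ => exact h₂ (h₁ ha)
  -- The map `g` exhibits `up l ⊆ up l'`, so monotonicity carries `b` from `f (up l)` to `f (up
  -- l')`.
  | @arr l l' b b' g hg hle hbb _ =>
    refine hc _ (closed_up _) b ?_ b' hbb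
    refine hf (up_subset (closed_up _) fun a ha => ?_) ha
    exact ⟨g a, hg a ha, hle a ha⟩
  | base_arr x l => exact hf (up_mono (by simp)) ha
  | arr_base x => exact ha

/-- Extend an environment by a value of the variable `0`. -/
def consEnv (Y : Set (GraphPoint T)) (ρ : ℕ → Set (GraphPoint T)) : ℕ → Set (GraphPoint T)
  | 0 => Y
  | n + 1 => ρ n

theorem closed_consEnv {Y : Set (GraphPoint T)} {ρ : ℕ → Set (GraphPoint T)} (hY : Closed Y)
    (hρ : ∀ n, Closed (ρ n)) : ∀ n, Closed (consEnv Y ρ n)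
  | 0 => hY
  | n + 1 => hρ n

theorem consEnv_mono {Y Y' : Set (GraphPoint T)} {ρ ρ' : ℕ → Set (GraphPoint T)} (hY : Y ⊆ Y')
    (hρ : ∀ n, ρ n ⊆ ρ' n) : ∀ n, consEnv Y ρ n ⊆ consEnv Y' ρ' n
  | 0 => hY
  | n + 1 => hρ n

/-- The interpretation of λ-terms. -/
def interp : LamTerm T → (ℕ → Set (GraphPoint T)) → Set (GraphPoint T)
  | .var n, ρ => ρ n
  | .const c, _ => {b | ∃ x, Le (arr [base x] (base (c :: x))) b}
  | .app t s, ρ => app (interp t ρ) (interp s ρ)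
  | .lam t, ρ => abs fun Y => interp t (consEnv Y ρ)

theorem interp_mono (t : LamTerm T) {ρ ρ' : ℕ → Set (GraphPoint T)} (h : ∀ n, ρ n ⊆ ρ' n) :
    interp t ρ ⊆ interp t ρ' := by
  induction t generalizing ρ ρ' with
  | var n => exact h n
  | const c => exact subset_rfl
  | app t s iht ihs => exact fun b ⟨l, hl, hb⟩ => ⟨l, fun a ha => ihs h (hl a ha), iht h hb⟩
  | lam t ih =>
    intro a ha
    cases a with
    | base x => exact ih (consEnv_mono subset_rfl h) ha
    | arr l b => exact ih (consEnv_mono subset_rfl h) ha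

theorem closed_interp (t : LamTerm T) {ρ : ℕ → Set (GraphPoint T)} (h : ∀ n, Closed (ρ n)) :
    Closed (interp t ρ) := by
  induction t generalizing ρ with
  | var n => exact h n
  | const c => exact fun a ⟨x, hx⟩ b hab => ⟨x, hx.trans hab⟩
  | app t s iht ihs => exact closed_app (iht h)
  | lam t ih =>
    exact closed_abs (fun Y Y' hY => interp_mono t (consEnv_mono hY fun _ => subset_rfl))
      fun Y hY => ih (closed_consEnv hY h)

/-- Continuity: a single point of the value consumes only finitely many points of each variable.
This is the nontrivial half of the β law, because `app` sees only finite parts of an argument. -/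
theorem exists_up_of_mem_interp (t : LamTerm T) {ρ : ℕ → Set (GraphPoint T)}
    (hρ : ∀ n, Closed (ρ n)) {a : GraphPoint T} (ha : a ∈ interp t ρ) :
    ∃ g : ℕ → List (GraphPoint T), (∀ n, ∀ b ∈ g n, b ∈ ρ n) ∧
      a ∈ interp t fun n => up (g n) := by
  induction t generalizing ρ a with
  | var n =>
    refine ⟨fun m => if m = n then [a] else [], fun m b hb => ?_, ?_⟩
    · by_cases h : m = n
      · subst h
        simp only [if_true, List.mem_singleton] at hb
        exact hb ▸ ha
      · simp [h] at hb
    · exact ⟨a, by simp, .refl a⟩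
  | const c => exact ⟨fun _ => [], by simp, ha⟩
  | app t s iht ihs =>
    obtain ⟨l, hl, hb⟩ := ha
    obtain ⟨g, hg, hgb⟩ := iht hρ hb
    have key : ∀ l : List (GraphPoint T), (∀ a ∈ l, a ∈ interp s ρ) →
        ∃ g : ℕ → List (GraphPoint T), (∀ n, ∀ b ∈ g n, b ∈ ρ n) ∧
          ∀ a ∈ l, a ∈ interp s fun n => up (g n) := by
      intro l
      induction l with
      | nil => exact fun _ => ⟨fun _ => [], by simp, by simp⟩
      | cons a l ih =>
        intro h
        obtain ⟨g, hg, hgl⟩ := ih fun b hb => h b (List.mem_cons_of_mem _ hb)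
        obtain ⟨g', hg', hga⟩ := ihs hρ (h a List.mem_cons_self)
        refine ⟨fun n => g n ++ g' n, fun n b hb => ?_, fun b hb => ?_⟩
        · rcases List.mem_append.1 hb with hb | hb
          exacts [hg n b hb, hg' n b hb]
        · rcases List.mem_cons.1 hb with rfl | hb
          · exact interp_mono s (fun n => up_mono fun _ h => List.mem_append_right _ h) hga
          · exact interp_mono s (fun n => up_mono fun _ h => List.mem_append_left _ h) (hgl b hb)
    obtain ⟨g', hg', hgl⟩ := key l hl
    refine ⟨fun n => g n ++ g' n, fun n b hb => ?_, l, fun b hb => ?_, ?_⟩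
    · rcases List.mem_append.1 hb with hb | hb
      exacts [hg n b hb, hg' n b hb]
    · exact interp_mono s (fun n => up_mono fun _ h => List.mem_append_right _ h) (hgl b hb)
    · exact interp_mono t (fun n => up_mono fun _ h => List.mem_append_left _ h) hgb
  | lam t ih =>
    have key : ∀ (l : List (GraphPoint T)) (b : GraphPoint T),
        b ∈ interp t (consEnv (up l) ρ) → ∃ g : ℕ → List (GraphPoint T),
          (∀ n, ∀ b ∈ g n, b ∈ ρ n) ∧ b ∈ interp t (consEnv (up l) fun n => up (g n)) := by
      intro l b hb
      obtain ⟨g, hg, hgb⟩ := ih (closed_consEnv (closed_up l) hρ) hb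
      -- The points consumed from variable `0` already lie in `up l`, so that component is dropped.
      refine ⟨fun n => g (n + 1), fun n => hg (n + 1), interp_mono t (fun n => ?_) hgb⟩
      cases n with
      | zero => exact up_subset (closed_up l) (hg 0)
      | succ n => exact subset_rfl
    cases a with
    | base x => exact key [] _ ha
    | arr l b => exact key l _ ha

theorem app_abs_interp (t : LamTerm T) {Y : Set (GraphPoint T)} {ρ : ℕ → Set (GraphPoint T)}
    (hY : Closed Y) (hρ : ∀ n, Closed (ρ n)) :
    app (abs fun Y => interp t (consEnv Y ρ)) Y = interp t (consEnv Y ρ) := by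
  ext b
  constructor
  · rintro ⟨l, hl, hb⟩
    exact interp_mono t (consEnv_mono (up_subset hY hl) fun _ => subset_rfl) hb
  · intro hb
    obtain ⟨g, hg, hgb⟩ := exists_up_of_mem_interp t (closed_consEnv hY hρ) hb
    refine ⟨g 0, hg 0, interp_mono t (fun n => ?_) hgb⟩
    cases n with
    | zero => exact subset_rfl
    | succ n => exact up_subset (hρ n) (hg (n + 1))

/-- The η law. A basic point enters the abstraction through an empty list of arguments, and
`Le.arr_base` and `Le.base_arr` convert this to membership in `X`. For a step function the points of
`l'` lie above points of `l`, which is the premise of `Le.arr`. -/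
theorem abs_app {X : Set (GraphPoint T)} (hX : Closed X) : abs (fun Y => app X Y) = X := by
  ext a
  cases a with
  | base x =>
    constructor
    · rintro ⟨l, hl, h⟩
      have hl : l = [] := by
        refine List.eq_nil_iff_forall_not_mem.2 fun a ha => ?_
        obtain ⟨b, hb, _⟩ := hl a ha
        simp at hb
      subst hl
      exact hX _ h _ (.arr_base x)
    · exact fun h => ⟨[], by simp, hX _ h _ (.base_arr x [])⟩
  | arr l b =>
    constructor
    · rintro ⟨l', hl', h⟩
      choose! f hf hle using hl'
      exact hX _ h _ (.arr f hf hle (.refl b))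
    · exact fun h => ⟨l, fun a ha => ⟨a, ha, .refl a⟩, h⟩

/-! ### Invariance of the interpretation under βη-equivalence -/

theorem interp_rename (f : ℕ → ℕ) (t : LamTerm T) (ρ : ℕ → Set (GraphPoint T)) :
    interp (t.rename f) ρ = interp t (ρ ∘ f) := by
  induction t generalizing f ρ with
  | var n => rfl
  | const c => rfl
  | app t s iht ihs => simp only [LamTerm.rename, interp, iht, ihs]
  | lam t ih =>
    simp only [LamTerm.rename, interp, ih]
    congr 2
    funext Y
    congr 1
    funext n; cases n <;> rfl

theorem interp_subst (σ : ℕ → LamTerm T) (t : LamTerm T) (ρ : ℕ → Set (GraphPoint T)) :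
    interp (t.subst σ) ρ = interp t fun n => interp (σ n) ρ := by
  induction t generalizing σ ρ with
  | var n => rfl
  | const c => rfl
  | app t s iht ihs => simp only [LamTerm.subst, interp, iht, ihs]
  | lam t ih =>
    simp only [LamTerm.subst, interp, ih]
    congr 2
    funext Y
    congr 1
    funext n
    cases n with
    | zero => rfl
    | succ n => simp only [LamTerm.liftSub, interp_rename]; rfl

theorem interp_eq_of_betaEta {t s : LamTerm T} (h : LamTerm.BetaEta t s)
    {ρ : ℕ → Set (GraphPoint T)} (hρ : ∀ n, Closed (ρ n)) : interp t ρ = interp s ρ := by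
  induction h generalizing ρ with
  | beta t s =>
    rw [interp_subst]
    refine (app_abs_interp t (closed_interp s hρ) hρ).trans ?_
    congr 1
    funext n; cases n <;> rfl
  | eta t =>
    refine Eq.trans ?_ (abs_app (closed_interp t hρ))
    simp only [interp, interp_rename]
    rfl
  | refl t => rfl
  | symm _ ih => exact (ih hρ).symm
  | trans _ _ ih₁ ih₂ => exact (ih₁ hρ).trans (ih₂ hρ)
  | app _ _ ih₁ ih₂ => simp only [interp, ih₁ hρ, ih₂ hρ]
  | @lam t t' _ ih =>
    -- Bodies are evaluated only at sets `up l`, which are closed, so the induction hypothesis on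
    -- closed environments suffices.
    have key : ∀ l, interp t (consEnv (up l) ρ) = interp t' (consEnv (up l) ρ) :=
      fun l => ih (closed_consEnv (closed_up l) hρ)
    ext a
    cases a with
    | base x => exact (Set.ext_iff.1 (key [])) _
    | arr l b => exact (Set.ext_iff.1 (key l)) _

/-- Going up, the domain of a step function can only gain points or have them replaced by smaller
ones with the same target. A step function drops to a basic point only from an empty domain, which
is excluded by `d`. -/
theorem exists_target_of_le_arr {x : List T} {a b : GraphPoint T} (h : Le a b)
    (ha : ∃ l c, a = arr l c ∧ ∃ d ∈ l, target d = x) :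
    ∃ l c, b = arr l c ∧ ∃ d ∈ l, target d = x := by
  induction h with
  | refl a => exact ha
  | trans _ _ h₁ h₂ => exact h₂ (h₁ ha)
  | arr f hf hle _ _ =>
    obtain ⟨l, c, heq, d, hd, hx⟩ := ha
    cases heq
    exact ⟨_, _, rfl, f d, hf d hd, (hle d hd).target_eq.trans hx⟩
  | base_arr x l =>
    obtain ⟨l, c, heq, _⟩ := ha
    cases heq
  | arr_base x =>
    obtain ⟨l, c, heq, d, hd, _⟩ := ha
    cases heq
    simp at hd

/-- A letter `c` sends the point `x` to `c :: x`, so the common target of all points in the value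
spells out the word. -/
theorem interp_wordBody (w : List T) {ρ : ℕ → Set (GraphPoint T)} (hρ : ρ 0 = up [base []]) :
    base w ∈ interp (LamTerm.wordBody w) ρ ∧
      ∀ a ∈ interp (LamTerm.wordBody w) ρ, a.target = w := by
  induction w with
  | nil =>
    simp only [LamTerm.wordBody, List.foldr, interp, hρ]
    refine ⟨⟨base [], by simp, .refl _⟩, ?_⟩
    rintro a ⟨b, hb, hle⟩
    rw [List.mem_singleton.1 hb] at hle
    exact hle.target_eq.symm
  | cons c w ih =>
    refine ⟨⟨[base w], fun a ha => ?_, w, .refl _⟩, ?_⟩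
    · rw [List.mem_singleton.1 ha]
      exact ih.1
    · rintro a ⟨l, hl, x, hx⟩
      obtain ⟨l', b', heq, d, hd, hdx⟩ := exists_target_of_le_arr (x := x) hx
        ⟨_, _, rfl, base x, by simp, rfl⟩
      cases heq
      have : target a = c :: x := hx.target_eq.symm
      rw [this, ← hdx, ih.2 d (hl d hd)]

end GraphPoint

/-- The point that maps the empty word to `w` lies in the value of `ofWord w`, while the body of
`ofWord w'` at the empty word contains only points with target `w'`. -/
theorem LamTerm.ofWord_injective_betaEta {T : Type*} {w w' : List T}
    (h : BetaEta (ofWord w) (ofWord w')) : w = w' := by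
  let ρ : ℕ → Set (GraphPoint T) := fun _ => ∅
  have hρ : ∀ n, GraphPoint.Closed (ρ n) := fun _ a ha => ha.elim
  have hmem : GraphPoint.arr [.base []] (.base w) ∈ GraphPoint.interp (ofWord w) ρ :=
    (GraphPoint.interp_wordBody w rfl).1
  rw [GraphPoint.interp_eq_of_betaEta h hρ] at hmem
  exact (GraphPoint.interp_wordBody w' (ρ := GraphPoint.consEnv (GraphPoint.up [.base []]) ρ)
    rfl).2 _ hmem

/-! ## Models of tensor terms -/

namespace TensorExpr

variable {T Ind X : Type*}

/-- Word-indexed relations that turn concatenation into composition. -/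
def IsModel (R : List T → X → X → Prop) : Prop :=
  ∀ u v x z, R (u ++ v) x z ↔ ∃ y, R u x y ∧ R v y z

/-- An assignment of values to indices satisfies a term if all its factors are satisfied; an edge
relates the value of its lower index to the value of its upper index. -/
def Sat (R : List T → X → X → Prop) (ν : Ind → X) : TensorExpr T Ind → Prop
  | edge w i j => R w (ν j) (ν i)
  | loop w => ∃ x, R w x x
  | mul t s => Sat R ν t ∧ Sat R ν s

/-- The bound indices of a term. -/
def bound (t : TensorExpr T Ind) : Set Ind := t.sup ∩ t.sub

/-- The total length of the words in a term. -/
def len : TensorExpr T Ind → ℕ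
  | edge w _ _ => w.length
  | loop w => w.length
  | mul t s => len t + len s

theorem ind_mul (t s : TensorExpr T Ind) : (mul t s).ind = t.ind ∪ s.ind := by
  simp only [ind, sup, sub]
  exact Set.union_union_union_comm _ _ _ _

theorem ind_eq (t : TensorExpr T Ind) : t.ind = t.fsup ∪ t.fsub ∪ t.bound := by
  ext i
  simp only [ind, fsup, fsub, bound, Set.mem_union, Set.mem_sdiff, Set.mem_inter_iff]
  tauto

theorem finite_sup (t : TensorExpr T Ind) : t.sup.Finite := by
  induction t with
  | edge w i j => exact Set.finite_singleton i
  | loop w => exact Set.finite_empty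
  | mul t s iht ihs => exact iht.union ihs

theorem finite_sub (t : TensorExpr T Ind) : t.sub.Finite := by
  induction t with
  | edge w i j => exact Set.finite_singleton j
  | loop w => exact Set.finite_empty
  | mul t s iht ihs => exact iht.union ihs

theorem finite_ind (t : TensorExpr T Ind) : t.ind.Finite := t.finite_sup.union t.finite_sub

theorem Sat.congr {R : List T → X → X → Prop} {ν ν' : Ind → X} {t : TensorExpr T Ind}
    (h : ∀ i ∈ t.ind, ν i = ν' i) (ht : Sat R ν t) : Sat R ν' t := by
  induction t with
  | edge w i j =>
    simp only [Sat] at ht ⊢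
    rwa [← h i (Or.inl rfl), ← h j (Or.inr rfl)]
  | loop w => exact ht
  | mul t s iht ihs =>
    rw [ind_mul] at h
    exact ⟨iht (fun i hi => h i (Or.inl hi)) ht.1, ihs (fun i hi => h i (Or.inr hi)) ht.2⟩

theorem sat_mapInd {R : List T → X → X → Prop} {ν : Ind → X} {f : Ind → Ind}
    {t : TensorExpr T Ind} : Sat R ν (t.mapInd f) ↔ Sat R (ν ∘ f) t := by
  induction t with
  | edge w i j => rfl
  | loop w => rfl
  | mul t s iht ihs => exact and_congr iht ihs

theorem sup_mapInd (f : Ind → Ind) (t : TensorExpr T Ind) : (t.mapInd f).sup = f '' t.sup := by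
  induction t with
  | edge w i j => simp [mapInd, sup]
  | loop w => simp [mapInd, sup]
  | mul t s iht ihs => simp only [mapInd, sup, iht, ihs, Set.image_union]

theorem sub_mapInd (f : Ind → Ind) (t : TensorExpr T Ind) : (t.mapInd f).sub = f '' t.sub := by
  induction t with
  | edge w i j => simp [mapInd, sub]
  | loop w => simp [mapInd, sub]
  | mul t s iht ihs => simp only [mapInd, sub, iht, ihs, Set.image_union]

theorem ind_mapInd (f : Ind → Ind) (t : TensorExpr T Ind) : (t.mapInd f).ind = f '' t.ind := by
  simp only [ind, sup_mapInd, sub_mapInd, Set.image_union]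

theorem len_mapInd (f : Ind → Ind) (t : TensorExpr T Ind) : (t.mapInd f).len = t.len := by
  induction t with
  | edge w i j => rfl
  | loop w => rfl
  | mul t s iht ihs => simp only [mapInd, len, iht, ihs]

theorem WF.mapInd {f : Ind → Ind} {t : TensorExpr T Ind} (ht : t.WF) (hf : Set.InjOn f t.ind) :
    (t.mapInd f).WF := by
  induction t with
  | edge w i j => trivial
  | loop w => trivial
  | mul t s iht ihs =>
    obtain ⟨h₁, h₂, h₃, h₄⟩ := ht
    rw [ind_mul] at hf
    refine ⟨iht h₁ (hf.mono Set.subset_union_left), ihs h₂ (hf.mono Set.subset_union_right), ?_, ?_⟩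
    · simp only [sup_mapInd]
      exact h₃.image hf (fun i hi => Or.inl (Or.inl hi)) fun i hi => Or.inr (Or.inl hi)
    · simp only [sub_mapInd]
      exact h₄.image hf (fun i hi => Or.inl (Or.inr hi)) fun i hi => Or.inr (Or.inr hi)

/-! ### Invariance under congruence -/

theorem Cong.wf {t s : TensorExpr T Ind} (h : Cong t s) : t.WF ∧ s.WF := by
  induction h with
  | refl h => exact ⟨h, h⟩
  | symm _ ih => exact ih.symm
  | trans _ _ ih₁ ih₂ => exact ⟨ih₁.1, ih₂.2⟩
  | assoc h =>
    refine ⟨h, ?_⟩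
    simp only [WF, sup, sub, Set.disjoint_union_left, Set.disjoint_union_right] at h ⊢
    tauto
  | comm h =>
    refine ⟨h, ?_⟩
    simp only [WF] at h ⊢
    exact ⟨h.2.1, h.1, h.2.2.1.symm, h.2.2.2.symm⟩
  | mul _ h₁ h₂ _ => exact ⟨h₁, h₂⟩
  | concat h => exact ⟨h, trivial⟩
  | close => exact ⟨trivial, trivial⟩
  | cycle => exact ⟨trivial, trivial⟩

theorem Cong.len_eq {t s : TensorExpr T Ind} (h : Cong t s) : t.len = s.len := by
  induction h with
  | refl h => rfl
  | symm _ ih => exact ih.symm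
  | trans _ _ ih₁ ih₂ => exact ih₁.trans ih₂
  | assoc h => simp only [len]; omega
  | comm h => simp only [len]; omega
  | mul _ h₁ h₂ ih => simp only [len, ih]
  | concat h => simp only [len, List.length_append]
  | close => rfl
  | cycle => simp [len]

theorem Cong.free_eq {t s : TensorExpr T Ind} (h : Cong t s) :
    t.fsup = s.fsup ∧ t.fsub = s.fsub := by
  induction h with
  | refl h => exact ⟨rfl, rfl⟩
  | symm _ ih => exact ⟨ih.1.symm, ih.2.symm⟩
  | trans _ _ ih₁ ih₂ => exact ⟨ih₁.1.trans ih₂.1, ih₁.2.trans ih₂.2⟩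
  | assoc h => simp only [fsup, fsub, sup, sub, Set.union_assoc, and_self]
  | @comm t s h =>
    simp only [fsup, fsub, sup, sub, Set.union_comm s.sup, Set.union_comm s.sub, and_self]
  | @mul t s k h h₁ h₂ ih =>
    simp only [WF, Set.disjoint_left] at h₁ h₂
    obtain ⟨-, -, h₃, h₄⟩ := h₁
    obtain ⟨-, -, h₅, h₆⟩ := h₂
    simp only [fsup, fsub, Set.ext_iff, Set.mem_sdiff, sup, sub, Set.mem_union] at ih ⊢
    refine ⟨fun i => ?_, fun i => ?_⟩ <;>
    · have := ih.1 i
      have := ih.2 i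
      have := @h₃ i
      have := @h₄ i
      have := @h₅ i
      have := @h₆ i
      clear h₃ h₄ h₅ h₆ ih
      grind
  | @concat u v i j k h =>
    simp only [WF, sup, sub, Set.disjoint_singleton] at h
    obtain ⟨-, -, hjk, hij⟩ := h
    simp only [fsup, fsub, sup, sub, Set.ext_iff, Set.mem_sdiff, Set.mem_union,
      Set.mem_singleton_iff]
    refine ⟨fun x => ?_, fun x => ?_⟩ <;> grind
  | close => simp [fsup, fsub, sup, sub]
  | cycle => exact ⟨rfl, rfl⟩

/-- A term is satisfied by an assignment of its free indices. -/
def SatFree (R : List T → X → X → Prop) (ν : Ind → X) (t : TensorExpr T Ind) : Prop :=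
  ∃ ν', (∀ i ∈ t.fsup ∪ t.fsub, ν' i = ν i) ∧ Sat R ν' t

theorem Sat.satFree {R : List T → X → X → Prop} {ν : Ind → X} {t : TensorExpr T Ind}
    (h : Sat R ν t) : SatFree R ν t :=
  ⟨ν, fun _ _ => rfl, h⟩

/-- When a factor of a product is replaced, the assignment need only change at the bound indices of
the new factor. By well-formedness these do not occur in the other factor, which thus stays
satisfied. -/
theorem SatFree.exists_eq_off_bound {R : List T → X → X → Prop} {ν : Ind → X}
    {t : TensorExpr T Ind} (h : SatFree R ν t) :
    ∃ ν', (∀ i ∉ t.bound, ν' i = ν i) ∧ Sat R ν' t := by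
  classical
  obtain ⟨ν', h₁, h₂⟩ := h
  refine ⟨fun i => if i ∈ t.ind then ν' i else ν i, fun i hi => ?_,
    h₂.congr fun i hi => by simp [hi]⟩
  by_cases hit : i ∈ t.ind
  · simp only [hit, if_true]
    rw [ind_eq] at hit
    exact h₁ i (hit.resolve_right hi)
  · simp [hit]

/-- Concatenation is the composition law of the model, and a loop asks for a value related to
itself, a condition that does not change when the word is rotated. Bound indices are quantified away
because concatenation deletes the middle index. -/
theorem Cong.satFree_iff {R : List T → X → X → Prop} (hR : IsModel R) {t s : TensorExpr T Ind}
    (h : Cong t s) (ν : Ind → X) : SatFree R ν t ↔ SatFree R ν s := by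
  classical
  induction h generalizing ν with
  | refl h => exact Iff.rfl
  | symm _ ih => exact (ih ν).symm
  | trans _ _ ih₁ ih₂ => exact (ih₁ ν).trans (ih₂ ν)
  | assoc h => simp only [SatFree, (Cong.assoc h).free_eq, Sat, and_assoc]
  | comm h => simp only [SatFree, (Cong.comm h).free_eq, Sat, and_comm]
  | @mul t s k h h₁ h₂ ih =>
    have key : ∀ {t s : TensorExpr T Ind}, (t.mul k).fsup = (s.mul k).fsup →
        (t.mul k).fsub = (s.mul k).fsub → (s.mul k).WF →
        (∀ ν, SatFree R ν t ↔ SatFree R ν s) → SatFree R ν (t.mul k) →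
          SatFree R ν (s.mul k) := by
      rintro t s e₁ e₂ hw ih ⟨ν₁, hν₁, ht, hk⟩
      obtain ⟨ν₂, hν₂, hs⟩ := ((ih ν₁).1 ht.satFree).exists_eq_off_bound
      simp only [WF, Set.disjoint_left] at hw
      refine ⟨ν₂, fun i hi => ?_, hs, hk.congr fun i hi => (hν₂ i ?_).symm⟩
      · rw [← hν₁ i (by rwa [e₁, e₂])]
        refine hν₂ i fun hb => ?_
        rcases hi with hi | hi
        · exact hi.2 (Or.inl hb.2)
        · exact hi.2 (Or.inl hb.1)
      · rintro ⟨hb₁, hb₂⟩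
        rcases hi with hi | hi
        · exact hw.2.2.1 hb₁ hi
        · exact hw.2.2.2 hb₂ hi
    have hfree := (Cong.mul h h₁ h₂).free_eq
    exact ⟨key hfree.1 hfree.2 h₂ ih, key hfree.1.symm hfree.2.symm h₁ fun ν => (ih ν).symm⟩
  | @concat u v i j k h =>
    simp only [SatFree, (Cong.concat h).free_eq, Sat, hR u v]
    simp only [WF, sup, sub, Set.disjoint_singleton] at h
    obtain ⟨-, -, hjk, hij⟩ := h
    constructor
    · rintro ⟨ν', h, h₁, h₂⟩
      exact ⟨ν', h, ν' j, h₁, h₂⟩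
    · rintro ⟨ν', h, y, h₁, h₂⟩
      -- The erased middle index takes the intermediate value; it is not free and differs from `i`
      -- and `k` by well-formedness.
      refine ⟨Function.update ν' j y, fun x hx => ?_, ?_, ?_⟩
      · rw [Function.update_of_ne, h x hx]
        rintro rfl
        simp only [fsup, fsub, sup, sub, Set.mem_union, Set.mem_sdiff, Set.mem_singleton_iff] at hx
        tauto
      · simpa [Function.update_of_ne hij] using h₁
      · simpa [Function.update_of_ne hjk.symm] using h₂
  | @close u i =>
    constructor
    · rintro ⟨ν', -, h⟩
      exact ⟨ν, fun _ _ => rfl, _, h⟩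
    · rintro ⟨ν', -, x, h⟩
      exact ⟨fun _ => x, by simp [fsup, fsub, sup, sub], h⟩
  | @cycle u a =>
    have : (∃ x, R (u ++ [a]) x x) ↔ ∃ x, R (a :: u) x x := by
      rw [show a :: u = [a] ++ u from rfl]
      simp only [hR u [a], hR [a] u]
      exact ⟨fun ⟨x, y, h₁, h₂⟩ => ⟨y, x, h₂, h₁⟩, fun ⟨x, y, h₁, h₂⟩ => ⟨y, x, h₂, h₁⟩⟩
    simp only [SatFree, Sat, this]
    rfl

/-! ### Words and orders as models -/

/-- The model of positions in a word, a position being given by a suffix. -/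
def suffixRel (w x y : List T) : Prop := x = w ++ y

theorem isModel_suffixRel : IsModel (suffixRel (T := T)) := by
  intro u v x z
  simp only [suffixRel, List.append_assoc]
  exact ⟨fun h => ⟨v ++ z, h, rfl⟩, fun ⟨y, h, hy⟩ => hy ▸ h⟩

/-- The model in which values decrease strictly along edges. -/
def orderRel (_ : List T) (x y : ℚ) : Prop := y < x

/-- Density of the rationals supplies the intermediate value. Edges with the empty word are strict
too, so the empty word does not act as equality in this model. -/
theorem isModel_orderRel : IsModel (orderRel (T := T)) := by
  intro u v x z
  constructor
  · intro h
    obtain ⟨y, h₁, h₂⟩ := exists_between (show z < x from h)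
    exact ⟨y, h₂, h₁⟩
  · rintro ⟨y, h₁, h₂⟩
    exact lt_trans h₂ h₁

/-! ### Normal forms -/

/-- The product of a list of edges, given by words, upper indices and lower indices.  The product of
the empty list is a dummy. -/
def prod : List (List T × Ind × Ind) → TensorExpr T Ind
  | [] => loop []
  | [e] => edge e.1 e.2.1 e.2.2
  | e :: e' :: l => mul (edge e.1 e.2.1 e.2.2) (prod (e' :: l))

theorem prod_cons (e : List T × Ind × Ind) {l : List (List T × Ind × Ind)} (hl : l ≠ []) :
    prod (e :: l) = mul (edge e.1 e.2.1 e.2.2) (prod l) := by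
  cases l with
  | nil => exact absurd rfl hl
  | cons e' l => rfl

theorem sup_prod (l : List (List T × Ind × Ind)) : (prod l).sup = {i | i ∈ l.map (·.2.1)} := by
  induction l with
  | nil => simp [prod, sup]
  | cons e l ih =>
    cases l with
    | nil => simp [prod, sup]
    | cons e' l => rw [prod, sup, ih]; ext; simp [sup]

theorem sub_prod (l : List (List T × Ind × Ind)) : (prod l).sub = {i | i ∈ l.map (·.2.2)} := by
  induction l with
  | nil => simp [prod, sub]
  | cons e l ih =>
    cases l with
    | nil => simp [prod, sub]
    | cons e' l => rw [prod, sub, ih]; ext; simp [sub]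

theorem wf_prod (l : List (List T × Ind × Ind)) :
    (prod l).WF ↔ (l.map (·.2.1)).Nodup ∧ (l.map (·.2.2)).Nodup := by
  induction l with
  | nil => simp [prod, WF]
  | cons e l ih =>
    cases l with
    | nil => simp [prod, WF]
    | cons e' l =>
      rw [prod, WF, ih, sup_prod, sub_prod]
      change _ ↔ (e.2.1 :: (e' :: l).map (·.2.1)).Nodup ∧ (e.2.2 :: (e' :: l).map (·.2.2)).Nodup
      rw [List.nodup_cons, List.nodup_cons]
      simp only [WF, sup, sub, Set.disjoint_singleton_left, Set.mem_ofPred_eq, true_and]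
      tauto

theorem Cong.mul_left {k t s : TensorExpr T Ind} (h : Cong t s) (h₁ : (k.mul t).WF)
    (h₂ : (k.mul s).WF) : Cong (k.mul t) (k.mul s) :=
  (Cong.comm h₁).trans ((Cong.mul h (Cong.comm h₁).wf.2 (Cong.comm h₂).wf.2).trans
    (Cong.comm h₂).symm)

theorem prod_perm {l l' : List (List T × Ind × Ind)} (h : l.Perm l') (hl : (prod l).WF) :
    Cong (prod l) (prod l') := by
  have wf : ∀ {l l' : List (List T × Ind × Ind)}, l.Perm l' → (prod l).WF → (prod l').WF := by
    intro l l' h hl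
    rw [wf_prod] at hl ⊢
    exact ⟨(h.map _).nodup_iff.1 hl.1, (h.map _).nodup_iff.1 hl.2⟩
  induction h with
  | nil => exact .refl hl
  | @cons e l l' h ih =>
    by_cases hn : l = []
    · subst hn
      rw [List.nil_perm.1 h]
      exact .refl hl
    · have hn' : l' ≠ [] := fun h0 => hn (by subst h0; exact h.eq_nil)
      have hl' := wf (h.cons e) hl
      rw [prod_cons _ hn] at hl ⊢
      rw [prod_cons _ hn'] at hl' ⊢
      exact Cong.mul_left (ih hl.2.1) hl hl'
  | swap e e' l =>
    by_cases hn : l = []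
    · subst hn
      exact .comm hl
    · have hl' := wf (List.Perm.swap e e' l) hl
      rw [prod_cons _ (List.cons_ne_nil _ _), prod_cons _ hn] at hl hl' ⊢
      rw [prod_cons _ (List.cons_ne_nil _ _), prod_cons _ hn]
      have h₁ := (Cong.symm (.assoc (by
        simp only [WF, sup, sub, Set.disjoint_union_left, Set.disjoint_union_right] at hl ⊢
        tauto)) : Cong _ (mul (mul (edge e'.1 e'.2.1 e'.2.2) (edge e.1 e.2.1 e.2.2)) (prod l)))
      have h₂ : Cong (mul (mul (edge e.1 e.2.1 e.2.2) (edge e'.1 e'.2.1 e'.2.2)) (prod l)) _ :=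
        .assoc (by
          simp only [WF, sup, sub, Set.disjoint_union_left, Set.disjoint_union_right] at hl' ⊢
          tauto)
      exact h₁.trans ((Cong.mul (.comm h₁.wf.2.1) h₁.wf.2 h₂.wf.1).trans h₂)
  | trans h₁ h₂ ih₁ ih₂ => exact (ih₁ hl).trans (ih₂ (wf h₁ hl))

theorem prod_mul_prod {l l' : List (List T × Ind × Ind)} (hl : l ≠ []) (hl' : l' ≠ [])
    (h : ((prod l).mul (prod l')).WF) : Cong ((prod l).mul (prod l')) (prod (l ++ l')) := by
  induction l with
  | nil => exact absurd rfl hl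
  | cons e l ih =>
    by_cases hn : l = []
    · subst hn
      rw [List.singleton_append, prod_cons _ hl']
      exact .refl h
    · rw [List.cons_append, prod_cons e hn, prod_cons e (by simp [hn])]
      rw [prod_cons e hn] at h
      have h₁ := Cong.assoc h
      have h₂ := ih hn h₁.wf.2.2.1
      refine h₁.trans (Cong.mul_left h₂ h₁.wf.2 ?_)
      have h₃ := h₁.wf.2
      simp only [WF, sup, sub, sup_prod, sub_prod, Set.disjoint_union_right] at h₃ ⊢
      refine ⟨trivial, h₂.wf.2, ?_, ?_⟩
      · refine Set.disjoint_left.2 fun i hi hm => ?_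
        rcases List.mem_append.1 (List.map_append ▸ hm) with hm | hm
        · exact Set.disjoint_left.1 h₃.2.2.1.1 hi hm
        · exact Set.disjoint_left.1 h₃.2.2.1.2 hi hm
      · refine Set.disjoint_left.2 fun i hi hm => ?_
        rcases List.mem_append.1 (List.map_append ▸ hm) with hm | hm
        · exact Set.disjoint_left.1 h₃.2.2.2.1 hi hm
        · exact Set.disjoint_left.1 h₃.2.2.2.2 hi hm

/-- A term is acyclic if it can be satisfied in the order model. -/
def Acyclic (t : TensorExpr T Ind) : Prop := ∃ ν, Sat orderRel ν t

theorem Cong.acyclic_iff {t s : TensorExpr T Ind} (h : Cong t s) : t.Acyclic ↔ s.Acyclic := by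
  have key : ∀ {t s : TensorExpr T Ind}, Cong t s → t.Acyclic → s.Acyclic := by
    rintro t s h ⟨ν, hν⟩
    obtain ⟨ν', -, hν'⟩ := (h.satFree_iff isModel_orderRel ν).1 hν.satFree
    exact ⟨ν', hν'⟩
  exact ⟨key h, key h.symm⟩

/-- A loop would require `x < x`, so an acyclic term consists of edges only. The sets of indices are
recorded in order to transfer the disjointness conditions of a product. -/
theorem exists_cong_prod {t : TensorExpr T Ind} (ht : t.WF) (ha : t.Acyclic) :
    ∃ l, l ≠ [] ∧ Cong t (prod l) ∧ t.sup = (prod l).sup ∧ t.sub = (prod l).sub := by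
  obtain ⟨ν, hν⟩ := ha
  induction t with
  | edge w i j => exact ⟨[(w, i, j)], by simp, .refl ht, rfl, rfl⟩
  | loop w =>
    obtain ⟨x, hx⟩ := hν
    exact absurd hx (lt_irrefl x)
  | mul t s iht ihs =>
    obtain ⟨l, hl, hc, h₁, h₂⟩ := iht ht.1 hν.1
    obtain ⟨l', hl', hc', h₁', h₂'⟩ := ihs ht.2.1 hν.2
    have w₁ : ((prod l).mul s).WF := ⟨hc.wf.2, ht.2.1, h₁ ▸ ht.2.2.1, h₂ ▸ ht.2.2.2⟩
    have w₂ : ((prod l).mul (prod l')).WF := ⟨hc.wf.2, hc'.wf.2, h₁' ▸ w₁.2.2.1, h₂' ▸ w₁.2.2.2⟩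
    refine ⟨l ++ l', by simp [hl], ((Cong.mul hc ht w₁).trans (Cong.mul_left hc' w₁ w₂)).trans
      (prod_mul_prod hl hl' w₂), ?_, ?_⟩
    · rw [sup, h₁, h₁', sup_prod, sup_prod, sup_prod]; ext; simp
    · rw [sub, h₂, h₂', sub_prod, sub_prod, sub_prod]; ext; simp

theorem sat_prod_mem {R : List T → X → X → Prop} {ν : Ind → X} {l : List (List T × Ind × Ind)}
    (h : Sat R ν (prod l)) {e : List T × Ind × Ind} (he : e ∈ l) : R e.1 (ν e.2.2) (ν e.2.1) := by
  induction l with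
  | nil => simp at he
  | cons e' l ih =>
    cases l with
    | nil => rw [List.mem_singleton.1 he]; exact h
    | cons e'' l =>
      rcases List.mem_cons.1 he with rfl | he
      · exact h.1
      · exact ih h.2 he

theorem prod_concat {u v : List T} {i j k : Ind} {l : List (List T × Ind × Ind)}
    (h : (prod ((u, j, i) :: (v, k, j) :: l)).WF) :
    Cong (prod ((u, j, i) :: (v, k, j) :: l)) (prod ((u ++ v, k, i) :: l)) := by
  cases l with
  | nil => exact .concat h
  | cons e l =>
    have hw : (prod ((u ++ v, k, i) :: e :: l)).WF := by
      rw [wf_prod] at h ⊢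
      simp only [List.map_cons, List.nodup_cons, List.mem_cons, not_or] at h ⊢
      tauto
    have h₁ : Cong (mul (mul (edge u j i) (edge v k j)) (prod (e :: l)))
        (prod ((u, j, i) :: (v, k, j) :: e :: l)) := .assoc (by
      simp only [prod, WF, sup, sub, Set.disjoint_union_left, Set.disjoint_union_right] at h ⊢
      tauto)
    exact h₁.symm.trans (Cong.mul (.concat h₁.wf.1.1) h₁.wf.1 hw)

/-- Concatenating the two edges that meet at a bound index shortens the product by one. The order
model guarantees that these are two different edges, since a single edge from an index to itself
would decrease its own value. -/
theorem exists_cong_prod_bound_eq_empty {t : TensorExpr T Ind} (ht : t.WF) (ha : t.Acyclic) :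
    ∃ l, l ≠ [] ∧ Cong t (prod l) ∧ (prod l).bound = ∅ := by
  classical
  obtain ⟨l, hl, hc, -, -⟩ := exists_cong_prod ht ha
  generalize hn : l.length = n
  induction n generalizing l with
  | zero => exact absurd (List.length_eq_zero_iff.1 hn) hl
  | succ n ih =>
    by_cases hb : (prod l).bound = ∅
    · exact ⟨l, hl, hc, hb⟩
    · obtain ⟨j, hj₁, hj₂⟩ := Set.nonempty_iff_ne_empty.2 hb
      rw [sup_prod] at hj₁
      rw [sub_prod] at hj₂
      obtain ⟨⟨u, j', i⟩, he, hej⟩ := List.mem_map.1 hj₁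
      obtain ⟨⟨v, k, j''⟩, he', hej'⟩ := List.mem_map.1 hj₂
      obtain rfl : j' = j := hej
      obtain rfl : j'' = j' := hej'
      obtain ⟨ν, hν⟩ := hc.acyclic_iff.1 ha
      have hne : (v, k, j'') ≠ (u, j'', i) := by
        intro heq
        have := sat_prod_mem hν he
        simp only [Prod.mk.injEq] at heq
        rw [← heq.2.2] at this
        exact absurd this (lt_irrefl _)
      have hperm : l.Perm ((u, j'', i) :: (v, k, j'') :: (l.erase (u, j'', i)).erase (v, k, j'')) :=
        (List.perm_cons_erase he).trans
          ((List.perm_cons_erase ((List.mem_erase_of_ne hne).2 he')).cons _)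
      have h₁ := prod_perm hperm hc.wf.2
      have hlen := hperm.length_eq
      exact ih _ (List.cons_ne_nil _ _) (hc.trans (h₁.trans (prod_concat h₁.wf.2)))
        (by simp only [List.length_cons] at hlen ⊢; omega)

/-- Without bound indices the upper index of every edge is free, hence equal to `j`; two edges would
repeat it. -/
theorem exists_cong_edge {t : TensorExpr T Ind} (ht : t.WF) (ha : t.Acyclic) {i j : Ind}
    (hsup : t.fsup = {j}) (hsub : t.fsub = {i}) : ∃ w, Cong t (edge w j i) := by
  obtain ⟨l, hl, hc, hb⟩ := exists_cong_prod_bound_eq_empty ht ha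
  have hfree := hc.free_eq
  rw [hsup, hsub, fsup, fsub, sdiff_eq_left.2, sdiff_eq_left.2, sup_prod, sub_prod] at hfree
  · obtain ⟨hup, hlow⟩ := hfree
    have hnd := ((wf_prod l).1 hc.wf.2).1
    match l, hl with
    | [(w, j', i')], _ =>
      simp only [List.map_cons, List.map_nil, List.mem_singleton, Set.ext_iff,
        Set.mem_singleton_iff, Set.mem_ofPred_eq] at hup hlow
      rw [(hup j).1 rfl, (hlow i).1 rfl]
      exact ⟨w, hc⟩
    | (w, j', i') :: (w', j'', i'') :: l, _ =>
      have h₁ : j' = j := by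
        have : j' ∈ ({j} : Set Ind) := by rw [hup]; simp
        exact this
      have h₂ : j'' = j := by
        have : j'' ∈ ({j} : Set Ind) := by rw [hup]; simp
        exact this
      simp [h₁, h₂] at hnd
  · exact (Set.disjoint_iff_inter_eq_empty.2 hb).symm
  · exact Set.disjoint_iff_inter_eq_empty.2 hb

end TensorExpr

/-! ## Tensor types -/

theorem TensorSymbol.dual_dual {P : Type*} (A : TensorSymbol P) : A.dual.dual = A := by
  induction A with
  | lit l => cases l <;> rfl
  | tensor A B ihA ihB => simp only [dual, ihA, ihB]
  | par A B ihA ihB => simp only [dual, ihA, ihB]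

theorem TensorSymbol.valency_dual {P : Type*} (v : P → ℕ × ℕ) (A : TensorSymbol P) :
    A.dual.valency v = (A.valency v).swap := by
  induction A with
  | lit l => cases l <;> simp [dual, valency, Literal.dual, Literal.valency]
  | tensor A B ihA ihB =>
    simp only [dual, valency, ihA, ihB]
    ext <;> simp [add_comm]
  | par A B ihA ihB =>
    simp only [dual, valency, ihA, ihB]
    ext <;> simp [add_comm]

namespace TensorType

variable {P Ind X Y : Type*} {v : P → ℕ × ℕ}

/-- The ordered upper indices. -/
def upper : TensorType P Ind → List Ind
  | lit _ I _ => I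
  | tensor A B => upper A ++ upper B
  | par A B => upper A ++ upper B

/-- The ordered lower indices. -/
def lower : TensorType P Ind → List Ind
  | lit _ _ J => J
  | tensor A B => lower A ++ lower B
  | par A B => lower A ++ lower B

/-- The type symbol of a tensor type. -/
def erase : TensorType P Ind → TensorSymbol P
  | lit l _ _ => .lit l
  | tensor A B => .tensor (erase A) (erase B)
  | par A B => .par (erase A) (erase B)

/-- Replace indices by their values. -/
def eval (ν : Ind → X) : TensorType P Ind → TensorType P X
  | lit l I J => lit l (I.map ν) (J.map ν)
  | tensor A B => tensor (eval ν A) (eval ν B)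
  | par A B => par (eval ν A) (eval ν B)

/-- All literals carry as many indices as their valency says. -/
def Fits (v : P → ℕ × ℕ) : TensorType P Ind → Prop
  | lit l I J => I.length = (l.valency v).1 ∧ J.length = (l.valency v).2
  | tensor A B => Fits v A ∧ Fits v B
  | par A B => Fits v A ∧ Fits v B

theorem dual_dual (A : TensorType P Ind) : A.dual.dual = A := by
  induction A with
  | lit l I J => cases l <;> simp [dual, Literal.dual]
  | tensor A B ihA ihB => simp only [dual, ihA, ihB]
  | par A B ihA ihB => simp only [dual, ihA, ihB]

theorem upper_dual (A : TensorType P Ind) : A.dual.upper = A.lower.reverse := by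
  induction A with
  | lit l I J => rfl
  | tensor A B ihA ihB => simp only [dual, upper, lower, ihA, ihB, List.reverse_append]
  | par A B ihA ihB => simp only [dual, upper, lower, ihA, ihB, List.reverse_append]

theorem lower_dual (A : TensorType P Ind) : A.dual.lower = A.upper.reverse := by
  induction A with
  | lit l I J => rfl
  | tensor A B ihA ihB => simp only [dual, upper, lower, ihA, ihB, List.reverse_append]
  | par A B ihA ihB => simp only [dual, upper, lower, ihA, ihB, List.reverse_append]

theorem erase_dual (A : TensorType P Ind) : A.dual.erase = A.erase.dual := by
  induction A with
  | lit l I J => rfl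
  | tensor A B ihA ihB => simp only [dual, erase, ihA, ihB, TensorSymbol.dual]
  | par A B ihA ihB => simp only [dual, erase, ihA, ihB, TensorSymbol.dual]

theorem sup_eq (A : TensorType P Ind) : A.sup = {i | i ∈ A.upper} := by
  induction A with
  | lit l I J => rfl
  | tensor A B ihA ihB => ext; simp [sup, upper, ihA, ihB]
  | par A B ihA ihB => ext; simp [sup, upper, ihA, ihB]

theorem sub_eq (A : TensorType P Ind) : A.sub = {i | i ∈ A.lower} := by
  induction A with
  | lit l I J => rfl
  | tensor A B ihA ihB => ext; simp [sub, lower, ihA, ihB]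
  | par A B ihA ihB => ext; simp [sub, lower, ihA, ihB]

theorem mem_ind {A : TensorType P Ind} {i : Ind} : i ∈ A.ind ↔ i ∈ A.upper ∨ i ∈ A.lower := by
  rw [ind, sup_eq, sub_eq]; rfl

theorem finite_ind (A : TensorType P Ind) : A.ind.Finite := by
  rw [ind, sup_eq, sub_eq]
  exact A.upper.finite_toSet.union A.lower.finite_toSet

theorem sup_dual (A : TensorType P Ind) : A.dual.sup = A.sub := by
  ext; simp [sup_eq, sub_eq, upper_dual]

theorem sub_dual (A : TensorType P Ind) : A.dual.sub = A.sup := by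
  ext; simp [sup_eq, sub_eq, lower_dual]

theorem ind_dual (A : TensorType P Ind) : A.dual.ind = A.ind := by
  rw [ind, ind, sup_dual, sub_dual, Set.union_comm]

theorem ind_tensor (A B : TensorType P Ind) : (tensor A B).ind = A.ind ∪ B.ind :=
  Set.union_union_union_comm _ _ _ _

theorem ind_par (A B : TensorType P Ind) : (par A B).ind = A.ind ∪ B.ind :=
  Set.union_union_union_comm _ _ _ _

theorem Fits.dual {A : TensorType P Ind} (h : A.Fits v) : A.dual.Fits v := by
  induction A with
  | lit l I J =>
    cases l <;> simpa [TensorType.dual, Fits, Literal.dual, Literal.valency, and_comm] using h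
  | tensor A B ihA ihB => exact ⟨ihB h.2, ihA h.1⟩
  | par A B ihA ihB => exact ⟨ihB h.2, ihA h.1⟩

theorem Fits.length_upper {A : TensorType P Ind} (h : A.Fits v) :
    A.upper.length = (A.erase.valency v).1 := by
  induction A with
  | lit l I J => exact h.1
  | tensor A B ihA ihB =>
    simp [upper, erase, TensorSymbol.valency, ihA h.1, ihB h.2]
  | par A B ihA ihB =>
    simp [upper, erase, TensorSymbol.valency, ihA h.1, ihB h.2]

theorem Fits.length_lower {A : TensorType P Ind} (h : A.Fits v) :
    A.lower.length = (A.erase.valency v).2 := by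
  induction A with
  | lit l I J => exact h.2
  | tensor A B ihA ihB =>
    simp [lower, erase, TensorSymbol.valency, ihA h.1, ihB h.2]
  | par A B ihA ihB =>
    simp [lower, erase, TensorSymbol.valency, ihA h.1, ihB h.2]

/-- A type is determined by its symbol and its two lists of indices; equalities between types are
reduced to these data. -/
theorem Fits.eq_decorate {A : TensorType P Ind} (h : A.Fits v) :
    A = A.erase.decorate v A.upper A.lower := by
  induction A with
  | lit l I J => rfl
  | tensor A B ihA ihB =>
    simp only [erase, upper, lower, TensorSymbol.decorate, ← h.1.length_upper, ← h.1.length_lower,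
      List.take_left, List.drop_left, ← ihA h.1, ← ihB h.2]
  | par A B ihA ihB =>
    simp only [erase, upper, lower, TensorSymbol.decorate, ← h.1.length_upper, ← h.1.length_lower,
      List.take_left, List.drop_left, ← ihA h.1, ← ihB h.2]

theorem erase_decorate (A : TensorSymbol P) (I J : List Ind) : (A.decorate v I J).erase = A := by
  induction A generalizing I J with
  | lit l => rfl
  | tensor A B ihA ihB => simp only [TensorSymbol.decorate, erase, ihA, ihB]
  | par A B ihA ihB => simp only [TensorSymbol.decorate, erase, ihA, ihB]

theorem upper_decorate (A : TensorSymbol P) (I J : List Ind) : (A.decorate v I J).upper = I := by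
  induction A generalizing I J with
  | lit l => rfl
  | tensor A B ihA ihB => simp only [TensorSymbol.decorate, upper, ihA, ihB, List.take_append_drop]
  | par A B ihA ihB => simp only [TensorSymbol.decorate, upper, ihA, ihB, List.take_append_drop]

theorem lower_decorate (A : TensorSymbol P) (I J : List Ind) : (A.decorate v I J).lower = J := by
  induction A generalizing I J with
  | lit l => rfl
  | tensor A B ihA ihB => simp only [TensorSymbol.decorate, lower, ihA, ihB, List.take_append_drop]
  | par A B ihA ihB => simp only [TensorSymbol.decorate, lower, ihA, ihB, List.take_append_drop]

theorem fits_decorate {A : TensorSymbol P} {I J : List Ind} (hI : I.length = (A.valency v).1)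
    (hJ : J.length = (A.valency v).2) : (A.decorate v I J).Fits v := by
  induction A generalizing I J with
  | lit l => exact ⟨hI, hJ⟩
  | tensor A B ihA ihB =>
    simp only [TensorSymbol.valency, Prod.fst_add, Prod.snd_add] at hI hJ
    exact ⟨ihA (by simp [hI]) (by simp [hJ]), ihB (by simp [hI]) (by simp [hJ])⟩
  | par A B ihA ihB =>
    simp only [TensorSymbol.valency, Prod.fst_add, Prod.snd_add] at hI hJ
    exact ⟨ihA (by simp [hI]) (by simp [hJ]), ihB (by simp [hI]) (by simp [hJ])⟩

theorem dual_decorate {A : TensorSymbol P} {I J : List Ind} (hI : I.length = (A.valency v).1)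
    (hJ : J.length = (A.valency v).2) :
    (A.decorate v I J).dual = A.dual.decorate v J.reverse I.reverse := by
  have h := (fits_decorate hI hJ).dual.eq_decorate
  rwa [erase_dual, upper_dual, lower_dual, erase_decorate, upper_decorate, lower_decorate] at h

theorem wf_iff {A : TensorType P Ind} : A.WF v ↔ A.Fits v ∧ (A.upper ++ A.lower).Nodup := by
  have key : ∀ {A B : TensorType P Ind}, Disjoint A.ind B.ind ↔
      ∀ i, ¬ ((i ∈ A.upper ∨ i ∈ A.lower) ∧ (i ∈ B.upper ∨ i ∈ B.lower)) := by
    intro A B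
    simp only [Set.disjoint_left, mem_ind, not_and]
  have key' : ∀ {A B : TensorType P Ind},
      (A.Fits v ∧ (A.upper ++ A.lower).Nodup) ∧ (B.Fits v ∧ (B.upper ++ B.lower).Nodup) ∧
        Disjoint A.ind B.ind ↔ (A.Fits v ∧ B.Fits v) ∧
          ((A.upper ++ B.upper) ++ (A.lower ++ B.lower)).Nodup := by
    intro A B
    have hp : ((A.upper ++ B.upper) ++ (A.lower ++ B.lower)).Perm
        ((A.upper ++ A.lower) ++ (B.upper ++ B.lower)) := by
      simp only [List.append_assoc]
      exact List.Perm.append_left _ (List.perm_append_comm_assoc _ _ _)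
    rw [hp.nodup_iff, List.nodup_append (l₁ := A.upper ++ A.lower), key]
    simp only [List.mem_append]
    grind
  induction A with
  | lit l I J => simp only [WF, Fits, upper, lower, and_assoc]
  | tensor A B ihA ihB => simp only [WF, ihA, ihB, key', Fits, upper, lower]
  | par A B ihA ihB => simp only [WF, ihA, ihB, key', Fits, upper, lower]

theorem WF.fits {A : TensorType P Ind} (h : A.WF v) : A.Fits v := (wf_iff.1 h).1

theorem WF.dual {A : TensorType P Ind} (h : A.WF v) : A.dual.WF v := by
  rw [wf_iff] at h ⊢
  refine ⟨h.1.dual, ?_⟩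
  rw [upper_dual, lower_dual, ← List.reverse_append, List.nodup_reverse]
  exact h.2

theorem WF.disjoint {A : TensorType P Ind} (h : A.WF v) {i : Ind} (h₁ : i ∈ A.sup) :
    i ∉ A.sub := by
  rw [sup_eq] at h₁
  rw [sub_eq]
  exact fun h₂ => List.disjoint_of_nodup_append (wf_iff.1 h).2 h₁ h₂

theorem upper_eval (ν : Ind → X) (A : TensorType P Ind) : (A.eval ν).upper = A.upper.map ν := by
  induction A with
  | lit l I J => rfl
  | tensor A B ihA ihB => simp only [eval, upper, ihA, ihB, List.map_append]
  | par A B ihA ihB => simp only [eval, upper, ihA, ihB, List.map_append]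

theorem lower_eval (ν : Ind → X) (A : TensorType P Ind) : (A.eval ν).lower = A.lower.map ν := by
  induction A with
  | lit l I J => rfl
  | tensor A B ihA ihB => simp only [eval, lower, ihA, ihB, List.map_append]
  | par A B ihA ihB => simp only [eval, lower, ihA, ihB, List.map_append]

theorem erase_eval (ν : Ind → X) (A : TensorType P Ind) : (A.eval ν).erase = A.erase := by
  induction A with
  | lit l I J => rfl
  | tensor A B ihA ihB => simp only [eval, erase, ihA, ihB]
  | par A B ihA ihB => simp only [eval, erase, ihA, ihB]

theorem eval_dual (ν : Ind → X) (A : TensorType P Ind) : A.dual.eval ν = (A.eval ν).dual := by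
  induction A with
  | lit l I J => simp only [dual, eval, List.map_reverse]
  | tensor A B ihA ihB => simp only [eval, dual, ihA, ihB]
  | par A B ihA ihB => simp only [eval, dual, ihA, ihB]

theorem Fits.eval {A : TensorType P Ind} (h : A.Fits v) (ν : Ind → X) : (A.eval ν).Fits v := by
  induction A with
  | lit l I J => simpa [TensorType.eval, Fits] using h
  | tensor A B ihA ihB => exact ⟨ihA h.1, ihB h.2⟩
  | par A B ihA ihB => exact ⟨ihA h.1, ihB h.2⟩

theorem eval_congr {ν ν' : Ind → X} {A : TensorType P Ind} (h : ∀ i ∈ A.ind, ν i = ν' i) :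
    A.eval ν = A.eval ν' := by
  induction A with
  | lit l I J =>
    simp only [eval]
    congr 1
    · exact List.map_congr_left fun i hi => h i (Or.inl hi)
    · exact List.map_congr_left fun i hi => h i (Or.inr hi)
  | tensor A B ihA ihB =>
    rw [ind_tensor] at h
    rw [eval, eval, ihA fun i hi => h i (Or.inl hi), ihB fun i hi => h i (Or.inr hi)]
  | par A B ihA ihB =>
    rw [ind_par] at h
    rw [eval, eval, ihA fun i hi => h i (Or.inl hi), ihB fun i hi => h i (Or.inr hi)]

theorem mapInd_eq_eval (f : Ind → Ind) (A : TensorType P Ind) : A.mapInd f = A.eval f := by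
  induction A with
  | lit l I J => rfl
  | tensor A B ihA ihB => simp only [eval, mapInd, ihA, ihB]
  | par A B ihA ihB => simp only [eval, mapInd, ihA, ihB]

theorem eval_eval (μ : X → Y) (ν : Ind → X) (A : TensorType P Ind) :
    (A.eval ν).eval μ = A.eval (μ ∘ ν) := by
  induction A with
  | lit l I J => simp only [eval, List.map_map]
  | tensor A B ihA ihB => simp only [eval, ihA, ihB]
  | par A B ihA ihB => simp only [eval, ihA, ihB]

theorem ind_eval (ν : Ind → X) (A : TensorType P Ind) : (A.eval ν).ind = ν '' A.ind := by
  ext x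
  simp only [mem_ind, upper_eval, lower_eval, List.mem_map, Set.mem_image]
  constructor
  · rintro (⟨i, hi, rfl⟩ | ⟨i, hi, rfl⟩)
    exacts [⟨i, Or.inl hi, rfl⟩, ⟨i, Or.inr hi, rfl⟩]
  · rintro ⟨i, hi | hi, rfl⟩
    exacts [Or.inl ⟨i, hi, rfl⟩, Or.inr ⟨i, hi, rfl⟩]

theorem WF.eval {A : TensorType P Ind} (h : A.WF v) {ν : Ind → X} (hν : Set.InjOn ν A.ind) :
    (A.eval ν).WF v := by
  rw [wf_iff] at h ⊢
  refine ⟨h.1.eval ν, ?_⟩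
  rw [upper_eval, lower_eval, ← List.map_append]
  refine List.Nodup.map_on (fun i hi j hj hij => hν ?_ ?_ hij) h.2
  · exact mem_ind.2 (List.mem_append.1 hi)
  · exact mem_ind.2 (List.mem_append.1 hj)

/-- Types without common indices. -/
def Separated (v : P → ℕ × ℕ) (Γ : Multiset (TensorType P Ind)) : Prop :=
  (∀ A ∈ Γ, A.WF v) ∧ Γ.Pairwise fun A B => Disjoint A.ind B.ind

theorem separated_zero : Separated v (0 : Multiset (TensorType P Ind)) :=
  ⟨by simp, [], rfl, .nil⟩

theorem separated_cons {A : TensorType P Ind} {Γ : Multiset (TensorType P Ind)} :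
    Separated v (A ::ₘ Γ) ↔ A.WF v ∧ (∀ B ∈ Γ, Disjoint A.ind B.ind) ∧ Separated v Γ := by
  have hs : Std.Symm fun A B : TensorType P Ind => Disjoint A.ind B.ind := ⟨fun _ _ h => h.symm⟩
  induction Γ using Quotient.inductionOn with
  | _ l =>
    simp only [Separated, Multiset.quot_mk_to_coe, Multiset.cons_coe, Multiset.mem_coe,
      Multiset.pairwise_coe_iff_pairwise, List.pairwise_cons, List.mem_cons, forall_eq_or_imp]
    tauto

theorem separated_add {Γ Θ : Multiset (TensorType P Ind)} :
    Separated v (Γ + Θ) ↔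
      Separated v Γ ∧ Separated v Θ ∧ ∀ A ∈ Γ, ∀ B ∈ Θ, Disjoint A.ind B.ind := by
  induction Γ using Multiset.induction_on with
  | empty => simp [separated_zero]
  | cons A Γ ih =>
    rw [Multiset.cons_add, separated_cons, separated_cons, ih]
    simp only [Multiset.mem_add, Multiset.mem_cons, or_imp, forall_and, forall_eq]
    tauto

theorem exists_fresh [Infinite Ind] (v : P → ℕ × ℕ) (A : TensorSymbol P) {Z : Set Ind}
    (hZ : Z.Finite) : ∃ F : TensorType P Ind, F.WF v ∧ F.erase = A ∧ Disjoint F.ind Z := by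
  classical
  obtain ⟨s, hs, hcard⟩ := hZ.infinite_compl.exists_subset_card_eq
    ((A.valency v).1 + (A.valency v).2)
  have hlen : s.toList.length = (A.valency v).1 + (A.valency v).2 := by simp [hcard]
  refine ⟨A.decorate v (s.toList.take (A.valency v).1) (s.toList.drop (A.valency v).1),
    wf_iff.2 ⟨fits_decorate (by simp [hlen]) (by simp [hlen]), ?_⟩, erase_decorate _ _ _, ?_⟩
  · rw [upper_decorate, lower_decorate, List.take_append_drop]
    exact s.nodup_toList
  · refine Set.disjoint_left.2 fun i hi => ?_
    rw [mem_ind, upper_decorate, lower_decorate, ← List.mem_append, List.take_append_drop,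
      Finset.mem_toList] at hi
    exact hs hi

end TensorType

/-! ## Typing judgements -/

namespace SynJudgement

open TensorExpr TensorType

variable {P T Ind X : Type*} {v : P → ℕ × ℕ}

theorem ext' {a b : SynJudgement v T Ind} (h₁ : a.term = b.term) (h₂ : a.types = b.types) :
    a = b := by
  cases a; cases b; cases h₁; cases h₂; rfl

theorem separated (a : SynJudgement v T Ind) : Separated v a.types :=
  ⟨a.types_wf, a.types_disjoint⟩

theorem mem_free_iff (a : SynJudgement v T Ind) {i : Ind} :
    i ∈ a.term.fsup ∪ a.term.fsub ↔ ∃ A ∈ a.types, i ∈ A.ind := by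
  rw [a.fsup_eq, a.fsub_eq]
  constructor
  · rintro (⟨A, hA, hi⟩ | ⟨A, hA, hi⟩)
    exacts [⟨A, hA, Or.inr hi⟩, ⟨A, hA, Or.inl hi⟩]
  · rintro ⟨A, hA, hi | hi⟩
    exacts [Or.inr ⟨A, hA, hi⟩, Or.inl ⟨A, hA, hi⟩]

theorem mem_ind_of_mem_types (a : SynJudgement v T Ind) {A : TensorType P Ind} (hA : A ∈ a.types)
    {i : Ind} (hi : i ∈ A.ind) : i ∈ a.term.ind := by
  rw [ind_eq]
  exact Or.inl (a.mem_free_iff.2 ⟨A, hA, hi⟩)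

/-- The values of the types of a judgement under the assignments that satisfy its term. -/
def values (R : List T → X → X → Prop) (a : SynJudgement v T Ind) :
    Set (Multiset (TensorType P X)) :=
  {Γ | ∃ ν, Sat R ν a.term ∧ Γ = a.types.map (TensorType.eval ν)}

theorem mem_values_iff_satFree {R : List T → X → X → Prop} {a : SynJudgement v T Ind}
    {Γ : Multiset (TensorType P X)} :
    Γ ∈ a.values R ↔ ∃ ν, SatFree R ν a.term ∧ Γ = a.types.map (TensorType.eval ν) := by
  constructor
  · rintro ⟨ν, h, rfl⟩
    exact ⟨ν, h.satFree, rfl⟩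
  · rintro ⟨ν, ⟨ν', h, hs⟩, rfl⟩
    refine ⟨ν', hs, Multiset.map_congr rfl fun A hA => eval_congr fun i hi => ?_⟩
    exact (h i (a.mem_free_iff.2 ⟨A, hA, hi⟩)).symm

theorem Step.values_eq {R : List T → X → X → Prop} (hR : IsModel R) {a b : SynJudgement v T Ind}
    (h : Step a b) : a.values R = b.values R := by
  classical
  cases h with
  | @alpha i i' hi hi' hterm htypes =>
    have hmap : ∀ ν : Ind → X, b.types.map (TensorType.eval ν) =
        a.types.map (TensorType.eval (ν ∘ replace i i')) := by
      intro ν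
      simp only [htypes, Multiset.map_map, Function.comp_def, mapInd_eq_eval, eval_eval]
    ext Γ
    constructor
    · rintro ⟨ν, hν, rfl⟩
      -- The new name `i'` inherits the value of `i`. It does not occur in the term, so overwriting
      -- its old value is harmless.
      have heq : ∀ k ∈ a.term.ind, ν k = (Function.update ν i' (ν i) ∘ replace i i') k := by
        intro k hk
        simp only [Function.comp_apply, replace]
        split_ifs with h
        · simp [h]
        · rw [Function.update_of_ne]
          rintro rfl
          exact hi' hk
      refine ⟨Function.update ν i' (ν i), ?_, ?_⟩
      · rw [hterm, sat_mapInd]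
        exact hν.congr heq
      · rw [hmap]
        exact Multiset.map_congr rfl fun A hA =>
          eval_congr fun k hk => heq k (a.mem_ind_of_mem_types hA hk)
    · rintro ⟨ν, hν, rfl⟩
      rw [hterm, sat_mapInd] at hν
      exact ⟨_, hν, hmap ν⟩
  | term hterm htypes =>
    ext Γ
    rw [mem_values_iff_satFree, mem_values_iff_satFree, htypes]
    simp only [hterm.satFree_iff hR]

theorem values_eq {R : List T → X → X → Prop} (hR : IsModel R) {a b : SynJudgement v T Ind}
    (h : a.toJudgement = b.toJudgement) : a.values R = b.values R := by
  have h' : Relation.EqvGen Step a b := Quotient.exact h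
  clear h
  induction h' with
  | rel a b h => exact h.values_eq hR
  | refl a => rfl
  | symm a b _ ih => exact (ih).symm
  | trans a b c _ _ ih₁ ih₂ => exact (ih₁).trans (ih₂)

theorem len_eq {a b : SynJudgement v T Ind} (h : a.toJudgement = b.toJudgement) :
    a.term.len = b.term.len := by
  have h' : Relation.EqvGen Step a b := Quotient.exact h
  clear h
  induction h' with
  | rel a b h =>
    cases h with
    | alpha _ _ hterm _ => rw [hterm, len_mapInd]
    | term hterm _ => exact hterm.len_eq
  | refl a => rfl
  | symm a b _ ih => exact ih.symm
  | trans a b c _ _ ih₁ ih₂ => exact ih₁.trans ih₂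

/-- Expressed through `values`, acyclicity becomes a property of the congruence class of a
judgement. -/
theorem acyclic_iff_nonempty_values {a : SynJudgement v T Ind} :
    a.term.Acyclic ↔ (a.values (orderRel (T := T))).Nonempty :=
  ⟨fun ⟨ν, h⟩ => ⟨_, ν, h, rfl⟩, fun ⟨_, ν, h, _⟩ => ⟨ν, h⟩⟩

theorem toJudgement_eq_of_cong {a : SynJudgement v T Ind} {t : TensorExpr T Ind}
    (h : a.term.Cong t) : ∃ b : SynJudgement v T Ind, b.term = t ∧ b.types = a.types ∧
      b.toJudgement = a.toJudgement := by
  refine ⟨⟨t, a.types, h.wf.2, a.types_wf, a.types_disjoint, ?_, ?_⟩, rfl, rfl, ?_⟩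
  · rw [← h.free_eq.1, a.fsup_eq]
  · rw [← h.free_eq.2, a.fsub_eq]
  · exact Quotient.sound (.symm _ _ (.rel _ _ (.term h rfl)))

/-! ### Renaming of indices -/

theorem fsup_mapInd {f : Ind → Ind} {t : TensorExpr T Ind} (hf : Set.InjOn f t.ind) :
    (t.mapInd f).fsup = f '' t.fsup := by
  have := (hf.mono Set.subset_union_left : Set.InjOn f t.sup).image_sdiff (t := t.sub)
  rw [fsup, fsup, this, sup_mapInd, sub_mapInd, hf.image_inter Set.subset_union_left
    Set.subset_union_right, Set.sdiff_self_inter]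

theorem fsub_mapInd {f : Ind → Ind} {t : TensorExpr T Ind} (hf : Set.InjOn f t.ind) :
    (t.mapInd f).fsub = f '' t.fsub := by
  have := (hf.mono Set.subset_union_right : Set.InjOn f t.sub).image_sdiff (t := t.sup)
  rw [fsub, fsub, this, sup_mapInd, sub_mapInd, hf.image_inter Set.subset_union_right
    Set.subset_union_left, Set.sdiff_self_inter]

/-- Rename the indices of a judgement injectively. -/
def map (a : SynJudgement v T Ind) (f : Ind → Ind) (hf : Set.InjOn f a.term.ind) :
    SynJudgement v T Ind where
  term := a.term.mapInd f
  types := a.types.map (TensorType.mapInd f)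
  term_wf := a.term_wf.mapInd hf
  types_wf := by
    intro A hA
    obtain ⟨B, hB, rfl⟩ := Multiset.mem_map.1 hA
    rw [mapInd_eq_eval]
    exact (a.types_wf B hB).eval (hf.mono fun i hi => a.mem_ind_of_mem_types hB hi)
  types_disjoint := by
    obtain ⟨l, hl, hp⟩ := a.types_disjoint
    refine ⟨l.map (TensorType.mapInd f), by rw [hl, Multiset.map_coe], ?_⟩
    rw [List.pairwise_map]
    have hm : ∀ A ∈ l, A ∈ a.types := fun A hA => by rw [hl]; exact hA
    refine hp.imp_of_mem fun {A B} hA hB hAB => ?_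
    rw [mapInd_eq_eval, mapInd_eq_eval, ind_eval, ind_eval]
    exact hAB.image hf (fun i hi => a.mem_ind_of_mem_types (hm A hA) hi)
      fun i hi => a.mem_ind_of_mem_types (hm B hB) hi
  fsup_eq := by
    rw [fsup_mapInd hf, a.fsup_eq]
    ext i
    simp only [Set.mem_image, Set.mem_ofPred_eq, Multiset.mem_map, mapInd_eq_eval, sub_eq]
    constructor
    · rintro ⟨j, ⟨A, hA, hj⟩, rfl⟩
      exact ⟨_, ⟨A, hA, rfl⟩, by rw [lower_eval]; exact List.mem_map_of_mem hj⟩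
    · rintro ⟨_, ⟨A, hA, rfl⟩, hi⟩
      rw [lower_eval] at hi
      obtain ⟨j, hj, rfl⟩ := List.mem_map.1 hi
      exact ⟨j, ⟨A, hA, hj⟩, rfl⟩
  fsub_eq := by
    rw [fsub_mapInd hf, a.fsub_eq]
    ext i
    simp only [Set.mem_image, Set.mem_ofPred_eq, Multiset.mem_map, mapInd_eq_eval, sup_eq]
    constructor
    · rintro ⟨j, ⟨A, hA, hj⟩, rfl⟩
      exact ⟨_, ⟨A, hA, rfl⟩, by rw [upper_eval]; exact List.mem_map_of_mem hj⟩
    · rintro ⟨_, ⟨A, hA, rfl⟩, hi⟩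
      rw [upper_eval] at hi
      obtain ⟨j, hj, rfl⟩ := List.mem_map.1 hi
      exact ⟨j, ⟨A, hA, hj⟩, rfl⟩

theorem injOn_replace {i i' : Ind} {s : Set Ind} (hi' : i' ∉ s) : Set.InjOn (replace i i') s := by
  intro j hj k hk h
  simp only [replace] at h
  split_ifs at h with h₁ h₂ h₂
  · rw [h₁, h₂]
  · exact absurd (h ▸ hk) hi'
  · exact absurd (h ▸ hj) hi'
  · exact h

/-- Congruence renames one free index at a time. Since all the new names are fresh and distinct, the
successive renamings do not interfere and compose to one map of indices. -/
theorem exists_rename (K K' : List Ind) (hlen : K.length = K'.length) (a : SynJudgement v T Ind)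
    (hK : ∀ i ∈ K, i ∈ a.term.fsup ∪ a.term.fsub) (hnd : K.Nodup) (hnd' : K'.Nodup)
    (hK' : ∀ i ∈ K', i ∉ a.term.ind) :
    ∃ (b : SynJudgement v T Ind) (f : Ind → Ind), b.toJudgement = a.toJudgement ∧
      b.types = a.types.map (TensorType.eval f) ∧ K.map f = K' ∧
      ∀ i ∈ a.term.ind, i ∉ K → f i = i := by
  induction K generalizing K' a with
  | nil =>
    obtain rfl : K' = [] := List.length_eq_zero_iff.1 hlen.symm
    refine ⟨a, id, rfl, ?_, rfl, fun _ _ _ => rfl⟩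
    have hid : ∀ A : TensorType P Ind, A.eval id = A := by
      intro A
      induction A with
      | lit l I J => simp [TensorType.eval]
      | tensor A B ihA ihB => simp only [TensorType.eval, ihA, ihB]
      | par A B ihA ihB => simp only [TensorType.eval, ihA, ihB]
    simp only [hid, Multiset.map_id']
  | cons i K ih =>
    match K', hlen with
    | i' :: K', hlen =>
      rw [List.nodup_cons] at hnd hnd'
      have hind : ∀ j ∈ i :: K, j ∈ a.term.ind := fun j hj => by
        rw [ind_eq]; exact Or.inl (hK j hj)
      have hi' : i' ∉ a.term.ind := hK' i' List.mem_cons_self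
      have hrep : ∀ j, j ≠ i → replace i i' j = j := fun j hj => by simp [replace, hj]
      have hrep' : replace i i' i = i' := by simp [replace]
      let a₁ := a.map (replace i i') (injOn_replace hi')
      have hind₁ : a₁.term.ind = replace i i' '' a.term.ind := ind_mapInd _ _
      have h₁ : a₁.toJudgement = a.toJudgement :=
        Quotient.sound (.symm _ _ (.rel _ _
          (.alpha (hK i List.mem_cons_self) hi' rfl rfl)))
      have hne : ∀ j ∈ K, j ≠ i := fun j hj h => hnd.1 (h ▸ hj)
      obtain ⟨b, f, hb, htypes, hf, hfix⟩ := ih K' (by simpa using hlen) a₁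
        (fun j hj => by
          have := hK j (List.mem_cons_of_mem _ hj)
          change j ∈ (a.term.mapInd _).fsup ∪ (a.term.mapInd _).fsub
          rw [fsup_mapInd (injOn_replace hi'), fsub_mapInd (injOn_replace hi'), ← Set.image_union]
          exact ⟨j, this, hrep j (hne j hj)⟩) hnd.2 hnd'.2
        (fun j hj => by
          rw [hind₁]
          rintro ⟨k, hk, hkj⟩
          by_cases hki : k = i
          · rw [hki, hrep'] at hkj
            exact hnd'.1 (hkj ▸ hj)
          · rw [hrep k hki] at hkj
            exact hK' j (List.mem_cons_of_mem _ hj) (hkj ▸ hk))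
      refine ⟨b, f ∘ replace i i', hb.trans h₁, ?_, ?_, ?_⟩
      · rw [htypes]
        change (a.types.map _).map _ = _
        simp only [Multiset.map_map, Function.comp_def, mapInd_eq_eval, eval_eval]
      · rw [List.map_cons, Function.comp_apply, hrep', hfix i' ?_ ?_, ← hf]
        · congr 1
          exact List.map_congr_left fun j hj => by rw [Function.comp_apply, hrep j (hne j hj)]
        · rw [hind₁]
          exact ⟨i, hind i List.mem_cons_self, hrep'⟩
        · exact fun h => hi' (hind i' (List.mem_cons_of_mem _ h))
      · intro j hj hjK
        rw [List.mem_cons, not_or] at hjK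
        rw [Function.comp_apply, hrep j hjK.1]
        refine hfix j ?_ hjK.2
        rw [hind₁]
        exact ⟨j, hj, hrep j hjK.1⟩

theorem exists_types_eq_singleton (a : SynJudgement v T Ind) {F G : TensorType P Ind}
    (ha : a.types = {F}) (hG : G.WF v) (he : F.erase = G.erase) (hd : Disjoint G.ind a.term.ind) :
    ∃ b : SynJudgement v T Ind, b.toJudgement = a.toJudgement ∧ b.types = {G} := by
  have hF : F.WF v := a.types_wf F (by simp [ha])
  obtain ⟨b, f, hb, htypes, hf, -⟩ := a.exists_rename (F.upper ++ F.lower) (G.upper ++ G.lower)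
    (by simp only [List.length_append, hF.fits.length_upper, hF.fits.length_lower,
      hG.fits.length_upper, hG.fits.length_lower, he])
    (fun i hi => a.mem_free_iff.2 ⟨F, by simp [ha], mem_ind.2 (List.mem_append.1 hi)⟩)
    (wf_iff.1 hF).2 (wf_iff.1 hG).2
    (fun i hi => Set.disjoint_left.1 hd (mem_ind.2 (List.mem_append.1 hi)))
  refine ⟨b, hb, ?_⟩
  rw [htypes, ha, Multiset.map_singleton]
  congr 1
  rw [List.map_append] at hf
  obtain ⟨h₁, h₂⟩ := List.append_inj hf (by simp only [List.length_map, hF.fits.length_upper,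
      hG.fits.length_upper, he])
  rw [(hF.fits.eval f).eq_decorate, hG.fits.eq_decorate, erase_eval, upper_eval, lower_eval, he,
    h₁, h₂]

/-- The indices of `G` may already occur in `a`. The type is therefore moved to a fresh copy `H`
first; eliminating the bound indices then leaves only indices of `H`, and a second renaming reaches
`G` without collisions. -/
theorem exists_eq_prod [Infinite Ind] (a : SynJudgement v T Ind) (hac : a.term.Acyclic)
    {F G : TensorType P Ind} (ha : a.types = {F}) (hG : G.WF v) (he : F.erase = G.erase) :
    ∃ (b : SynJudgement v T Ind) (l : List (List T × Ind × Ind)),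
      b.toJudgement = a.toJudgement ∧ b.types = {G} ∧ b.term = prod l ∧ b.term.bound = ∅ := by
  have step : ∀ b : SynJudgement v T Ind, b.toJudgement = a.toJudgement →
      ∃ (c : SynJudgement v T Ind) (l : List (List T × Ind × Ind)),
        c.toJudgement = a.toJudgement ∧ c.types = b.types ∧ c.term = prod l ∧ c.term.bound = ∅ := by
    intro b hb
    have hac' : b.term.Acyclic := by
      rwa [acyclic_iff_nonempty_values, values_eq isModel_orderRel hb,
        ← acyclic_iff_nonempty_values]
    obtain ⟨l, -, hc, hbd⟩ := exists_cong_prod_bound_eq_empty b.term_wf hac'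
    obtain ⟨c, h₁, h₂, h₃⟩ := toJudgement_eq_of_cong hc
    exact ⟨c, l, h₃.trans hb, h₂, h₁, h₁ ▸ hbd⟩
  obtain ⟨H, hH, hHe, hHd⟩ := TensorType.exists_fresh v F.erase
    (a.term.finite_ind.union G.finite_ind)
  rw [Set.disjoint_union_right] at hHd
  obtain ⟨b, hb, hbt⟩ := a.exists_types_eq_singleton ha hH hHe.symm hHd.1
  obtain ⟨c, -, hc, hct, -, hcb⟩ := step b hb
  obtain ⟨d, hd, hdt⟩ := c.exists_types_eq_singleton (hct.trans hbt) hG (hHe.trans he) (by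
    refine Set.disjoint_left.2 fun i hi hi' => ?_
    rw [ind_eq, hcb, Set.union_empty] at hi'
    obtain ⟨A, hA, hiA⟩ := c.mem_free_iff.1 hi'
    rw [hct, hbt, Multiset.mem_singleton] at hA
    exact Set.disjoint_left.1 hHd.2 (hA ▸ hiA) hi)
  obtain ⟨e, l, h₁, h₂, h₃⟩ := step d (hd.trans hc)
  exact ⟨e, l, h₁, h₂.trans hdt, h₃⟩

end SynJudgement

/-! ## Kronecker deltas and identity judgements -/

namespace TensorExpr

variable {T Ind X : Type*}

theorem delta_nil_ne_some {D : List Ind} {e : TensorExpr T Ind} : delta [] D ≠ some e := by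
  simp [delta]

theorem delta_cons_eq_some {i : Ind} {U D : List Ind} {e : TensorExpr T Ind}
    (h : delta (i :: U) D = some e) :
    (∃ j, U = [] ∧ D = [j] ∧ e = edge [] i j) ∨
      ∃ j J e', D = j :: J ∧ delta U J = some e' ∧ e = mul (edge [] i j) e' := by
  unfold delta at h
  split at h
  · rename_i heq
    cases heq
    exact Or.inl ⟨_, rfl, rfl, (Option.some.inj h).symm⟩
  · rename_i heq
    cases heq
    obtain ⟨e', he', rfl⟩ := Option.map_eq_some_iff.1 h
    exact Or.inr ⟨_, _, e', rfl, he', rfl⟩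
  · cases h

theorem exists_delta {U D : List Ind} (hlen : U.length = D.length) (hU : U ≠ []) :
    ∃ e : TensorExpr T Ind, delta U D = some e := by
  induction U generalizing D with
  | nil => exact absurd rfl hU
  | cons i U ih =>
    cases D with
    | nil => cases hlen
    | cons j D =>
      by_cases hn : U = []
      · subst hn
        obtain rfl : D = [] := List.length_eq_zero_iff.1 (by simpa using hlen.symm)
        exact ⟨_, rfl⟩
      · obtain ⟨e, he⟩ := ih (D := D) (by simpa using hlen) hn
        refine ⟨mul (edge [] i j) e, ?_⟩
        cases U with
        | nil => exact absurd rfl hn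
        | cons i' U => simp [delta, he]

theorem sup_delta {U D : List Ind} {e : TensorExpr T Ind} (h : delta U D = some e) :
    e.sup = {i | i ∈ U} := by
  induction U generalizing D e with
  | nil => exact absurd h delta_nil_ne_some
  | cons i U ih =>
    rcases delta_cons_eq_some h with ⟨j, rfl, rfl, rfl⟩ | ⟨j, D, e, rfl, h', rfl⟩
    · ext; simp [sup]
    · ext; simp [sup, ih h']

theorem sub_delta {U D : List Ind} {e : TensorExpr T Ind} (h : delta U D = some e) :
    e.sub = {i | i ∈ D} := by
  induction U generalizing D e with
  | nil => exact absurd h delta_nil_ne_some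
  | cons i U ih =>
    rcases delta_cons_eq_some h with ⟨j, rfl, rfl, rfl⟩ | ⟨j, D, e, rfl, h', rfl⟩
    · ext; simp [sub]
    · ext; simp [sub, ih h']

theorem wf_delta {U D : List Ind} {e : TensorExpr T Ind} (h : delta U D = some e)
    (hU : U.Nodup) (hD : D.Nodup) :
    e.WF := by
  induction U generalizing D e with
  | nil => exact absurd h delta_nil_ne_some
  | cons i U ih =>
    rcases delta_cons_eq_some h with ⟨j, rfl, rfl, rfl⟩ | ⟨j, D, e, rfl, h', rfl⟩
    · trivial
    · rw [List.nodup_cons] at hU hD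
      refine ⟨trivial, ih h' hU.2 hD.2, ?_, ?_⟩
      · rw [sup_delta h']
        exact Set.disjoint_singleton_left.2 hU.1
      · rw [sub_delta h']
        exact Set.disjoint_singleton_left.2 hD.1

theorem sat_delta {R : List T → X → X → Prop} {ν : Ind → X} {U D : List Ind}
    {e : TensorExpr T Ind} (h : delta U D = some e) :
    Sat R ν e ↔ List.Forall₂ (fun i j => R [] (ν j) (ν i)) U D := by
  induction U generalizing D e with
  | nil => exact absurd h delta_nil_ne_some
  | cons i U ih =>
    rcases delta_cons_eq_some h with ⟨j, rfl, rfl, rfl⟩ | ⟨j, D, e, rfl, h', rfl⟩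
    · simp [Sat]
    · simp [Sat, ih h']

theorem len_delta {U D : List Ind} {e : TensorExpr T Ind} (h : delta U D = some e) :
    e.len = 0 := by
  induction U generalizing D e with
  | nil => exact absurd h delta_nil_ne_some
  | cons i U ih =>
    rcases delta_cons_eq_some h with ⟨j, rfl, rfl, rfl⟩ | ⟨j, D, e, rfl, h', rfl⟩
    · rfl
    · simp [len, ih h']

/-- In the model `R`, the term `e` acts as an identity between the type `F`, used as a hypothesis,
and the type `G`. -/
def IsIdentity {P : Type*} (R : List T → X → X → Prop) (e : TensorExpr T Ind)
    (F G : TensorType P Ind) : Prop :=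
  ∀ ν : Ind → X, Sat R ν e ↔
    List.Forall₂ (fun i j => R [] (ν j) (ν i)) F.upper G.upper ∧
      List.Forall₂ (fun i j => R [] (ν i) (ν j)) F.lower G.lower

end TensorExpr

theorem Multiset.exists_mem_cons_iff {α : Type*} {p : α → Prop} {a : α} {s : Multiset α} :
    (∃ x ∈ a ::ₘ s, p x) ↔ p a ∨ ∃ x ∈ s, p x := by
  simp

theorem List.forall₂_append_iff {α β : Type*} {r : α → β → Prop} {l₁ l₂ : List α} {m₁ m₂ : List β}
    (h : l₁.length = m₁.length) :
    List.Forall₂ r (l₁ ++ l₂) (m₁ ++ m₂) ↔ List.Forall₂ r l₁ m₁ ∧ List.Forall₂ r l₂ m₂ := by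
  induction l₁ generalizing m₁ with
  | nil =>
    obtain rfl : m₁ = [] := List.length_eq_zero_iff.1 h.symm
    simp
  | cons a l₁ ih =>
    match m₁, h with
    | b :: m₁, h => simp [ih (by simpa using h), and_assoc]

namespace SynJudgement

open TensorExpr TensorType

variable {P T Ind X : Type*} {v : P → ℕ × ℕ}

theorem isIdentity_delta (R : List T → X → X → Prop) {F G : TensorType P Ind}
    {e : TensorExpr T Ind} (hF : F.Fits v) (hG : G.Fits v) (he : F.erase = G.erase)
    (h : delta (G.lower ++ F.upper) (F.lower ++ G.upper) = some e) : e.IsIdentity R F G := by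
  intro ν
  rw [sat_delta h, List.forall₂_append_iff (by rw [hF.length_lower, hG.length_lower, he]), and_comm]
  exact and_congr_right fun _ => ⟨List.Forall₂.flip, List.Forall₂.flip⟩

/-- The valency has to be nonzero because the delta of empty sequences is undefined. No index is
bound, since the two copies are disjoint and neither repeats an index. -/
theorem exists_identity {F G : TensorType P Ind} (hF : F.WF v) (hG : G.WF v)
    (he : F.erase = G.erase) (hd : Disjoint F.ind G.ind) (hv : F.erase.valency v ≠ 0) :
    ∃ a : SynJudgement v T Ind,
      delta (G.lower ++ F.upper) (F.lower ++ G.upper) = some a.term ∧ a.types = {F.dual, G} ∧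
        a.term.bound = ∅ := by
  have hlu : G.lower.length = F.lower.length := by
    rw [hF.fits.length_lower, hG.fits.length_lower, he]
  have huu : F.upper.length = G.upper.length := by
    rw [hF.fits.length_upper, hG.fits.length_upper, he]
  obtain ⟨e, h⟩ := exists_delta (T := T) (U := G.lower ++ F.upper) (D := F.lower ++ G.upper)
    (by simp [hlu, huu]) (by
      intro hnil
      rw [List.append_eq_nil_iff] at hnil
      apply hv
      ext
      · simp [← hF.fits.length_upper, hnil.2]
      · simp [← hF.fits.length_lower, ← hlu, hnil.1])
  obtain ⟨hF₁, hF₂, hF₃⟩ := List.nodup_append.1 (wf_iff.1 hF).2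
  obtain ⟨hG₁, hG₂, hG₃⟩ := List.nodup_append.1 (wf_iff.1 hG).2
  simp only [Set.disjoint_left, mem_ind] at hd
  have hsep : Separated v ({F.dual, G} : Multiset (TensorType P Ind)) := by
    refine separated_cons.2 ⟨hF.dual, ?_, separated_cons.2 ⟨hG, by simp, separated_zero⟩⟩
    intro B hB
    rw [Multiset.mem_singleton.1 hB, ind_dual]
    simpa only [Set.disjoint_left, mem_ind] using hd
  have hb : e.sup ∩ e.sub = ∅ := by
    rw [sup_delta h, sub_delta h]
    ext i
    simp only [Set.mem_inter_iff, Set.mem_ofPred_eq, List.mem_append, Set.mem_empty_iff_false,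
      iff_false]
    have := @hd i
    have h₁ := fun h h' => hF₃ i h i h' rfl
    have h₂ := fun h h' => hG₃ i h i h' rfl
    tauto
  have hb' := Set.disjoint_iff_inter_eq_empty.2 hb
  refine ⟨⟨e, {F.dual, G}, ?_, hsep.1, hsep.2, ?_, ?_⟩, h, rfl, hb⟩
  · refine wf_delta h (List.nodup_append.2 ⟨hG₂, hF₁, ?_⟩) (List.nodup_append.2 ⟨hF₂, hG₁, ?_⟩)
    · rintro i hi _ hi' rfl
      exact hd (Or.inl hi') (Or.inr hi)
    · rintro i hi _ hi' rfl
      exact hd (Or.inr hi) (Or.inl hi')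
  · rw [fsup, sdiff_eq_left.2 hb', sup_delta h]
    ext i
    simp only [Multiset.insert_eq_cons, Multiset.exists_mem_cons_iff, Set.mem_ofPred_eq, sub_eq,
      Multiset.mem_singleton, exists_eq_left, lower_dual, List.mem_reverse, List.mem_append,
      or_comm]
  · rw [fsub, sdiff_eq_left.2 hb'.symm, sub_delta h]
    ext i
    simp only [Multiset.insert_eq_cons, Multiset.exists_mem_cons_iff, Set.mem_ofPred_eq, sup_eq,
      Multiset.mem_singleton, exists_eq_left, upper_dual, List.mem_reverse, List.mem_append]

/-! ## Composition of judgements -/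

theorem exists_of_forall_mem_iff (a : SynJudgement v T Ind) {Γ : Multiset (TensorType P Ind)}
    (hΓ : Separated v Γ) (hsup : ∀ i, (∃ A ∈ Γ, i ∈ A.sup) ↔ ∃ A ∈ a.types, i ∈ A.sup)
    (hsub : ∀ i, (∃ A ∈ Γ, i ∈ A.sub) ↔ ∃ A ∈ a.types, i ∈ A.sub) :
    ∃ c : SynJudgement v T Ind, c.term = a.term ∧ c.types = Γ :=
  ⟨⟨a.term, Γ, a.term_wf, hΓ.1, hΓ.2, by rw [a.fsup_eq]; ext i; exact (hsub i).symm,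
    by rw [a.fsub_eq]; ext i; exact (hsup i).symm⟩, rfl, rfl⟩

theorem separated_par {A B : TensorType P Ind} {Γ : Multiset (TensorType P Ind)} :
    Separated v (.par A B ::ₘ Γ) ↔ Separated v (A ::ₘ B ::ₘ Γ) := by
  simp only [separated_cons, Multiset.mem_cons, forall_eq_or_imp, TensorType.WF, ind_par,
    Set.disjoint_union_left, forall_and]
  tauto

theorem exists_par (a : SynJudgement v T Ind) {A B : TensorType P Ind}
    {Γ : Multiset (TensorType P Ind)} (ha : a.types = A ::ₘ B ::ₘ Γ) :
    ∃ c : SynJudgement v T Ind, c.term = a.term ∧ c.types = .par A B ::ₘ Γ := by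
  refine a.exists_of_forall_mem_iff (separated_par.2 (ha ▸ a.separated)) (fun i => ?_) fun i => ?_
  · simp only [ha, Multiset.exists_mem_cons_iff, TensorType.sup, Set.mem_union, or_assoc]
  · simp only [ha, Multiset.exists_mem_cons_iff, TensorType.sub, Set.mem_union, or_assoc]

theorem exists_of_par (a : SynJudgement v T Ind) {A B : TensorType P Ind}
    {Γ : Multiset (TensorType P Ind)} (ha : a.types = .par A B ::ₘ Γ) :
    ∃ c : SynJudgement v T Ind, c.term = a.term ∧ c.types = A ::ₘ B ::ₘ Γ := by
  refine a.exists_of_forall_mem_iff (separated_par.1 (ha ▸ a.separated)) (fun i => ?_) fun i => ?_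
  · simp only [ha, Multiset.exists_mem_cons_iff, TensorType.sup, Set.mem_union, or_assoc]
  · simp only [ha, Multiset.exists_mem_cons_iff, TensorType.sub, Set.mem_union, or_assoc]

/-- Each index of `A` is a free lower index of one term and a free upper index of the other, so the
product binds it. Every condition is a Boolean statement about a single index. The bound on
`c.term.bound` lets later constructions keep bound indices out of a given set. -/
theorem exists_cut (a b : SynJudgement v T Ind) {A : TensorType P Ind}
    {Γ Θ : Multiset (TensorType P Ind)} (ha : a.types = A ::ₘ Γ) (hb : b.types = A.dual ::ₘ Θ)
    (hΓΘ : ∀ F ∈ Γ, ∀ H ∈ Θ, Disjoint F.ind H.ind) (hab : Disjoint a.term.bound b.term.ind)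
    (hba : Disjoint b.term.bound a.term.ind) :
    ∃ c : SynJudgement v T Ind, c.term = a.term.mul b.term ∧ c.types = Γ + Θ ∧
      c.term.bound ⊆ a.term.bound ∪ b.term.bound ∪ A.ind := by
  have hsa := a.separated
  have hsb := b.separated
  rw [ha, separated_cons] at hsa
  rw [hb, separated_cons, ind_dual] at hsb
  have hA := fun i => hsa.1.disjoint (i := i)
  have fa := fun i => Set.ext_iff.1 a.fsup_eq i
  have fa' := fun i => Set.ext_iff.1 a.fsub_eq i
  have fb := fun i => Set.ext_iff.1 b.fsup_eq i
  have fb' := fun i => Set.ext_iff.1 b.fsub_eq i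
  simp only [ha, hb, Set.mem_ofPred_eq, Multiset.exists_mem_cons_iff, sub_dual, sup_dual, fsup,
    fsub, Set.mem_sdiff] at fa fa' fb fb'
  have hAΓ : ∀ i, i ∈ A.ind → ¬ ((∃ F ∈ Γ, i ∈ F.sup) ∨ ∃ F ∈ Γ, i ∈ F.sub) := by
    rintro i hi (⟨F, hF, h⟩ | ⟨F, hF, h⟩)
    · exact Set.disjoint_left.1 (hsa.2.1 F hF) hi (Or.inl h)
    · exact Set.disjoint_left.1 (hsa.2.1 F hF) hi (Or.inr h)
  have hAΘ : ∀ i, i ∈ A.ind → ¬ ((∃ F ∈ Θ, i ∈ F.sup) ∨ ∃ F ∈ Θ, i ∈ F.sub) := by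
    rintro i hi (⟨F, hF, h⟩ | ⟨F, hF, h⟩)
    · exact Set.disjoint_left.1 (hsb.2.1 F hF) hi (Or.inl h)
    · exact Set.disjoint_left.1 (hsb.2.1 F hF) hi (Or.inr h)
  have hΓΘ' : ∀ i, ((∃ F ∈ Γ, i ∈ F.sup) ∨ ∃ F ∈ Γ, i ∈ F.sub) →
      ¬ ((∃ F ∈ Θ, i ∈ F.sup) ∨ ∃ F ∈ Θ, i ∈ F.sub) := by
    rintro i (⟨F, hF, h⟩ | ⟨F, hF, h⟩) (⟨H, hH, h'⟩ | ⟨H, hH, h'⟩)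
    · exact Set.disjoint_left.1 (hΓΘ F hF H hH) (Or.inl h) (Or.inl h')
    · exact Set.disjoint_left.1 (hΓΘ F hF H hH) (Or.inl h) (Or.inr h')
    · exact Set.disjoint_left.1 (hΓΘ F hF H hH) (Or.inr h) (Or.inl h')
    · exact Set.disjoint_left.1 (hΓΘ F hF H hH) (Or.inr h) (Or.inr h')
  simp only [Set.disjoint_left, bound, TensorExpr.ind, TensorType.ind, Set.mem_inter_iff,
    Set.mem_union] at hab hba hAΓ hAΘ
  have hsep : Separated v (Γ + Θ) := separated_add.2 ⟨hsa.2.2, hsb.2.2, hΓΘ⟩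
  refine ⟨⟨a.term.mul b.term, Γ + Θ, ⟨a.term_wf, b.term_wf, ?_, ?_⟩, hsep.1, hsep.2, ?_, ?_⟩, rfl,
    rfl, ?_⟩
  · refine Set.disjoint_left.2 fun i h h' => ?_
    have := fa i; have := fa' i; have := fb i; have := fb' i; have := hAΓ i; have := hAΘ i
    have := hΓΘ' i; have := @hab i; have := @hba i; have := hA i
    clear fa fa' fb fb' hAΓ hAΘ hΓΘ' hab hba hA hΓΘ hsa hsb
    grind
  · refine Set.disjoint_left.2 fun i h h' => ?_
    have := fa i; have := fa' i; have := fb i; have := fb' i; have := hAΓ i; have := hAΘ i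
    have := hΓΘ' i; have := @hab i; have := @hba i; have := hA i
    clear fa fa' fb fb' hAΓ hAΘ hΓΘ' hab hba hA hΓΘ hsa hsb
    grind
  · ext i
    simp only [fsup, TensorExpr.sup, TensorExpr.sub, Set.mem_sdiff, Set.mem_union,
      Set.mem_ofPred_eq, Multiset.mem_add, or_and_right, exists_or]
    have := fa i; have := fa' i; have := fb i; have := fb' i; have := hAΓ i; have := hAΘ i
    have := hΓΘ' i; have := @hab i; have := @hba i; have := hA i
    clear fa fa' fb fb' hAΓ hAΘ hΓΘ' hab hba hA hΓΘ hsa hsb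
    grind
  · ext i
    simp only [fsub, TensorExpr.sup, TensorExpr.sub, Set.mem_sdiff, Set.mem_union,
      Set.mem_ofPred_eq, Multiset.mem_add, or_and_right, exists_or]
    have := fa i; have := fa' i; have := fb i; have := fb' i; have := hAΓ i; have := hAΘ i
    have := hΓΘ' i; have := @hab i; have := @hba i; have := hA i
    clear fa fa' fb fb' hAΓ hAΘ hΓΘ' hab hba hA hΓΘ hsa hsb
    grind
  · intro i
    simp only [bound, TensorExpr.sup, TensorExpr.sub, TensorType.ind, Set.mem_inter_iff,
      Set.mem_union]
    have := fa i; have := fa' i; have := fb i; have := fb' i; have := hAΓ i; have := hAΘ i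
    have := hΓΘ' i; have := @hab i; have := @hba i; have := hA i
    clear fa fa' fb fb' hAΓ hAΘ hΓΘ' hab hba hA hΓΘ hsa hsb
    grind

theorem exists_tensor (a b : SynJudgement v T Ind) {A B : TensorType P Ind}
    {Γ Θ : Multiset (TensorType P Ind)} (ha : a.types = A ::ₘ Γ) (hb : b.types = B ::ₘ Θ)
    (hab : Disjoint a.term.ind b.term.ind) :
    ∃ c : SynJudgement v T Ind, c.term = a.term.mul b.term ∧
      c.types = .tensor A B ::ₘ (Γ + Θ) ∧ c.term.bound ⊆ a.term.bound ∪ b.term.bound := by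
  have hsep : Separated v (.tensor A B ::ₘ (Γ + Θ)) := by
    have h : Separated v ((A ::ₘ Γ) + (B ::ₘ Θ)) := by
      rw [← ha, ← hb]
      refine separated_add.2 ⟨a.separated, b.separated, fun F hF H hH => ?_⟩
      exact hab.mono (fun i hi => a.mem_ind_of_mem_types hF hi)
        fun i hi => b.mem_ind_of_mem_types hH hi
    rw [Multiset.cons_add, Multiset.add_cons, ← separated_par] at h
    rw [separated_cons] at h ⊢
    exact h
  have hd : ∀ i, i ∈ a.term.ind → i ∉ b.term.ind := fun _ h => Set.disjoint_left.1 hab h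
  have fa := fun i => Set.ext_iff.1 a.fsup_eq i
  have fa' := fun i => Set.ext_iff.1 a.fsub_eq i
  have fb := fun i => Set.ext_iff.1 b.fsup_eq i
  have fb' := fun i => Set.ext_iff.1 b.fsub_eq i
  simp only [ha, hb, Set.mem_ofPred_eq, Multiset.exists_mem_cons_iff, fsup, fsub, Set.mem_sdiff]
    at fa fa' fb fb'
  refine ⟨⟨a.term.mul b.term, _, ⟨a.term_wf, b.term_wf,
    hab.mono Set.subset_union_left Set.subset_union_left,
    hab.mono Set.subset_union_right Set.subset_union_right⟩, hsep.1, hsep.2, ?_, ?_⟩, rfl, rfl, ?_⟩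
  · ext i
    simp only [fsup, TensorExpr.sup, TensorExpr.sub, Set.mem_sdiff, Set.mem_union,
      Set.mem_ofPred_eq, Multiset.exists_mem_cons_iff, Multiset.mem_add, or_and_right, exists_or,
      TensorType.sub]
    have := fa i; have := fb i; have h := hd i
    simp only [TensorExpr.ind, Set.mem_union] at h
    clear fa fa' fb fb' hd hab hsep
    grind
  · ext i
    simp only [fsub, TensorExpr.sup, TensorExpr.sub, Set.mem_sdiff, Set.mem_union,
      Set.mem_ofPred_eq, Multiset.exists_mem_cons_iff, Multiset.mem_add, or_and_right, exists_or,
      TensorType.sup]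
    have := fa' i; have := fb' i; have h := hd i
    simp only [TensorExpr.ind, Set.mem_union] at h
    clear fa fa' fb fb' hd hab hsep
    grind
  · intro i
    have h := hd i
    simp only [bound, TensorExpr.sup, TensorExpr.sub, TensorExpr.ind, Set.mem_inter_iff,
      Set.mem_union] at h ⊢
    clear fa fa' fb fb' hd hab hsep
    grind

end SynJudgement

/-! ## Word semantics of translations -/

namespace TensorType

variable {P Ind X : Type*} {v : P → ℕ × ℕ}

/-- The implicational type underlying a tensor type whose symbol is a translation or the dual of a
translation; atoms are decorated with their upper and lower indices. -/
def toImp : TensorType P X → ImpType (P × List X × List X)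
  | lit (.pos p) I J => .atom (p, I, J)
  | lit (.neg p) I J => .atom (p, J.reverse, I.reverse)
  | tensor A B => .imp (toImp A) (toImp B)
  | par A B => .imp (toImp B) (toImp A)

theorem toImp_dual (A : TensorType P X) : A.dual.toImp = A.toImp := by
  induction A with
  | lit l I J => cases l <;> simp [dual, Literal.dual, toImp]
  | tensor A B ihA ihB => simp only [dual, toImp, ihA, ihB]
  | par A B ihA ihB => simp only [dual, toImp, ihA, ihB]

/-- The values of the upper and lower indices. -/
def listVal (ν : Ind → X) (A : TensorType P Ind) : List X × List X :=
  (A.upper.map ν, A.lower.map ν)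

theorem listVal_eval (ν : Ind → X) (A : TensorType P Ind) :
    A.listVal ν = ((A.eval ν).upper, (A.eval ν).lower) := by
  rw [upper_eval, lower_eval, listVal]

theorem listVal_congr {ν ν' : Ind → X} {A : TensorType P Ind} (h : ∀ i ∈ A.ind, ν i = ν' i) :
    A.listVal ν = A.listVal ν' := by
  rw [listVal_eval, listVal_eval, eval_congr h]

/-- In the word model an edge with the empty word is an equality of values. -/
theorem eval_eq_of_isIdentity {T : Type*} {e : TensorExpr T Ind} {F G : TensorType P Ind}
    (hF : F.Fits v) (hG : G.Fits v) (he : F.erase = G.erase)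
    (h : e.IsIdentity TensorExpr.suffixRel F G) {ν : Ind → List T}
    (hν : e.Sat TensorExpr.suffixRel ν) : F.eval ν = G.eval ν := by
  obtain ⟨h₁, h₂⟩ := (h ν).1 hν
  have e₁ : F.upper.map ν = G.upper.map ν := by
    rw [← List.forall₂_eq_eq_eq, List.forall₂_map_left_iff, List.forall₂_map_right_iff]
    exact h₁.imp fun i j hij => (show ν j = [] ++ ν i from hij).symm
  have e₂ : F.lower.map ν = G.lower.map ν := by
    rw [← List.forall₂_eq_eq_eq, List.forall₂_map_left_iff, List.forall₂_map_right_iff]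
    exact h₂.imp fun i j hij => hij
  rw [(hF.eval ν).eq_decorate, (hG.eval ν).eq_decorate, erase_eval, erase_eval, upper_eval,
    upper_eval, lower_eval, lower_eval, he, e₁, e₂]

end TensorType

section WordSound

open TensorExpr TensorType LamTerm

variable {P C T Ind : Type*} {v : P → ℕ × ℕ}

/-- A term `t` with links `L` and type `F` is sound for a tensor term `e` if it realizes the value
of `F` under all assignments in the word model that satisfy `e`. -/
def WordSound (base : P × List (List T) × List (List T) → LamTerm T → Prop) (g : C → LamTerm T)
    (L : Multiset (ℕ × ImpType P × TensorType P Ind)) (t : LamTerm C) (F : TensorType P Ind)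
    (e : TensorExpr T Ind) : Prop :=
  ∀ ν, Sat suffixRel ν e → ∀ σ : ℕ → LamTerm T,
    (∀ x ∈ L, Realizes base (x.2.2.eval ν).toImp (σ x.1)) →
      Realizes base (F.eval ν).toImp ((t.mapConst g).subst σ)

variable {base : P × List (List T) × List (List T) → LamTerm T → Prop} {g : C → LamTerm T}
  {L M : Multiset (ℕ × ImpType P × TensorType P Ind)} {t s : LamTerm C}
  {F G H : TensorType P Ind} {d e : TensorExpr T Ind}

theorem WordSound.var (n : ℕ) (A : ImpType P) (hF : F.Fits v) (hG : G.Fits v)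
    (he : F.erase = G.erase) (h : e.IsIdentity suffixRel F G) :
    WordSound base g {(n, A, F.dual)} (.var n) G e := by
  intro ν hν σ hσ
  have := hσ _ (Multiset.mem_singleton_self _)
  rw [eval_dual, toImp_dual, eval_eq_of_isIdentity hF hG he h hν] at this
  exact this

theorem WordSound.lam (hbase : ∀ q u u', BetaEta u u' → base q u → base q u') {A : ImpType P}
    (h : WordSound base g ((0, A, F) ::ₘ L.map (fun x => (x.1 + 1, x.2))) t H e) :
    WordSound base g L (.lam t) (.par H F) e := by
  intro ν hν σ hσ
  refine Realizes.lam hbase fun s hs => h ν hν _ fun x hx => ?_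
  rcases Multiset.mem_cons.1 hx with rfl | hx
  · exact hs
  · obtain ⟨y, hy, rfl⟩ := Multiset.mem_map.1 hx
    exact hσ y hy

/-- One assignment satisfies both factors, so function and argument see the same value of the cut
type `F`. -/
theorem WordSound.app (hd : WordSound base g L t (.par H F.dual) d)
    (he : WordSound base g M s F e) : WordSound base g (L + M) (.app t s) H (d.mul e) := by
  intro ν hν σ hσ
  have h₁ := hd ν hν.1 σ fun x hx => hσ x (Multiset.mem_add.2 (Or.inl hx))
  have h₂ := he ν hν.2 σ fun x hx => hσ x (Multiset.mem_add.2 (Or.inr hx))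
  rw [TensorType.eval, toImp, eval_dual, toImp_dual] at h₁
  exact h₁ _ h₂

end WordSound

/-! ## Order semantics of translations -/

section OrderSound

open TensorExpr TensorType

variable {P C T Ind : Type*} {v : P → ℕ × ℕ}

/-- The pairs of lists that lie strictly above (in the order reversed on the second component) an
element of a set. -/
def shiftUp (n : ℕ × ℕ) (r : Set (List ℚ × List ℚ)) : Set (List ℚ × List ℚ) :=
  {x | ∃ y ∈ r, (y.1.length, y.2.length) = n ∧ List.Forall₂ (· < ·) y.1 x.1 ∧
    List.Forall₂ (· > ·) y.2 x.2}

/-- The application of a set of values of type `A ⊸ B` to a set of values of type `A`. -/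
def applyVal (n m : ℕ × ℕ) (R r : Set (List ℚ × List ℚ)) : Set (List ℚ × List ℚ) :=
  {x | (x.1.length, x.2.length) = m ∧ ∃ y ∈ r, (y.1.length, y.2.length) = n ∧
    (x.1 ++ y.2.reverse, x.2 ++ y.1.reverse) ∈ R}

/-- The logical predicate on sets of values of implicational types. -/
def Productive (v : P → ℕ × ℕ) (base : P → Set (List ℚ × List ℚ) → Prop) :
    ImpType P → Set (List ℚ × List ℚ) → Prop
  | .atom p, r => base p r
  | .imp A B, R => ∀ r, Productive v base A r →
      Productive v base B (applyVal (A.tr.valency v) (B.tr.valency v) R r)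

/-- The properties of predicates that are inherited by the logical predicate they generate. -/
structure ProductiveBase (v : P → ℕ × ℕ) (base : P → Set (List ℚ × List ℚ) → Prop) : Prop where
  mono : ∀ p r r', r ⊆ r' → base p r → base p r'
  shiftUp : ∀ p r, base p r → base p (shiftUp (v p) r)
  nonempty : ∀ p r, base p r → ∃ x ∈ r, (x.1.length, x.2.length) = v p
  univ : ∀ p, base p Set.univ

variable {base : P → Set (List ℚ × List ℚ) → Prop}

theorem Productive.mono (hb : ProductiveBase v base) {A : ImpType P} {r r' : Set (List ℚ × List ℚ)}
    (h : r ⊆ r') (hr : Productive v base A r) : Productive v base A r' := by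
  induction A generalizing r r' with
  | atom p => exact hb.mono p r r' h hr
  | imp A B _ ihB =>
    intro s hs
    refine ihB ?_ (hr s hs)
    rintro x ⟨hx, y, hy, hn, hm⟩
    exact ⟨hx, y, hy, hn, h hm⟩

/-- At `A ⊸ B`, the hypothesis on `R` is used with a shifted argument and the result is shifted as
well. Dual positions carry the reversed order, so both shifts combine to one shift of the element of
`R`, paired with the unshifted argument. -/
theorem Productive.shiftUp (hb : ProductiveBase v base) {A : ImpType P} {r : Set (List ℚ × List ℚ)}
    (hr : Productive v base A r) : Productive v base A (shiftUp (A.tr.valency v) r) := by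
  induction A generalizing r with
  | atom p => exact hb.shiftUp p r hr
  | imp A B ihA ihB =>
    intro s hs
    refine Productive.mono hb ?_ (ihB (hr _ (ihA hs)))
    rintro x' ⟨x, ⟨hx, y, ⟨z, hz, hzlen, hz₁, hz₂⟩, hylen, hmem⟩, -, hx₁, hx₂⟩
    refine ⟨?_, z, hz, hzlen, _, hmem, ?_, ?_, ?_⟩
    · rw [← hx, hx₁.length_eq, hx₂.length_eq]
    · simp only [Prod.ext_iff] at hx hylen
      simp only [List.length_append, List.length_reverse, hx.1, hx.2, hylen.1, hylen.2, ImpType.tr,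
        TensorSymbol.valency, TensorSymbol.valency_dual]
      rfl
    · exact List.rel_append hx₁ (List.forall₂_reverse_iff.2 hz₂.flip)
    · exact List.rel_append hx₂ (List.forall₂_reverse_iff.2 hz₁.flip)

/-- The halves depend on each other. An element of `R : A ⊸ B` is found by applying `R` to the
universal set at `A`; and the universal set at `A ⊸ B` yields results only from arguments that are
known to be inhabited. -/
theorem Productive.nonempty_and_univ (hb : ProductiveBase v base) (A : ImpType P) :
    (∀ r, Productive v base A r → ∃ x ∈ r, (x.1.length, x.2.length) = A.tr.valency v) ∧
      Productive v base A Set.univ := by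
  induction A with
  | atom p => exact ⟨hb.nonempty p, hb.univ p⟩
  | imp A B ihA ihB =>
    constructor
    · intro R hR
      obtain ⟨x, ⟨hx, y, -, hy, hm⟩, -⟩ := ihB.1 _ (hR _ ihA.2)
      refine ⟨_, hm, ?_⟩
      simp only [Prod.ext_iff] at hx hy
      simp only [List.length_append, List.length_reverse, hx.1, hx.2, hy.1, hy.2, ImpType.tr,
        TensorSymbol.valency, TensorSymbol.valency_dual]
      rfl
    · intro r hr
      obtain ⟨y, hy, hylen⟩ := ihA.1 r hr
      -- The shift serves only to restrict the universal set to pairs of lists of the right lengths.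
      refine Productive.mono hb ?_ (ihB.2.shiftUp hb)
      rintro x ⟨z, -, hz, h₁, h₂⟩
      exact ⟨by rw [← h₁.length_eq, ← h₂.length_eq, hz], y, hy, hylen, trivial⟩

/-- The set of values of `F` under the assignments that satisfy `e` in the order model and send the
links `L` to elements of the given sets. -/
def orderValues (ρ : ℕ → Set (List ℚ × List ℚ))
    (L : Multiset (ℕ × ImpType P × TensorType P Ind)) (F : TensorType P Ind)
    (e : TensorExpr T Ind) : Set (List ℚ × List ℚ) :=
  {x | ∃ ν, Sat orderRel ν e ∧ (∀ y ∈ L, y.2.2.dual.listVal ν ∈ ρ y.1) ∧ x = F.listVal ν}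

/-- The values of a translation in the order model satisfy the logical predicate of its type. -/
def OrderSound (v : P → ℕ × ℕ) (base : P → Set (List ℚ × List ℚ) → Prop)
    (L : Multiset (ℕ × ImpType P × TensorType P Ind)) (A : ImpType P) (F : TensorType P Ind)
    (e : TensorExpr T Ind) : Prop :=
  ∀ ρ : ℕ → Set (List ℚ × List ℚ), (∀ x ∈ L, Productive v base x.2.1 (ρ x.1)) →
    Productive v base A (orderValues ρ L F e)

/-! ### Assignments with prescribed values, and order soundness of the typing rules -/

theorem exists_map_eq {X : Type*} [Inhabited X] {l : List Ind} (hl : l.Nodup) {m : List X}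
    (h : l.length = m.length) : ∃ ν : Ind → X, l.map ν = m := by
  classical
  induction l generalizing m with
  | nil => exact ⟨fun _ => default, (List.length_eq_zero_iff.1 h.symm).symm⟩
  | cons i l ih =>
    cases m with
    | nil => cases h
    | cons x m =>
      rw [List.nodup_cons] at hl
      obtain ⟨ν, hν⟩ := ih hl.2 (m := m) (by simpa using h)
      refine ⟨Function.update ν i x, ?_⟩
      rw [List.map_cons, Function.update_self, ← hν]
      congr 1
      refine List.map_congr_left fun j hj => Function.update_of_ne ?_ _ _
      rintro rfl
      exact hl.1 hj

theorem exists_listVal_eq {F G : TensorType P Ind} (hF : F.WF v) (hG : G.WF v)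
    (hd : Disjoint F.ind G.ind) {x y : List ℚ × List ℚ}
    (hx : (x.1.length, x.2.length) = F.erase.valency v)
    (hy : (y.1.length, y.2.length) = G.erase.valency v) :
    ∃ ν : Ind → ℚ, F.listVal ν = x ∧ G.listVal ν = y := by
  rw [Prod.ext_iff, ← hF.fits.length_upper, ← hF.fits.length_lower] at hx
  rw [Prod.ext_iff, ← hG.fits.length_upper, ← hG.fits.length_lower] at hy
  dsimp only at hx hy
  have hnd : ((F.upper ++ F.lower) ++ (G.upper ++ G.lower)).Nodup := by
    refine List.nodup_append.2 ⟨(wf_iff.1 hF).2, (wf_iff.1 hG).2, ?_⟩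
    rintro i hi _ hi' rfl
    exact Set.disjoint_left.1 hd (mem_ind.2 (List.mem_append.1 hi))
      (mem_ind.2 (List.mem_append.1 hi'))
  obtain ⟨ν, hν⟩ := exists_map_eq hnd (m := (x.1 ++ x.2) ++ (y.1 ++ y.2)) (by
    simp only [List.length_append, hx.1, hx.2, hy.1, hy.2])
  simp only [List.map_append] at hν
  obtain ⟨h₁, h₂⟩ := List.append_inj hν
    (by simp only [List.length_append, List.length_map, hx.1, hx.2])
  obtain ⟨h₃, h₄⟩ := List.append_inj h₁ (by simp only [List.length_map, hx.1])
  obtain ⟨h₅, h₆⟩ := List.append_inj h₂ (by simp only [List.length_map, hy.1])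
  exact ⟨ν, Prod.ext h₃ h₄, Prod.ext h₅ h₆⟩

variable {L M : Multiset (ℕ × ImpType P × TensorType P Ind)} {A B : ImpType P}
  {F G H : TensorType P Ind} {d e : TensorExpr T Ind}

/-- Edges with the empty word are strict, so an identity acts on values as `shiftUp`; this is why
predicates must be closed under shifts. -/
theorem OrderSound.var (hb : ProductiveBase v base) (n : ℕ) (hF : F.WF v) (hG : G.WF v)
    (hd : Disjoint F.ind G.ind) (hFA : F.erase = A.tr) (hGA : G.erase = A.tr)
    (h : e.IsIdentity orderRel F G) : OrderSound v base {(n, A, F.dual)} A G e := by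
  intro ρ hρ
  refine Productive.mono hb ?_ ((hρ _ (Multiset.mem_singleton_self _)).shiftUp hb)
  rintro x ⟨y, hy, hlen, h₁, h₂⟩
  obtain ⟨ν, hνF, hνG⟩ := exists_listVal_eq hF hG hd (x := y) (y := x) (hlen.trans (hFA ▸ rfl))
    (by rw [← h₁.length_eq, ← h₂.length_eq, hlen, hGA])
  refine ⟨ν, (h ν).2 ?_, ?_, hνG.symm⟩
  · rw [← hνF, ← hνG, listVal, listVal] at h₁ h₂
    rw [List.forall₂_map_left_iff, List.forall₂_map_right_iff] at h₁ h₂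
    exact ⟨h₁, h₂⟩
  · intro z hz
    rw [Multiset.mem_singleton.1 hz, dual_dual, hνF]
    exact hy

theorem OrderSound.lam (hb : ProductiveBase v base) (hF : F.Fits v) (hH : H.Fits v)
    (hFA : F.erase = A.tr.dual) (hHB : H.erase = B.tr)
    (h : OrderSound v base ((0, A, F) ::ₘ L.map (fun x => (x.1 + 1, x.2))) B H e) :
    OrderSound v base L (.imp A B) (.par H F) e := by
  intro ρ hρ r hr
  refine Productive.mono hb ?_ (h (fun n => n.casesOn r ρ) ?_)
  · rintro _ ⟨ν, hν, hL, rfl⟩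
    refine ⟨?_, _, hL _ (Multiset.mem_cons_self _ _), ?_, ν, hν, fun y hy => ?_, ?_⟩
    · simp only [listVal, List.length_map, hH.length_upper, hH.length_lower, hHB]
    · simp only [listVal, List.length_map, upper_dual, lower_dual, List.length_reverse,
        hF.length_upper, hF.length_lower, hFA, TensorSymbol.valency_dual]
      rfl
    · exact hL _ (Multiset.mem_cons_of_mem (Multiset.mem_map_of_mem _ hy))
    · simp only [listVal, upper_dual, lower_dual, List.map_reverse, List.reverse_reverse, upper,
        lower, List.map_append]
  · intro x hx
    rcases Multiset.mem_cons.1 hx with rfl | hx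
    · exact hr
    · obtain ⟨y, hy, rfl⟩ := Multiset.mem_map.1 hx
      exact hρ y hy

theorem Sat.exists_glue {X : Type*} {R : List T → X → X → Prop} {ν₁ ν₂ : Ind → X}
    (h₁ : Sat R ν₁ d) (h₂ : Sat R ν₂ e) (h : ∀ i ∈ d.ind, i ∈ e.ind → ν₁ i = ν₂ i) :
    ∃ ν, Sat R ν (d.mul e) ∧ (∀ i ∈ d.ind, ν i = ν₁ i) ∧ ∀ i ∈ e.ind, ν i = ν₂ i := by
  classical
  have h₁' : ∀ i ∈ d.ind, (fun i => if i ∈ d.ind then ν₁ i else ν₂ i) i = ν₁ i :=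
    fun i hi => if_pos hi
  have h₂' : ∀ i ∈ e.ind, (fun i => if i ∈ d.ind then ν₁ i else ν₂ i) i = ν₂ i := by
    intro i hi
    by_cases hd : i ∈ d.ind
    · rw [h₁' i hd, h i hd hi]
    · exact if_neg hd
  exact ⟨_, ⟨h₁.congr fun i hi => (h₁' i hi).symm, h₂.congr fun i hi => (h₂' i hi).symm⟩, h₁', h₂'⟩

/-- Function and argument are evaluated under separate assignments. Membership in `applyVal` makes
these agree on `F`, and the two terms share no other indices, so the assignments glue to one that
satisfies the product. -/
theorem OrderSound.app (hb : ProductiveBase v base) (hH : H.Fits v) (hHB : H.erase = B.tr)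
    (hd : OrderSound v base L (.imp A B) (.par H F.dual) d) (he : OrderSound v base M A F e)
    (hde : d.ind ∩ e.ind ⊆ F.ind) (hHd : H.ind ⊆ d.ind)
    (hL : ∀ x ∈ L, x.2.2.ind ⊆ d.ind) (hM : ∀ x ∈ M, x.2.2.ind ⊆ e.ind) :
    OrderSound v base (L + M) B H (d.mul e) := by
  intro ρ hρ
  have h₁ := hd ρ fun x hx => hρ x (Multiset.mem_add.2 (Or.inl hx))
  have h₂ := he ρ fun x hx => hρ x (Multiset.mem_add.2 (Or.inr hx))
  refine Productive.mono hb ?_ (h₁ _ h₂)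
  rintro ⟨U, D⟩ ⟨hlen, _, ⟨ν₂, hν₂, hL₂, rfl⟩, -, ν₁, hν₁, hL₁, heq⟩
  simp only [listVal, upper, lower, upper_dual, lower_dual, List.map_append, List.map_reverse,
    Prod.mk.injEq] at heq hlen
  rw [← hHB, Prod.ext_iff, ← hH.length_upper, ← hH.length_lower] at hlen
  obtain ⟨hU, hlow⟩ := List.append_inj heq.1 (by simpa using hlen.1)
  obtain ⟨hD, hup⟩ := List.append_inj heq.2 (by simpa using hlen.2)
  rw [List.reverse_inj] at hlow hup
  have hagree : ∀ i ∈ F.ind, ν₁ i = ν₂ i := by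
    intro i hi
    rcases mem_ind.1 hi with hi | hi
    · exact (List.map_inj_left.1 hup i hi).symm
    · exact (List.map_inj_left.1 hlow i hi).symm
  obtain ⟨ν, hν, hνd, hνe⟩ := Sat.exists_glue hν₁ hν₂ fun i hi hi' => hagree i (hde ⟨hi, hi'⟩)
  refine ⟨ν, hν, fun x hx => ?_, ?_⟩
  · rcases Multiset.mem_add.1 hx with hx | hx
    · rw [listVal_congr fun i hi => hνd i (hL x hx (ind_dual x.2.2 ▸ hi))]
      exact hL₁ x hx
    · rw [listVal_congr fun i hi => hνe i (hM x hx (ind_dual x.2.2 ▸ hi))]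
      exact hL₂ x hx
  · rw [listVal_congr fun i hi => hνd i (hHd hi), listVal, hU, hD]

/-- Productive sets are inhabited, and an element of `orderValues` comes from a satisfying
assignment. -/
theorem OrderSound.acyclic (hb : ProductiveBase v base) (h : OrderSound v base 0 A F e) :
    e.Acyclic := by
  obtain ⟨x, ⟨ν, hν, -⟩, -⟩ :=
    (Productive.nonempty_and_univ hb A).1 _ (h (fun _ => ∅) (by simp))
  exact ⟨ν, hν⟩

end OrderSound

/-! ## Translations -/

theorem Multiset.exists_of_map_eq_add {α β : Type*} {f : α → β} {s : Multiset α}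
    {t u : Multiset β} (h : s.map f = t + u) :
    ∃ t' u', s = t' + u' ∧ t'.map f = t ∧ u'.map f = u := by
  induction t using Multiset.induction_on generalizing s with
  | empty => exact ⟨0, s, by simp, rfl, by simpa using h⟩
  | cons a t ih =>
    rw [Multiset.cons_add] at h
    obtain ⟨b, hb, rfl⟩ := Multiset.mem_map.1 (h ▸ Multiset.mem_cons_self a _)
    obtain ⟨s, rfl⟩ := Multiset.exists_cons_of_mem hb
    rw [Multiset.map_cons, Multiset.cons_inj_right] at h
    obtain ⟨t', u', rfl, rfl, rfl⟩ := ih h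
    exact ⟨b ::ₘ t', u', by simp, by simp, rfl⟩

/-- The final target atom alone makes the valency nonzero; hence the delta of every variable is
defined. -/
theorem ImpType.valency_tr_ne_zero {P : Type*} {v : P → ℕ × ℕ} (hv : ∀ p, v p ≠ 0)
    (A : ImpType P) : A.tr.valency v ≠ 0 := by
  induction A with
  | atom p => exact hv p
  | imp A B _ ihB =>
    intro h
    apply ihB
    simp only [tr, TensorSymbol.valency, Prod.ext_iff, Prod.fst_add, Prod.snd_add, Prod.fst_zero,
      Prod.snd_zero, Nat.add_eq_zero_iff] at h
    exact Prod.ext h.1.1 h.2.1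

section Translates

open TensorExpr TensorType

variable {P C T Ind : Type*} {sig : LamSignature P C} {v : P → ℕ × ℕ}
  {ax : C → Set (TypingJudgement v T Ind)}
  {L : Multiset (ℕ × ImpType P × TensorType P Ind)} {t : LamTerm C} {A : ImpType P}
  {F : TensorType P Ind} {e : TensorExpr T Ind}

theorem Translates.exists_judgement (h : Translates sig v ax L t A F e) :
    ∃ a : SynJudgement v T Ind, a.term = e ∧ a.types = F ::ₘ L.map (fun x => x.2.2) := by
  induction h with
  | var n A I J I' J' a hterm htypes => exact ⟨a, rfl, by rw [htypes]; exact Multiset.pair_comm _ _⟩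
  | const c I J a ha htypes => exact ⟨a, rfl, htypes⟩
  | app hdisj a hterm htypes => exact ⟨a, hterm, by rw [htypes, Multiset.map_add]⟩
  | lam _ ih =>
    obtain ⟨a, ha, htypes⟩ := ih
    rw [Multiset.map_cons, Multiset.map_map] at htypes
    obtain ⟨c, hc, hct⟩ := a.exists_par htypes
    exact ⟨c, hc.trans ha, hct⟩

theorem Translates.erase_eq (h : Translates sig v ax L t A F e) :
    F.erase = A.tr ∧ ∀ x ∈ L, x.2.2.erase = x.2.1.tr.dual := by
  induction h with
  | var n A I J I' J' a hterm htypes =>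
    refine ⟨erase_decorate _ _ _, fun x hx => ?_⟩
    rw [Multiset.mem_singleton.1 hx]
    exact erase_decorate _ _ _
  | const c I J a ha htypes => exact ⟨erase_decorate _ _ _, by simp⟩
  | app hdisj a hterm htypes _ _ ih₁ ih₂ =>
    refine ⟨(TensorSymbol.par.inj ih₁.1).1, fun x hx => ?_⟩
    rcases Multiset.mem_add.1 hx with hx | hx
    exacts [ih₁.2 x hx, ih₂.2 x hx]
  | lam _ ih =>
    refine ⟨?_, fun x hx => ?_⟩
    · rw [erase, ih.1, ih.2 _ (Multiset.mem_cons_self _ _)]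
      rfl
    · exact ih.2 (x.1 + 1, x.2)
        (Multiset.mem_cons_of_mem (Multiset.mem_map_of_mem (fun x => (x.1 + 1, x.2)) hx))

theorem Translates.wordSound {base : P × List (List T) × List (List T) → LamTerm T → Prop}
    {g : C → LamTerm T} (hbase : ∀ q u u', LamTerm.BetaEta u u' → base q u → base q u')
    (hax : ∀ (c : C) (F : TensorType P Ind) (a : SynJudgement v T Ind), a.toJudgement ∈ ax c →
      F.erase = (sig.typ c).tr → a.types = {F} → WordSound base g 0 (.const c) F a.term)
    (h : Translates sig v ax L t A F e) : WordSound base g L t F e := by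
  induction h with
  | var n A I J I' J' a hterm htypes =>
    have hI := (a.types_wf (A.tr.dual.decorate v I J) (by simp [htypes])).fits
    have hG := (a.types_wf (A.tr.decorate v J' I') (by simp [htypes])).fits
    have he : (A.tr.dual.decorate v I J).dual.erase = (A.tr.decorate v J' I').erase := by
      rw [erase_dual, erase_decorate, erase_decorate, TensorSymbol.dual_dual]
    have := WordSound.var (base := base) (g := g) n A hI.dual hG he
      (SynJudgement.isIdentity_delta suffixRel hI.dual hG he (by
        rwa [upper_dual, lower_dual, upper_decorate, upper_decorate, lower_decorate,
          lower_decorate]))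
    rwa [dual_dual] at this
  | const c I J a ha htypes => exact hax c _ a ha (erase_decorate _ _ _) htypes
  | app hdisj a hterm htypes _ _ ih₁ ih₂ => exact ih₁.app ih₂
  | lam _ ih => exact ih.lam hbase

/-- A shared index cannot be upper in both factors or lower in both, so it is free in each of them.
It then occurs in a type of each premise, and only the cut type allows this, as the types of the
conclusion are pairwise disjoint. -/
theorem SynJudgement.ind_inter_ind_subset {a b c : SynJudgement v T Ind} {F H : TensorType P Ind}
    {Γ Θ : Multiset (TensorType P Ind)} (ha : a.types = .par H F.dual ::ₘ Γ)
    (hb : b.types = F ::ₘ Θ) (hc : c.term = a.term.mul b.term) (hct : c.types = H ::ₘ (Γ + Θ)) :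
    a.term.ind ∩ b.term.ind ⊆ F.ind := by
  have hsep : Separated v ((H ::ₘ Γ) + Θ) := by
    rw [Multiset.cons_add, ← hct]
    exact c.separated
  have hd := (separated_add.1 hsep).2.2
  have hw := c.term_wf
  rw [hc] at hw
  obtain ⟨-, -, h₁, h₂⟩ := hw
  have hfree : ∀ i, i ∈ a.term.fsup ∪ a.term.fsub → i ∈ b.term.fsup ∪ b.term.fsub → i ∈ F.ind := by
    intro i hi hi'
    obtain ⟨A, hA, hiA⟩ := a.mem_free_iff.1 hi
    obtain ⟨B, hB, hiB⟩ := b.mem_free_iff.1 hi'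
    rw [hb] at hB
    rcases Multiset.mem_cons.1 hB with rfl | hB
    · exact hiB
    rw [ha] at hA
    rcases Multiset.mem_cons.1 hA with rfl | hA
    · rw [ind_par, ind_dual] at hiA
      exact hiA.resolve_left fun h =>
        Set.disjoint_left.1 (hd H (Multiset.mem_cons_self _ _) B hB) h hiB
    · exact absurd hiB (Set.disjoint_left.1 (hd A (Multiset.mem_cons_of_mem hA) B hB) hiA)
  rintro i ⟨hi, hi'⟩
  refine hfree i ?_ ?_
  · rcases hi with hi | hi
    · exact Or.inl ⟨hi, fun h => hi'.elim (fun h' => Set.disjoint_left.1 h₁ hi h')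
        fun h' => Set.disjoint_left.1 h₂ h h'⟩
    · exact Or.inr ⟨hi, fun h => hi'.elim (fun h' => Set.disjoint_left.1 h₁ h h')
        fun h' => Set.disjoint_left.1 h₂ hi h'⟩
  · rcases hi' with hi' | hi'
    · exact Or.inl ⟨hi', fun h => hi.elim (fun h' => Set.disjoint_left.1 h₁ h' hi')
        fun h' => Set.disjoint_left.1 h₂ h' h⟩
    · exact Or.inr ⟨hi', fun h => hi.elim (fun h' => Set.disjoint_left.1 h₁ h' h)
        fun h' => Set.disjoint_left.1 h₂ h' hi'⟩

theorem Translates.orderSound {base : P → Set (List ℚ × List ℚ) → Prop}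
    (hb : ProductiveBase v base)
    (hax : ∀ (c : C) (F : TensorType P Ind) (a : SynJudgement v T Ind), a.toJudgement ∈ ax c →
      F.erase = (sig.typ c).tr → a.types = {F} → OrderSound v base 0 (sig.typ c) F a.term)
    (h : Translates sig v ax L t A F e) : OrderSound v base L A F e := by
  induction h with
  | var n A I J I' J' a hterm htypes =>
    have hI := a.types_wf (A.tr.dual.decorate v I J) (by simp [htypes])
    have hG := a.types_wf (A.tr.decorate v J' I') (by simp [htypes])
    have he : (A.tr.dual.decorate v I J).dual.erase = A.tr := by
      rw [erase_dual, erase_decorate, TensorSymbol.dual_dual]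
    have hd : Disjoint (A.tr.dual.decorate v I J).ind (A.tr.decorate v J' I').ind := by
      have := a.separated
      rw [htypes] at this
      exact (separated_cons.1 this).2.1 _ (Multiset.mem_singleton_self _)
    have := OrderSound.var hb n hI.dual hG (by rwa [ind_dual]) he (erase_decorate _ _ _)
      (SynJudgement.isIdentity_delta orderRel hI.dual.fits hG.fits
        (he.trans (erase_decorate _ _ _).symm) (by
        rwa [upper_dual, lower_dual, upper_decorate, upper_decorate, lower_decorate,
          lower_decorate]))
    rwa [dual_dual] at this
  | const c I J a ha htypes => exact hax c _ a ha (erase_decorate _ _ _) htypes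
  | @app L M t s A B F H d e hdisj a hterm htypes h₁ h₂ ih₁ ih₂ =>
    obtain ⟨b, rfl, hbt⟩ := h₁.exists_judgement
    obtain ⟨c, rfl, hct⟩ := h₂.exists_judgement
    refine OrderSound.app hb (a.types_wf H (by simp [htypes])).fits
      (TensorSymbol.par.inj h₁.erase_eq.1).1 ih₁ ih₂
      (SynJudgement.ind_inter_ind_subset hbt hct hterm htypes) ?_ ?_ ?_
    · exact fun i hi => b.mem_ind_of_mem_types (hbt ▸ Multiset.mem_cons_self _ _)
        (ind_par H F.dual ▸ Or.inl hi)
    · exact fun x hx i hi => b.mem_ind_of_mem_types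
        (hbt ▸ Multiset.mem_cons_of_mem (Multiset.mem_map_of_mem _ hx)) hi
    · exact fun x hx i hi => c.mem_ind_of_mem_types
        (hct ▸ Multiset.mem_cons_of_mem (Multiset.mem_map_of_mem _ hx)) hi
  | lam h ih =>
    obtain ⟨b, rfl, hbt⟩ := h.exists_judgement
    refine ih.lam hb (b.types_wf _ ?_).fits (b.types_wf _ ?_).fits
      (h.erase_eq.2 _ (Multiset.mem_cons_self _ _)) h.erase_eq.1
    · rw [hbt, Multiset.map_cons]
      exact Multiset.mem_cons_of_mem (Multiset.mem_cons_self _ _)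
    · rw [hbt]
      exact Multiset.mem_cons_self _ _

theorem Translates.len_eq (hax : ∀ (c : C) (a : SynJudgement v T Ind), a.toJudgement ∈ ax c →
      a.term.len = 1) (h : Translates sig v ax L t A F e) : e.len = t.numConst := by
  induction h with
  | var n A I J I' J' a hterm htypes => exact len_delta hterm
  | const c I J a ha htypes => exact hax c a ha
  | app hdisj a hterm htypes _ _ ih₁ ih₂ => simp only [len, LamTerm.numConst, ih₁, ih₂]
  | lam _ ih => exact ih

theorem TensorType.finite_setOf_mem_ind (Γ : Multiset (TensorType P Ind)) :
    {i | ∃ A ∈ Γ, i ∈ A.ind}.Finite := by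
  induction Γ using Multiset.induction_on with
  | empty => simp
  | cons A Γ ih =>
    simp only [Multiset.exists_mem_cons_iff]
    exact A.finite_ind.union ih

/-- The types of the conclusion and of the links are prescribed, and bound indices are kept out of
the finite set `Z`. Both are generalized in the induction, so that in an application the second
premise can be made to avoid all indices of the first. -/
theorem exists_translates [Infinite Ind] (hv : ∀ p, v p ≠ 0)
    (hax : ∀ (c : C) (F : TensorType P Ind), F.WF v → F.erase = (sig.typ c).tr →
      ∀ Z : Set Ind, Z.Finite → ∃ a : SynJudgement v T Ind, a.toJudgement ∈ ax c ∧
        a.types = {F} ∧ Disjoint a.term.bound Z)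
    {X : Multiset (ℕ × ImpType P)} (h : sig.Derivable X t A)
    (hL : L.map (fun x => (x.1, x.2.1)) = X) (hLe : ∀ x ∈ L, x.2.2.erase = x.2.1.tr.dual)
    (hF : F.erase = A.tr) (hsep : Separated v (F ::ₘ L.map (fun x => x.2.2))) {Z : Set Ind}
    (hZ : Z.Finite) :
    ∃ a : SynJudgement v T Ind, Translates sig v ax L t A F a.term ∧
      a.types = F ::ₘ L.map (fun x => x.2.2) ∧ Disjoint a.term.bound Z := by
  induction h generalizing L F Z with
  | var n A =>
    obtain ⟨⟨m, A', G⟩, rfl, heq⟩ := Multiset.map_eq_singleton.1 hL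
    cases heq
    have hGe := hLe _ (Multiset.mem_singleton_self _)
    obtain ⟨hFw, hFG, hG⟩ := separated_cons.1 hsep
    rw [Multiset.map_singleton] at hG hFG
    have hGw := (separated_cons.1 hG).1
    have hd := hFG _ (Multiset.mem_singleton_self _)
    dsimp only at hGe hGw hd
    obtain ⟨a, ha, hat, hab⟩ := SynJudgement.exists_identity (T := T) hGw.dual hFw
      (by rw [erase_dual, hGe, TensorSymbol.dual_dual, hF]) (by rw [ind_dual]; exact hd.symm)
      (by rw [erase_dual, hGe, TensorSymbol.dual_dual]; exact A'.valency_tr_ne_zero hv)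
    rw [dual_dual] at hat
    refine ⟨a, ?_, hat.trans (Multiset.pair_comm _ _), by rw [hab]; exact Set.empty_disjoint _⟩
    have hG' := hGw.fits.eq_decorate
    have hF' := hFw.fits.eq_decorate
    rw [hGe] at hG'
    rw [hF] at hF'
    rw [upper_dual, lower_dual] at ha
    dsimp only at hF' ⊢
    rw [hG', hF']
    exact Translates.var _ A' _ _ _ _ a ha (hat.trans (by rw [← hG', ← hF']))
  | const c =>
    obtain rfl := Multiset.map_eq_zero.1 hL
    have hFw := (separated_cons.1 hsep).1
    obtain ⟨a, ha, hat, hab⟩ := hax c F hFw hF Z hZ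
    refine ⟨a, ?_, hat, hab⟩
    have hF' := hFw.fits.eq_decorate
    rw [hF] at hF'
    rw [hF']
    exact Translates.const c _ _ a ha (hat.trans (by rw [← hF']))
  | @app X Y t s A B hdisj h₁ h₂ ih₁ ih₂ =>
    obtain ⟨L₁, L₂, rfl, rfl, rfl⟩ := Multiset.exists_of_map_eq_add hL
    rw [Multiset.map_add] at hsep
    have hW := hZ.union (TensorType.finite_setOf_mem_ind
      (F ::ₘ (L₁.map (fun x => x.2.2) + L₂.map (fun x => x.2.2))))
    -- The cut type. Its indices become bound in the product, so they must avoid `Z` and the types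
    -- of the conclusion.
    obtain ⟨G, hG, hGe, hGd⟩ := exists_fresh v A.tr hW
    have hGd' : ∀ B ∈ F ::ₘ (L₁.map (fun x => x.2.2) + L₂.map (fun x => x.2.2)),
        Disjoint G.ind B.ind := fun B hB =>
      hGd.mono_right fun i hi => Or.inr ⟨B, hB, hi⟩
    have hsep' := hsep
    rw [← Multiset.cons_add, separated_add] at hsep'
    obtain ⟨hs₁, hs₂, hs₁₂⟩ := hsep'
    obtain ⟨a, ha, hat, hab⟩ := ih₁ (L := L₁) (F := .par F G.dual) rfl
      (fun x hx => hLe x (Multiset.mem_add.2 (Or.inl hx)))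
      (by rw [erase, hF, erase_dual, hGe]; rfl)
      (SynJudgement.separated_par.2 (by
        rw [Multiset.cons_swap, separated_cons, ind_dual]
        refine ⟨hG.dual, fun B hB => hGd' B ?_, hs₁⟩
        rw [← Multiset.cons_add]
        exact Multiset.mem_add.2 (Or.inl hB))) (hW.union G.finite_ind)
    obtain ⟨b, hb, hbt, hbb⟩ := ih₂ (L := L₂) (F := G) rfl
      (fun x hx => hLe x (Multiset.mem_add.2 (Or.inr hx))) hGe
      (separated_cons.2 ⟨hG, fun B hB => hGd' B (Multiset.mem_cons_of_mem
        (Multiset.mem_add.2 (Or.inr hB))), hs₂⟩) ((hW.union G.finite_ind).union a.term.finite_ind)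
    obtain ⟨a', ha', hat'⟩ := a.exists_of_par hat
    rw [Multiset.cons_swap] at hat'
    rw [← ha'] at ha hab hbb
    simp only [Set.disjoint_union_right] at hab hbb hGd
    obtain ⟨c, hc, hct, hcb⟩ := SynJudgement.exists_cut a' b hat' (by rw [dual_dual, hbt])
      hs₁₂ (by
        rw [ind_eq, Set.disjoint_union_right]
        refine ⟨Set.disjoint_left.2 fun i hi hi' => ?_,
          (hbb.2.mono_right fun i hi => Or.inl hi.1).symm⟩
        obtain ⟨B, hB, hiB⟩ := b.mem_free_iff.1 hi'
        rw [hbt] at hB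
        rcases Multiset.mem_cons.1 hB with rfl | hB
        · exact Set.disjoint_left.1 hab.2 hi hiB
        · exact Set.disjoint_left.1 hab.1.2 hi
            ⟨B, Multiset.mem_cons_of_mem (Multiset.mem_add.2 (Or.inr hB)), hiB⟩) hbb.2
    refine ⟨c, ?_, ?_, ?_⟩
    · rw [hc]
      refine Translates.app (fun x hx y hy => ?_) c hc (by rw [hct, Multiset.cons_add]) ha hb
      exact hdisj _ (Multiset.mem_map_of_mem _ hx) _ (Multiset.mem_map_of_mem _ hy)
    · rw [hct, Multiset.cons_add, Multiset.map_add]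
    · refine Set.disjoint_of_subset_left hcb ?_
      rw [Set.disjoint_union_left, Set.disjoint_union_left, ind_dual]
      exact ⟨⟨hab.1.1, hbb.1.1.1⟩, hGd.1⟩
  | @lam X t A B h ih =>
    cases F with
    | lit l I J => cases hF
    | tensor H G => cases hF
    | par H G =>
      obtain ⟨hH, hG⟩ := TensorSymbol.par.inj hF
      have hmap : (L.map (fun x => (x.1 + 1, x.2))).map (fun x => x.2.2) =
          L.map (fun x => x.2.2) := by
        rw [Multiset.map_map]; rfl
      obtain ⟨a, ha, hat, hab⟩ := ih (L := (0, A, G) ::ₘ L.map (fun x => (x.1 + 1, x.2))) (F := H)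
        (by rw [← hL, Multiset.map_cons, Multiset.map_map, Multiset.map_map]; rfl) (by
          intro x hx
          rcases Multiset.mem_cons.1 hx with rfl | hx
          · exact hG
          · obtain ⟨y, hy, rfl⟩ := Multiset.mem_map.1 hx
            exact hLe y hy) hH (by
          rw [Multiset.map_cons, hmap]
          exact SynJudgement.separated_par.1 hsep) hZ
      rw [Multiset.map_cons, hmap] at hat
      obtain ⟨c, hc, hct⟩ := a.exists_par hat
      exact ⟨c, hc ▸ Translates.lam ha, hct, by rwa [hc]⟩

end Translates

/-! ## The string signature -/

section StringSignature

open TensorExpr TensorType LamTerm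

variable {T Ind : Type*}

/-- A term realizes an atom if it is the body of the word assigned to the upper index. -/
def wordBase (q : Unit × List (List T) × List (List T)) (u : LamTerm T) : Prop :=
  BetaEta u (wordBody (q.2.1.headD []))

theorem wordBase_of_betaEta (q : Unit × List (List T) × List (List T)) (u u' : LamTerm T)
    (h : BetaEta u u') (hu : wordBase q u) : wordBase q u' :=
  h.symm.trans hu

/-- A set of values of an atom is productive if it is nonempty. -/
def stringProductive (_ : Unit) (r : Set (List ℚ × List ℚ)) : Prop := ∃ x, ([x], []) ∈ r

theorem productiveBase_stringProductive : ProductiveBase stringValency stringProductive where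
  mono := fun _ _ _ h ⟨x, hx⟩ => ⟨x, h hx⟩
  shiftUp := fun _ _ ⟨x, hx⟩ => ⟨x + 1, _, hx, rfl, by simp, by simp⟩
  nonempty := fun _ _ ⟨_, hx⟩ => ⟨_, hx, rfl⟩
  univ := fun _ => ⟨0, trivial⟩

theorem stringValency_ne_zero (p : Unit) : stringValency p ≠ 0 := by
  simp [stringValency, Prod.ext_iff]

theorem SynJudgement.ne_of_types_eq {a : SynJudgement stringValency T Ind} {i j : Ind}
    (h : a.types = {.par (.lit (.pos ()) [i] []) (.lit (.neg ()) [] [j])}) : i ≠ j := by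
  rintro rfl
  have : TensorType.WF stringValency (.par (.lit (.pos ()) [i] []) (.lit (.neg ()) [] [i])) :=
    a.types_wf _ (h ▸ Multiset.mem_singleton_self _)
  have := this.2.2
  simp [TensorType.ind, TensorType.sup, TensorType.sub] at this

/-- A satisfied edge of the letter `c` says that the output position is `c` prepended to the input
position, which is what applying `c` does to the body of a word. -/
theorem wordSound_stringAxiom (c : T) (F : TensorType Unit Ind)
    (a : SynJudgement stringValency T Ind) (ha : a.toJudgement ∈ stringAxiom Ind c)
    (hF : a.types = {F}) : WordSound wordBase const 0 (.const c) F a.term := by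
  obtain ⟨i, j, b, hab, hb, hbt⟩ := ha
  intro ν hν σ _
  have hmem : a.types.map (TensorType.eval ν) ∈ b.values suffixRel :=
    SynJudgement.values_eq isModel_suffixRel hab ▸ ⟨ν, hν, rfl⟩
  obtain ⟨μ, hμ, heq⟩ := hmem
  rw [hF, hbt, Multiset.map_singleton, Multiset.map_singleton, Multiset.singleton_inj] at heq
  rw [hb] at hμ
  rw [heq]
  intro s hs
  have hμ' : μ i = c :: μ j := hμ
  change BetaEta _ (wordBody (μ i))
  rw [hμ']
  exact BetaEta.app (.refl _) hs

theorem orderSound_stringAxiom (c : T) (F : TensorType Unit Ind)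
    (a : SynJudgement stringValency T Ind) (ha : a.toJudgement ∈ stringAxiom Ind c)
    (hF : a.types = {F}) :
    OrderSound stringValency stringProductive 0 ((stringSignature T).typ c) F a.term := by
  classical
  obtain ⟨i, j, b, hab, hb, hbt⟩ := ha
  have hij := SynJudgement.ne_of_types_eq hbt
  intro ρ _ r ⟨x, hx⟩
  -- The output of the letter is placed at `x + 1`, strictly above its input at `x`.
  have hmem : b.types.map (TensorType.eval (fun k => if k = i then x + 1 else x)) ∈
      a.values orderRel := by
    rw [SynJudgement.values_eq isModel_orderRel hab]
    refine ⟨_, ?_, rfl⟩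
    rw [hb]
    simp [Sat, orderRel, hij.symm]
  obtain ⟨ν, hν, heq⟩ := hmem
  rw [hF, hbt, Multiset.map_singleton, Multiset.map_singleton, Multiset.singleton_inj] at heq
  refine ⟨x + 1, rfl, _, hx, rfl, ν, hν, by simp, ?_⟩
  rw [listVal_eval, ← heq]
  simp [TensorType.eval, upper, lower, hij.symm]

theorem len_stringAxiom (c : T) (a : SynJudgement stringValency T Ind)
    (ha : a.toJudgement ∈ stringAxiom Ind c) : a.term.len = 1 := by
  obtain ⟨i, j, b, hab, hb, -⟩ := ha
  rw [SynJudgement.len_eq hab, hb]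
  rfl

theorem exists_stringAxiom (c : T) (F : TensorType Unit Ind) (hF : F.WF stringValency)
    (he : F.erase = ((stringSignature T).typ c).tr) :
    ∃ a : SynJudgement stringValency T Ind, a.toJudgement ∈ stringAxiom Ind c ∧
      a.types = {F} ∧ a.term.bound = ∅ := by
  match F, he, hF with
  | .par (.lit (.pos ()) I J) (.lit (.neg ()) I' J'), _, ⟨⟨hI, hJ, _⟩, ⟨hI', hJ', _⟩, hd⟩ =>
    obtain ⟨i, rfl⟩ := List.length_eq_one_iff.1 hI
    obtain rfl := List.length_eq_zero_iff.1 hJ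
    obtain rfl := List.length_eq_zero_iff.1 hI'
    obtain ⟨j, rfl⟩ := List.length_eq_one_iff.1 hJ'
    have hij : i ≠ j := by
      rintro rfl
      simp [TensorType.ind, TensorType.sup, TensorType.sub] at hd
    have hsep : Separated stringValency ({.par (.lit (.pos ()) [i] []) (.lit (.neg ()) [] [j])} :
        Multiset (TensorType Unit Ind)) := by
      refine separated_cons.2 ⟨?_, by simp, separated_zero⟩
      exact ⟨⟨rfl, rfl, by simp⟩, ⟨rfl, rfl, by simp⟩, hd⟩
    let a : SynJudgement stringValency T Ind :=
      ⟨.edge [c] j i, {.par (.lit (.pos ()) [i] []) (.lit (.neg ()) [] [j])}, trivial, hsep.1,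
        hsep.2, by
          ext k
          simp [TensorExpr.fsup, TensorExpr.sup, TensorExpr.sub, TensorType.sub]
          grind, by
          ext k
          simp [TensorExpr.fsub, TensorExpr.sup, TensorExpr.sub, TensorType.sup]
          grind⟩
    refine ⟨a, ⟨i, j, a, rfl, rfl, rfl⟩, rfl, ?_⟩
    ext k
    simp [a, bound, TensorExpr.sup, TensorExpr.sub]
    grind

variable {L : Multiset (ℕ × ImpType Unit × TensorType Unit Ind)} {t : LamTerm T}
  {A : ImpType Unit} {F : TensorType Unit Ind} {e : TensorExpr T Ind}

theorem Translates.wordSound_string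
    (h : Translates (stringSignature T) stringValency (stringAxiom Ind) L t A F e) :
    WordSound wordBase LamTerm.const L t F e :=
  h.wordSound wordBase_of_betaEta fun c F a ha _ hF => wordSound_stringAxiom c F a ha hF

theorem Translates.orderSound_string
    (h : Translates (stringSignature T) stringValency (stringAxiom Ind) L t A F e) :
    OrderSound stringValency stringProductive L A F e :=
  h.orderSound productiveBase_stringProductive fun c F a ha _ hF =>
    orderSound_stringAxiom c F a ha hF

theorem Translates.len_string
    (h : Translates (stringSignature T) stringValency (stringAxiom Ind) L t A F e) :
    e.len = t.numConst :=
  h.len_eq len_stringAxiom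

theorem exists_translates_string [Infinite Ind] (h : (stringSignature T).Derivable 0 t A)
    (hF : F.WF stringValency) (he : F.erase = A.tr) {Z : Set Ind} (hZ : Z.Finite) :
    ∃ a : SynJudgement stringValency T Ind,
      Translates (stringSignature T) stringValency (stringAxiom Ind) 0 t A F a.term ∧
      a.types = {F} ∧ Disjoint a.term.bound Z :=
  exists_translates (L := 0) stringValency_ne_zero (fun c F hF he Z _ => by
    obtain ⟨a, ha, hat, hab⟩ := exists_stringAxiom c F hF he
    exact ⟨a, ha, hat, hab ▸ Set.empty_disjoint Z⟩) h rfl (by simp) he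
    (separated_cons.2 ⟨hF, by simp, separated_zero⟩) hZ

end StringSignature

/-! ## Finiteness of the set of axioms -/

section Finiteness

open TensorExpr TensorType

theorem List.finite_setOf_nodup_of_forall_mem {α : Type*} {s : Set α} (hs : s.Finite) :
    {l : List α | (∀ x ∈ l, x ∈ s) ∧ l.Nodup}.Finite := by
  have := hs.fintype
  classical
  refine (Set.finite_range fun l : {l : List s // l.Nodup} => l.1.map Subtype.val).subset ?_
  rintro l ⟨h, hl⟩
  lift l to List s using h
  exact ⟨⟨l, hl.of_map _⟩, rfl⟩

theorem TensorExpr.length_le_len_prod {T Ind : Type*} {l : List (List T × Ind × Ind)}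
    {x : List T × Ind × Ind} (hx : x ∈ l) : x.1.length ≤ (prod l).len := by
  induction l with
  | nil => cases hx
  | cons y l ih =>
    cases l with
    | nil => rw [List.mem_singleton.1 hx]; rfl
    | cons z l =>
      rcases List.mem_cons.1 hx with rfl | hx
      · exact Nat.le_add_right _ _
      · exact (ih hx).trans (Nat.le_add_left _ _)

/-- Each such class has a representative with one fixed type `G` and no bound index. Its term is a
product of distinct edges between indices of `G`, labelled by words of length at most `n`, which
leaves finitely many choices. -/
theorem SynJudgement.finite_setOf_toJudgement {P T Ind : Type*} {v : P → ℕ × ℕ} [Finite T]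
    [Infinite Ind] (A : TensorSymbol P) (n : ℕ) :
    {b : TypingJudgement v T Ind | ∃ (a : SynJudgement v T Ind) (F : TensorType P Ind),
      b = a.toJudgement ∧ a.types = {F} ∧ F.erase = A ∧ a.term.Acyclic ∧
        a.term.len ≤ n}.Finite := by
  obtain ⟨G, hG, hGe, -⟩ := exists_fresh v A (Set.finite_empty (α := Ind))
  have hS := (List.finite_length_le T n).prod (G.finite_ind.prod G.finite_ind)
  have hP := (List.finite_setOf_nodup_of_forall_mem hS).image prod
  have hJ : {a : SynJudgement v T Ind | a.types = {G} ∧ a.term ∈ prod '' {l | (∀ x ∈ l, x ∈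
      {w : List T | w.length ≤ n} ×ˢ (G.ind ×ˢ G.ind)) ∧ l.Nodup}}.Finite :=
    Set.Finite.of_finite_image (hP.subset (by rintro _ ⟨a, ⟨-, ha⟩, rfl⟩; exact ha))
      fun a ha b hb h => ext' h (ha.1.trans hb.1.symm)
  refine (hJ.image toJudgement).subset ?_
  rintro _ ⟨a, F, rfl, ha, hF, hac, hn⟩
  obtain ⟨b, l, hb, hbt, hl, hbb⟩ := a.exists_eq_prod hac ha hG (hF.trans hGe.symm)
  have hind : b.term.ind ⊆ G.ind := by
    rw [ind_eq, hbb, Set.union_empty]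
    intro i hi
    obtain ⟨B, hB, hiB⟩ := b.mem_free_iff.1 hi
    rw [hbt, Multiset.mem_singleton] at hB
    exact hB ▸ hiB
  have hw := b.term_wf
  rw [hl, wf_prod] at hw
  rw [hl] at hind
  refine ⟨b, ⟨hbt, l, ⟨fun x hx => ⟨?_, hind (Or.inl ?_), hind (Or.inr ?_)⟩, hw.1.of_map _⟩,
    hl.symm⟩, hb⟩
  · exact (length_le_len_prod hx).trans (by rw [← hl, len_eq hb]; exact hn)
  · rw [sup_prod]
    exact List.mem_map_of_mem (f := fun x => x.2.1) hx
  · rw [sub_prod]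
    exact List.mem_map_of_mem (f := fun x => x.2.2) hx

theorem StringACG.finite_axioms {P C T : Type*} [Finite P] [Finite C] [Finite T] (Ind : Type*)
    [Infinite Ind] (G : StringACG P C T) : (G.tensorSignature Ind).axioms.Finite := by
  have h : ∀ c, (G.axiomTranslation Ind c).Finite := by
    intro c
    refine (SynJudgement.finite_setOf_toJudgement (G.sig.typ c).tr
      (G.lexicon.onConst c).numConst).subset ?_
    rintro _ ⟨I, J, e, a, h, rfl, rfl, ha⟩
    exact ⟨a, _, rfl, ha, erase_decorate _ _ _, h.orderSound_string.acyclic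
      productiveBase_stringProductive, h.len_string.le⟩
  refine (Set.finite_iUnion h).subset ?_
  rintro b ⟨c, hb⟩
  exact Set.mem_iUnion.2 ⟨c, hb⟩

end Finiteness

/-! ## Semantics of the abstract signature -/

namespace TensorSymbol

variable {P X Y : Type*} {v : P → ℕ × ℕ}

theorem decorate_par_append {A B : TensorSymbol P} {I I' J J' : List X}
    (hI : I.length = (A.valency v).1) (hJ : J.length = (A.valency v).2) :
    (par A B).decorate v (I ++ I') (J ++ J') = .par (A.decorate v I J) (B.decorate v I' J') := by
  rw [decorate, List.take_left' hI, List.take_left' hJ, List.drop_left' hI, List.drop_left' hJ]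

theorem eval_decorate (ν : X → Y) (A : TensorSymbol P) (I J : List X) :
    (A.decorate v I J).eval ν = A.decorate v (I.map ν) (J.map ν) := by
  induction A generalizing I J with
  | lit l => rfl
  | tensor A B ihA ihB =>
    simp only [decorate, TensorType.eval, ihA, ihB, List.map_take, List.map_drop]
  | par A B ihA ihB =>
    simp only [decorate, TensorType.eval, ihA, ihB, List.map_take, List.map_drop]

end TensorSymbol

namespace StringACG

open TensorExpr TensorType

variable {P C T Ind : Type*} [Finite P] [Finite C] [Finite T] (G : StringACG P C T)

theorem valency_tr (A : ImpType P) :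
    A.tr.valency G.valency = (G.lexicon.onType A).tr.valency stringValency := by
  induction A with
  | atom p => rfl
  | imp A B ihA ihB =>
    rw [G.lexicon.onType_imp, ImpType.tr, ImpType.tr, TensorSymbol.valency, TensorSymbol.valency,
      TensorSymbol.valency_dual, TensorSymbol.valency_dual, ihA, ihB]

theorem valency_ne_zero (p : P) : G.valency p ≠ 0 :=
  ImpType.valency_tr_ne_zero stringValency_ne_zero _

/-- A term realizes a decorated atom of the abstract signature if it realizes the decorated image of
the atom under the lexicon. -/
def base (q : P × List (List T) × List (List T)) (u : LamTerm T) : Prop :=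
  LamTerm.Realizes wordBase
    ((G.lexicon.onType (.atom q.1)).tr.decorate stringValency q.2.1 q.2.2).toImp u

theorem base_of_betaEta (q : P × List (List T) × List (List T)) (u u' : LamTerm T)
    (h : LamTerm.BetaEta u u') (hu : G.base q u) : G.base q u' :=
  LamTerm.Realizes.of_betaEta wordBase_of_betaEta h hu

/-- Abstract types and their images carry the same lists of indices. By `valency_tr` these lists are
divided at the same places under `⊸`, and duality reverses them in the same way. -/
theorem realizes_base_iff {A : ImpType P} {F : TensorType P (List T)} (hF : F.Fits G.valency)
    (he : F.erase = A.tr) {u : LamTerm T} :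
    LamTerm.Realizes G.base F.toImp u ↔ LamTerm.Realizes wordBase
      ((G.lexicon.onType A).tr.decorate stringValency F.upper F.lower).toImp u := by
  induction A generalizing F u with
  | atom p =>
    match F, he with
    | .lit (.pos _) I J, rfl => rfl
  | imp A B ihA ihB =>
    match F, he, hF with
    | .par H K, he, ⟨hH, hK⟩ =>
      obtain ⟨hHe, hKe⟩ := TensorSymbol.par.inj he
      have hKe' : K.dual.erase = A.tr := by rw [erase_dual, hKe, TensorSymbol.dual_dual]
      have hlenH : H.upper.length = ((G.lexicon.onType B).tr.valency stringValency).1 ∧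
          H.lower.length = ((G.lexicon.onType B).tr.valency stringValency).2 := by
        rw [← G.valency_tr, ← hHe, hH.length_upper, hH.length_lower]
        exact ⟨rfl, rfl⟩
      have hlenK : K.dual.upper.length = ((G.lexicon.onType A).tr.valency stringValency).1 ∧
          K.dual.lower.length = ((G.lexicon.onType A).tr.valency stringValency).2 := by
        rw [← G.valency_tr, ← hKe', hK.dual.length_upper, hK.dual.length_lower]
        exact ⟨rfl, rfl⟩
      rw [G.lexicon.onType_imp, ImpType.tr, upper, lower,
        TensorSymbol.decorate_par_append hlenH.1 hlenH.2]
      have hdec := dual_decorate (v := stringValency) hlenK.1 hlenK.2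
      rw [upper_dual, lower_dual, List.reverse_reverse, List.reverse_reverse] at hdec
      rw [← hdec, toImp, toImp, toImp_dual, ← toImp_dual K]
      have hA := fun s => ihA hK.dual hKe' (u := s)
      rw [upper_dual, lower_dual] at hA
      exact forall_congr' fun s => imp_congr (hA s) (ihB hH hHe)

/-- A set of values is productive for an atom of the abstract signature if it is productive for the
image of the atom under the lexicon. -/
def productive (p : P) (r : Set (List ℚ × List ℚ)) : Prop :=
  Productive stringValency stringProductive (G.lexicon.onType (.atom p)) r

theorem productive_iff {A : ImpType P} {r : Set (List ℚ × List ℚ)} :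
    Productive G.valency G.productive A r ↔
      Productive stringValency stringProductive (G.lexicon.onType A) r := by
  induction A generalizing r with
  | atom p => rfl
  | imp A B ihA ihB =>
    rw [G.lexicon.onType_imp, Productive, Productive, ← G.valency_tr, ← G.valency_tr]
    exact forall_congr' fun s => imp_congr ihA ihB

theorem productiveBase : ProductiveBase G.valency G.productive where
  mono := fun _ _ _ h hr => Productive.mono productiveBase_stringProductive h hr
  shiftUp := fun _ _ h => Productive.shiftUp productiveBase_stringProductive h
  nonempty := fun _ r hr => (Productive.nonempty_and_univ productiveBase_stringProductive _).1 r hr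
  univ := fun _ => (Productive.nonempty_and_univ productiveBase_stringProductive _).2

/-- The judgement `a` is only congruent to an actual translation `b`. The value of `F` is
transported to `b` by `values_eq`, and there soundness for the string signature applies. -/
theorem wordSound_axiomTranslation (c : C) (F : TensorType P Ind)
    (a : SynJudgement G.valency T Ind) (ha : a.toJudgement ∈ G.axiomTranslation Ind c)
    (hF : a.types = {F}) : WordSound G.base G.lexicon.onConst 0 (.const c) F a.term := by
  obtain ⟨I, J, e, b, h, hab, rfl, hbt⟩ := ha
  intro ν hν σ _
  have hmem : a.types.map (TensorType.eval ν) ∈ b.values suffixRel :=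
    SynJudgement.values_eq isModel_suffixRel hab ▸ ⟨ν, hν, rfl⟩
  obtain ⟨μ, hμ, heq⟩ := hmem
  rw [hF, hbt, Multiset.map_singleton, Multiset.map_singleton, Multiset.singleton_inj] at heq
  have hfits := (a.types_wf F (hF ▸ Multiset.mem_singleton_self F)).fits.eval ν
  rw [G.realizes_base_iff hfits (A := G.sig.typ c) (by
    rw [heq, erase_eval, erase_decorate]), heq, upper_eval, lower_eval, upper_decorate,
    lower_decorate, ← TensorSymbol.eval_decorate]
  have := h.wordSound_string μ hμ σ (by simp)
  rwa [LamTerm.mapConst_const] at this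

theorem orderSound_axiomTranslation (c : C) (F : TensorType P Ind)
    (a : SynJudgement G.valency T Ind) (ha : a.toJudgement ∈ G.axiomTranslation Ind c)
    (hF : a.types = {F}) :
    OrderSound G.valency G.productive 0 (G.sig.typ c) F a.term := by
  obtain ⟨I, J, e, b, h, hab, rfl, hbt⟩ := ha
  intro ρ _
  rw [productive_iff]
  refine Productive.mono productiveBase_stringProductive ?_ (h.orderSound_string ρ (by simp))
  rintro _ ⟨μ, hμ, -, rfl⟩
  have hmem : b.types.map (TensorType.eval μ) ∈ a.values orderRel :=
    SynJudgement.values_eq isModel_orderRel hab ▸ ⟨μ, hμ, rfl⟩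
  obtain ⟨ν, hν, heq⟩ := hmem
  rw [hF, hbt, Multiset.map_singleton, Multiset.map_singleton, Multiset.singleton_inj] at heq
  refine ⟨ν, hν, by simp, ?_⟩
  rw [listVal_eval _ F, ← heq, upper_eval, lower_eval, upper_decorate, lower_decorate, listVal,
    upper_decorate, lower_decorate]

/-- The image type decorated with the index lists of `F` is well-formed because valencies agree; a
translation of `φ(c)` with that type has the free indices required by `F`. -/
theorem exists_axiomTranslation [Infinite Ind] (c : C) {F : TensorType P Ind}
    (hF : F.WF G.valency) (he : F.erase = (G.sig.typ c).tr) {Z : Set Ind} (hZ : Z.Finite) :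
    ∃ a : SynJudgement G.valency T Ind, a.toJudgement ∈ G.axiomTranslation Ind c ∧
      a.types = {F} ∧ Disjoint a.term.bound Z := by
  have hval := G.valency_tr (G.sig.typ c)
  obtain ⟨a, h, ha, hab⟩ := exists_translates_string (G.lexicon.derivable c)
    (F := (G.lexicon.onType (G.sig.typ c)).tr.decorate stringValency F.upper F.lower)
    (wf_iff.2 ⟨fits_decorate (by rw [hF.fits.length_upper, he, hval])
      (by rw [hF.fits.length_lower, he, hval]), by
      rw [upper_decorate, lower_decorate]
      exact (wf_iff.1 hF).2⟩) (erase_decorate _ _ _) hZ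
  have hsep : Separated G.valency ({F} : Multiset (TensorType P Ind)) :=
    separated_cons.2 ⟨hF, by simp, separated_zero⟩
  have hF' := hF.fits.eq_decorate
  rw [he] at hF'
  refine ⟨⟨a.term, {F}, a.term_wf, hsep.1, hsep.2, ?_, ?_⟩,
    ⟨_, _, _, _, h, rfl, rfl, by rw [← hF']⟩, rfl, hab⟩
  · rw [a.fsup_eq, ha]
    simp [sub_eq, lower_decorate]
  · rw [a.fsub_eq, ha]
    simp [sup_eq, upper_decorate]

end StringACG

/-! ## Derivable identities -/

section Identity

open TensorExpr TensorType

variable {P T Ind X : Type*} {v : P → ℕ × ℕ}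

theorem TensorExpr.IsIdentity.dual {R : List T → X → X → Prop} {e : TensorExpr T Ind}
    {F G : TensorType P Ind} (h : e.IsIdentity R F G) : e.IsIdentity R G.dual F.dual := by
  intro ν
  rw [h ν, upper_dual, upper_dual, lower_dual, lower_dual, List.forall₂_reverse_iff,
    List.forall₂_reverse_iff, and_comm]
  exact and_congr ⟨List.Forall₂.flip, List.Forall₂.flip⟩ ⟨List.Forall₂.flip, List.Forall₂.flip⟩

theorem TensorExpr.IsIdentity.par {R : List T → X → X → Prop} {d e : TensorExpr T Ind}
    {F G F' G' : TensorType P Ind} (h : d.IsIdentity R F F') (h' : e.IsIdentity R G G')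
    (hF : F.Fits v) (hF' : F'.Fits v) (he : F.erase = F'.erase) :
    (d.mul e).IsIdentity R (.par F G) (.par F' G') := by
  intro ν
  rw [upper, upper, lower, lower, List.forall₂_append_iff (by
      rw [hF.length_upper, hF'.length_upper, he]), List.forall₂_append_iff (by
      rw [hF.length_lower, hF'.length_lower, he]), Sat, h ν, h' ν]
  tauto

theorem TensorExpr.IsIdentity.mul_comm {R : List T → X → X → Prop} {d e : TensorExpr T Ind}
    {F G : TensorType P Ind} (h : (d.mul e).IsIdentity R F G) : (e.mul d).IsIdentity R F G :=
  fun ν => and_comm.trans (h ν)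

theorem SynJudgement.ind_eq_of_bound_eq_empty {a : SynJudgement v T Ind} {F G : TensorType P Ind}
    (ha : a.types = {F, G}) (hb : a.term.bound = ∅) : a.term.ind = F.ind ∪ G.ind := by
  ext i
  rw [ind_eq, hb, Set.union_empty, a.mem_free_iff, ha, Multiset.insert_eq_cons,
    Multiset.exists_mem_cons_iff]
  simp

/-- An identity judgement is derivable in tensor type calculus. -/
structure DerivableIdentity (a : SynJudgement v T Ind) (F G : TensorType P Ind) : Prop where
  types_eq : a.types = {F.dual, G}
  bound_eq : a.term.bound = ∅
  derivable : DerivableFrom 0 a.toJudgement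
  word : a.term.IsIdentity suffixRel F G
  order : a.term.IsIdentity orderRel F G

theorem DerivableIdentity.ind_eq {a : SynJudgement v T Ind} {F G : TensorType P Ind}
    (h : DerivableIdentity a F G) : a.term.ind = F.ind ∪ G.ind := by
  rw [SynJudgement.ind_eq_of_bound_eq_empty h.types_eq h.bound_eq, ind_dual]

/-- η-expansion: the tensor of two identities followed by the `⅋` rule. The factors appear in
reverse order because the dual of `F ⅋ G` is the tensor of the duals of `G` and `F`. -/
theorem DerivableIdentity.par {a b : SynJudgement v T Ind} {F G F' G' : TensorType P Ind}
    (ha : DerivableIdentity a F F') (hb : DerivableIdentity b G G') (hF : F.Fits v)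
    (hF' : F'.Fits v) (he : F.erase = F'.erase) (hd : Disjoint a.term.ind b.term.ind) :
    ∃ c : SynJudgement v T Ind, DerivableIdentity c (.par F G) (.par F' G') := by
  obtain ⟨c, hc, hct, hcb⟩ := SynJudgement.exists_tensor b a hb.types_eq ha.types_eq hd.symm
  obtain ⟨k, hk, hkt⟩ := c.exists_par (A := F') (B := G') (Γ := {.tensor G.dual F.dual}) (by
    rw [hct]
    change .tensor G.dual F.dual ::ₘ G' ::ₘ F' ::ₘ 0 = F' ::ₘ G' ::ₘ .tensor G.dual F.dual ::ₘ 0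
    rw [Multiset.cons_swap G', Multiset.cons_swap, Multiset.cons_swap _ G'])
  refine ⟨k, hkt.trans (Multiset.pair_comm _ _), ?_, ?_, ?_, ?_⟩
  · rw [ha.bound_eq, hb.bound_eq, Set.union_empty] at hcb
    rw [hk, Set.subset_empty_iff.1 hcb]
  · refine DerivableFrom.par (Γ := {.tensor G.dual F.dual}) ?_ hk hkt
      (DerivableFrom.tensor hb.types_eq ha.types_eq hc hct hb.derivable ha.derivable)
    rw [hct]
    change .tensor G.dual F.dual ::ₘ G' ::ₘ F' ::ₘ 0 = F' ::ₘ G' ::ₘ .tensor G.dual F.dual ::ₘ 0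
    rw [Multiset.cons_swap G', Multiset.cons_swap, Multiset.cons_swap _ G']
  · rw [hk, hc]
    exact (ha.word.par hb.word hF hF' he).mul_comm
  · rw [hk, hc]
    exact (ha.order.par hb.order hF hF' he).mul_comm

theorem DerivableIdentity.dual {a : SynJudgement v T Ind} {F G : TensorType P Ind}
    (h : DerivableIdentity a F G) : DerivableIdentity a G.dual F.dual where
  types_eq := by rw [dual_dual, h.types_eq]; exact Multiset.pair_comm _ _
  bound_eq := h.bound_eq
  derivable := h.derivable
  word := h.word.dual
  order := h.order.dual

/-- The calculus provides identities for atoms only. An identity from `F` to `G` is also one from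
`G.dual` to `F.dual`, so negative literals and tensors reduce to positive literals and pars. -/
theorem exists_derivableIdentity (hv : ∀ p, v p ≠ 0) {F G : TensorType P Ind} (hF : F.WF v)
    (hG : G.WF v) (he : F.erase = G.erase) (hd : Disjoint F.ind G.ind) :
    ∃ a : SynJudgement v T Ind, DerivableIdentity a F G := by
  have hpos : ∀ (p : P) (I J I' J' : List Ind), (lit (.pos p) I J).WF v →
      (lit (.pos p) I' J').WF v → Disjoint (lit (.pos p) I J).ind (lit (.pos p) I' J').ind →
      ∃ a : SynJudgement v T Ind, DerivableIdentity a (lit (.pos p) I J) (lit (.pos p) I' J') := by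
    intro p I J I' J' hF hG hd
    obtain ⟨a, ha, hat, hab⟩ := SynJudgement.exists_identity (T := T) hF hG rfl hd (hv p)
    refine ⟨a, hat, hab, ?_, ?_, ?_⟩
    · exact DerivableFrom.id p J.reverse I.reverse J' I' a
        (by rw [List.reverse_reverse, List.reverse_reverse]; exact ha) hat
    · exact SynJudgement.isIdentity_delta _ hF.fits hG.fits rfl ha
    · exact SynJudgement.isIdentity_delta _ hF.fits hG.fits rfl ha
  have hpar : ∀ A B A' B' : TensorType P Ind, (A.par B).WF v → (A'.par B').WF v →
      (A.par B).erase = (A'.par B').erase → Disjoint (A.par B).ind (A'.par B').ind →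
      (A.erase = A'.erase → Disjoint A.ind A'.ind →
        ∃ a : SynJudgement v T Ind, DerivableIdentity a A A') →
      (B.erase = B'.erase → Disjoint B.ind B'.ind →
        ∃ a : SynJudgement v T Ind, DerivableIdentity a B B') →
      ∃ a : SynJudgement v T Ind, DerivableIdentity a (A.par B) (A'.par B') := by
    rintro A B A' B' ⟨hA, hB, hAB⟩ ⟨hA', hB', hAB'⟩ he hd h₁ h₂
    obtain ⟨heA, heB⟩ := TensorSymbol.par.inj he
    rw [ind_par, ind_par, Set.disjoint_union_left, Set.disjoint_union_right,
      Set.disjoint_union_right] at hd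
    obtain ⟨a, ha⟩ := h₁ heA hd.1.1
    obtain ⟨b, hb⟩ := h₂ heB hd.2.2
    refine ha.par hb hA.fits hA'.fits heA ?_
    rw [ha.ind_eq, hb.ind_eq, Set.disjoint_union_left, Set.disjoint_union_right,
      Set.disjoint_union_right]
    exact ⟨⟨hAB, hd.1.2⟩, hd.2.1.symm, hAB'⟩
  induction F generalizing G with
  | lit l I J =>
    match l, G, he with
    | .pos p, .lit (.pos _) I' J', rfl => exact hpos p I J I' J' hF hG hd
    | .neg p, .lit (.neg _) I' J', rfl =>
      obtain ⟨a, ha⟩ := hpos p J'.reverse I'.reverse J.reverse I.reverse hG.dual hF.dual (by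
        have := ind_dual (lit (.neg p) I J)
        have h' := ind_dual (lit (.neg p) I' J')
        rw [← this, ← h'] at hd
        exact hd.symm)
      refine ⟨a, ?_⟩
      have := ha.dual
      simpa [TensorType.dual, Literal.dual] using this
  | tensor A B ihA ihB =>
    match G, he, hG with
    | .tensor A' B', he, hG =>
      have hF' : (B'.dual.par A'.dual).WF v := hG.dual
      have hG' : (B.dual.par A.dual).WF v := hF.dual
      obtain ⟨heA, heB⟩ := TensorSymbol.tensor.inj he
      obtain ⟨a, ha⟩ := hpar B'.dual A'.dual B.dual A.dual hF' hG' (by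
          rw [erase, erase, erase_dual, erase_dual, erase_dual, erase_dual, heA, heB]) (by
          have h₁ := ind_dual (A.tensor B)
          have h₂ := ind_dual (A'.tensor B')
          rw [← h₁, ← h₂] at hd
          exact hd.symm)
        (fun _ h => by
          rw [ind_dual, ind_dual] at h
          obtain ⟨a, ha⟩ := ihB hF.2.1 hG.2.1 heB h.symm
          exact ⟨a, ha.dual⟩)
        (fun _ h => by
          rw [ind_dual, ind_dual] at h
          obtain ⟨a, ha⟩ := ihA hF.1 hG.1 heA h.symm
          exact ⟨a, ha.dual⟩)
      refine ⟨a, ?_⟩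
      have := ha.dual
      simpa only [TensorType.dual, dual_dual] using this
  | par A B ihA ihB =>
    match G, he, hG with
    | .par A' B', he, hG =>
      exact hpar A B A' B' hF hG he hd (fun he hd => ihA hF.1 hG.1 he hd)
        fun he hd => ihB hF.2.1 hG.2.1 he hd

end Identity

/-! ## Derivations for abstract terms -/

section Existence

open TensorExpr TensorType

variable {P C T Ind : Type*} {sig : LamSignature P C} {v : P → ℕ × ℕ}
  {L : Multiset (ℕ × ImpType P × TensorType P Ind)} {t : LamTerm C} {A B : ImpType P}
  {F H : TensorType P Ind} {d e : TensorExpr T Ind}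

theorem WordSound.congr {base : P × List (List T) × List (List T) → LamTerm T → Prop}
    {g : C → LamTerm T} (h : WordSound base g L t F e)
    (hde : ∀ ν, Sat suffixRel ν d → Sat suffixRel ν e) : WordSound base g L t F d :=
  fun ν hν => h ν (hde ν hν)

theorem WordSound.comp {base : P × List (List T) × List (List T) → LamTerm T → Prop}
    {g : C → LamTerm T} (h : WordSound base g L t H e) (hH : H.Fits v) (hF : F.Fits v)
    (he : H.erase = F.erase) (hd : d.IsIdentity suffixRel H F) :
    WordSound base g L t F (e.mul d) := by
  intro ν hν
  rw [← eval_eq_of_isIdentity hH hF he hd hν.2]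
  exact h ν hν.1

theorem OrderSound.congr {base : P → Set (List ℚ × List ℚ) → Prop} (hb : ProductiveBase v base)
    (h : OrderSound v base L A F e) (hde : ∀ ν, Sat orderRel ν e → Sat orderRel ν d) :
    OrderSound v base L A F d := by
  intro ρ hρ
  refine Productive.mono hb ?_ (h ρ hρ)
  rintro x ⟨ν, hν, hx⟩
  exact ⟨ν, hde ν hν, hx⟩

/-- Composition with an identity moves the values of `H` strictly to those of `F`, and closure under
`shiftUp` absorbs the move. -/
theorem OrderSound.comp {base : P → Set (List ℚ × List ℚ) → Prop} (hb : ProductiveBase v base)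
    (h : OrderSound v base L A H e) (hH : H.WF v) (hF : F.WF v) (hHA : H.erase = A.tr)
    (hFA : F.erase = A.tr) (hHF : Disjoint H.ind F.ind) (hd : d.IsIdentity orderRel H F)
    (hed : e.ind ∩ d.ind ⊆ H.ind) (hFd : F.ind ⊆ d.ind) (hL : ∀ x ∈ L, x.2.2.ind ⊆ e.ind) :
    OrderSound v base L A F (e.mul d) := by
  intro ρ hρ
  refine Productive.mono hb ?_ ((h ρ hρ).shiftUp hb)
  rintro x ⟨_, ⟨ν, hν, hνL, rfl⟩, hlen, h₁, h₂⟩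
  obtain ⟨μ, hμH, hμF⟩ := exists_listVal_eq hH hF hHF (x := H.listVal ν) (y := x)
    (hlen.trans (hHA ▸ rfl)) (by rw [← h₁.length_eq, ← h₂.length_eq, hlen, hFA])
  have hagree : ∀ i ∈ H.ind, ν i = μ i := by
    intro i hi
    rcases mem_ind.1 hi with hi | hi
    · exact (List.map_inj_left.1 (Prod.ext_iff.1 hμH).1 i hi).symm
    · exact (List.map_inj_left.1 (Prod.ext_iff.1 hμH).2 i hi).symm
  have hμ : Sat orderRel μ d := by
    rw [hd μ]
    rw [← hμF, ← hμH, listVal, listVal] at h₁ h₂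
    rw [List.forall₂_map_left_iff, List.forall₂_map_right_iff] at h₁ h₂
    exact ⟨h₁, h₂⟩
  obtain ⟨κ, hκ, hκe, hκd⟩ := Sat.exists_glue hν hμ fun i hi hi' => hagree i (hed ⟨hi, hi'⟩)
  refine ⟨κ, hκ, fun y hy => ?_, ?_⟩
  · rw [listVal_congr fun i hi => hκe i (hL y hy (ind_dual y.2.2 ▸ hi))]
    exact hνL y hy
  · rw [listVal_congr fun i hi => hκd i (hFd hi), hμF]

/-- A derivable judgement of a tensor signature that represents a λ-term. -/
structure Represents (ax : Set (TypingJudgement v T Ind))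
    (base : P × List (List T) × List (List T) → LamTerm T → Prop)
    (obase : P → Set (List ℚ × List ℚ) → Prop) (g : C → LamTerm T)
    (L : Multiset (ℕ × ImpType P × TensorType P Ind)) (t : LamTerm C) (A : ImpType P)
    (F : TensorType P Ind) (a : SynJudgement v T Ind) : Prop where
  types_eq : a.types = F ::ₘ L.map (fun x => x.2.2)
  derivable : ∃ Y : Multiset (TypingJudgement v T Ind), (∀ y ∈ Y, y ∈ ax) ∧
    DerivableFrom Y a.toJudgement
  word : WordSound base g L t F a.term
  order : OrderSound v obase L A F a.term

variable {ax : Set (TypingJudgement v T Ind)}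
  {base : P × List (List T) × List (List T) → LamTerm T → Prop}
  {obase : P → Set (List ℚ × List ℚ) → Prop} {g : C → LamTerm T}

theorem SynJudgement.mem_ind_iff (a : SynJudgement v T Ind) {i : Ind} :
    i ∈ a.term.ind ↔ (∃ A ∈ a.types, i ∈ A.ind) ∨ i ∈ a.term.bound := by
  rw [ind_eq, Set.mem_union, a.mem_free_iff]

/-- The calculus has no rule that takes `H ⅋ Ḡ` apart. Application is simulated by tensoring the
argument of type `G` with an identity from `H` to `F` and cutting the result, of type `G ⊗ H̄`,
against the function. The outcome behaves as the translated application followed by that identity,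
which `WordSound.comp` and `OrderSound.comp` take into account. -/
theorem Represents.app {M : Multiset (ℕ × ImpType P × TensorType P Ind)} {s : LamTerm C}
    {a b δ : SynJudgement v T Ind} {G : TensorType P Ind} {Z : Set Ind}
    (hb : ProductiveBase v obase)
    (ha : Represents ax base obase g L t (.imp A B) (.par H G.dual) a)
    (hs : Represents ax base obase g M s A G b) (hδ : DerivableIdentity δ H F)
    (hF : F.WF v) (hH : H.WF v) (hHB : H.erase = B.tr) (hFB : F.erase = B.tr)
    (hHF : Disjoint H.ind F.ind) (hGH : Disjoint G.ind H.ind) (hGF : Disjoint G.ind F.ind)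
    (hsep : Separated v (F ::ₘ (L.map (fun x => x.2.2) + M.map (fun x => x.2.2))))
    (hG : ∀ B ∈ L.map (fun x => x.2.2) + M.map (fun x => x.2.2), Disjoint G.ind B.ind)
    (hHL : ∀ B ∈ L.map (fun x => x.2.2) + M.map (fun x => x.2.2), Disjoint H.ind B.ind)
    (haF : Disjoint a.term.bound F.ind) (haH : Disjoint a.term.bound H.ind)
    (haG : Disjoint a.term.bound G.ind)
    (haL : ∀ B ∈ L.map (fun x => x.2.2) + M.map (fun x => x.2.2), Disjoint a.term.bound B.ind)
    (hba : Disjoint b.term.bound a.term.ind) (hbH : Disjoint b.term.bound H.ind)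
    (hbF : Disjoint b.term.bound F.ind)
    (haZ : Disjoint a.term.bound Z) (hbZ : Disjoint b.term.bound Z) (hGZ : Disjoint G.ind Z)
    (hHZ : Disjoint H.ind Z) :
    ∃ c : SynJudgement v T Ind, Represents ax base obase g (L + M) (.app t s) B F c ∧
      Disjoint c.term.bound Z := by
  have hδi := hδ.ind_eq
  have hai := fun i => a.mem_ind_iff (i := i)
  have hbi := fun i => b.mem_ind_iff (i := i)
  simp only [ha.types_eq, hs.types_eq, Multiset.exists_mem_cons_iff, ind_par, ind_dual,
    Set.mem_union] at hai hbi
  obtain ⟨hFw, hFL, hLM⟩ := separated_cons.1 hsep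
  obtain ⟨-, -, hLM⟩ := separated_add.1 hLM
  have hbδ : Disjoint b.term.ind δ.term.ind := by
    rw [hδi, Set.disjoint_left]
    intro i hi hi'
    rcases (hbi i).1 hi with (hi | ⟨K, hK, hi⟩) | hi <;> rcases hi' with hi' | hi'
    · exact Set.disjoint_left.1 hGH hi hi'
    · exact Set.disjoint_left.1 hGF hi hi'
    · exact Set.disjoint_left.1 (hHL K (Multiset.mem_add.2 (Or.inr hK))) hi' hi
    · exact Set.disjoint_left.1 (hFL K (Multiset.mem_add.2 (Or.inr hK))) hi' hi
    · exact Set.disjoint_left.1 hbH hi hi'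
    · exact Set.disjoint_left.1 hbF hi hi'
  have hδt : δ.types = H.dual ::ₘ {F} := hδ.types_eq
  obtain ⟨r, hr, hrt, hrb⟩ := SynJudgement.exists_tensor b δ hs.types_eq hδt hbδ
  rw [hδ.bound_eq, Set.union_empty] at hrb
  have hrind : r.term.ind = b.term.ind ∪ δ.term.ind := by rw [hr, ind_mul]
  have hdual : (TensorType.par H G.dual).dual = .tensor G H.dual := by
    rw [TensorType.dual, dual_dual]
  obtain ⟨c, hc, hct, hcb⟩ := SynJudgement.exists_cut a r ha.types_eq (by rw [hdual]; exact hrt)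
    (by
      intro K hK N hN
      rcases Multiset.mem_add.1 hN with hN | hN
      · exact hLM K hK N hN
      · rw [Multiset.mem_singleton.1 hN]
        exact (hFL K (Multiset.mem_add.2 (Or.inl hK))).symm)
    (by
      rw [hrind, hδi, Set.disjoint_left]
      rintro i hi (hi' | hi' | hi')
      · rcases (hbi i).1 hi' with (hi' | ⟨K, hK, hi'⟩) | hi'
        · exact Set.disjoint_left.1 haG hi hi'
        · exact Set.disjoint_left.1 (haL K (Multiset.mem_add.2 (Or.inr hK))) hi hi'
        · exact Set.disjoint_left.1 hba hi' ((hai i).2 (Or.inr hi))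
      · exact Set.disjoint_left.1 haH hi hi'
      · exact Set.disjoint_left.1 haF hi hi')
    (hba.mono_left hrb)
  -- The product is reassociated only at the level of satisfaction, so no congruence of terms is
  -- needed.
  have hmul : ∀ {Y : Type} (R : List T → Y → Y → Prop) (ν : Ind → Y), Sat R ν c.term ↔
      Sat R ν ((a.term.mul b.term).mul δ.term) := by
    intro Y R ν
    rw [hc, hr]
    exact and_assoc.symm
  refine ⟨c, ⟨?_, ?_, ?_, ?_⟩, ?_⟩
  · rw [hct, Multiset.map_add, ← add_assoc, add_comm]
    rfl
  · obtain ⟨Y, hY, hYd⟩ := ha.derivable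
    obtain ⟨Y', hY', hYd'⟩ := hs.derivable
    refine ⟨Y + (Y' + 0), fun y hy => ?_, DerivableFrom.cut ha.types_eq (hrt.trans (by
      rw [hdual])) hc hct hYd (DerivableFrom.tensor hs.types_eq hδt hr hrt hYd' hδ.derivable)⟩
    rw [add_zero] at hy
    rcases Multiset.mem_add.1 hy with hy | hy
    exacts [hY y hy, hY' y hy]
  · exact ((ha.word.app hs.word).comp hH.fits hF.fits (hHB.trans hFB.symm) hδ.word).congr
      fun ν hν => by rw [hc, hr] at hν; exact and_assoc.2 hν
  · refine ((ha.order.app hb hH.fits hHB hs.order ?_ ?_ ?_ ?_).comp hb hH hF hHB hFB hHF hδ.order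
      ?_ ?_ ?_).congr hb fun ν hν => (hmul orderRel ν).2 hν
    · rintro i ⟨hi, hi'⟩
      rcases (hbi i).1 hi' with (hi' | ⟨K, hK, hi'⟩) | hi'
      · exact hi'
      · exfalso
        rcases (hai i).1 hi with ((hi | hi) | ⟨N, hN, hi⟩) | hi
        · exact Set.disjoint_left.1 (hHL K (Multiset.mem_add.2 (Or.inr hK))) hi hi'
        · exact Set.disjoint_left.1 (hG K (Multiset.mem_add.2 (Or.inr hK))) hi hi'
        · exact Set.disjoint_left.1 (hLM N hN K hK) hi hi'
        · exact Set.disjoint_left.1 (haL K (Multiset.mem_add.2 (Or.inr hK))) hi hi'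
      · exact absurd hi (Set.disjoint_left.1 hba hi')
    · exact fun i hi => (hai i).2 (Or.inl (Or.inl (Or.inl hi)))
    · exact fun x hx i hi => (hai i).2 (Or.inl (Or.inr ⟨_, Multiset.mem_map_of_mem _ hx, hi⟩))
    · exact fun x hx i hi => (hbi i).2 (Or.inl (Or.inr ⟨_, Multiset.mem_map_of_mem _ hx, hi⟩))
    · rw [ind_mul, hδi]
      rintro i ⟨hi | hi, hi' | hi'⟩
      · exact hi'
      · exfalso
        rcases (hai i).1 hi with ((hi | hi) | ⟨N, hN, hi⟩) | hi
        · exact Set.disjoint_left.1 hHF hi hi'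
        · exact Set.disjoint_left.1 hGF hi hi'
        · exact Set.disjoint_left.1 (hFL N (Multiset.mem_add.2 (Or.inl hN))) hi' hi
        · exact Set.disjoint_left.1 haF hi hi'
      · exact hi'
      · exact absurd (hδi ▸ Or.inr hi') (Set.disjoint_left.1 hbδ hi)
    · exact fun i hi => hδi ▸ Or.inr hi
    · intro x hx i hi
      rw [ind_mul]
      rcases Multiset.mem_add.1 hx with hx | hx
      · exact Or.inl ((hai i).2 (Or.inl (Or.inr ⟨_, Multiset.mem_map_of_mem _ hx, hi⟩)))
      · exact Or.inr ((hbi i).2 (Or.inl (Or.inr ⟨_, Multiset.mem_map_of_mem _ hx, hi⟩)))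
  · refine Set.disjoint_of_subset_left hcb ?_
    rw [ind_par, ind_dual, Set.disjoint_union_left, Set.disjoint_union_left,
      Set.disjoint_union_left]
    exact ⟨⟨haZ, hbZ.mono_left hrb⟩, hHZ, hGZ⟩

/-- The typing derivation is replayed in the tensor calculus, carrying both soundness properties. As
in `exists_translates`, the prescribed types and the avoided set are generalized so that premises
can be kept apart. -/
theorem exists_represents [Infinite Ind] (hv : ∀ p, v p ≠ 0)
    (hbase : ∀ q u u', LamTerm.BetaEta u u' → base q u → base q u')
    (hb : ProductiveBase v obase)
    (hax : ∀ (c : C) (F : TensorType P Ind), F.WF v → F.erase = (sig.typ c).tr →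
      ∀ Z : Set Ind, Z.Finite → ∃ a : SynJudgement v T Ind, a.toJudgement ∈ ax ∧
        a.types = {F} ∧ WordSound base g 0 (.const c) F a.term ∧
        OrderSound v obase 0 (sig.typ c) F a.term ∧ Disjoint a.term.bound Z)
    {X : Multiset (ℕ × ImpType P)} (h : sig.Derivable X t A)
    (hL : L.map (fun x => (x.1, x.2.1)) = X) (hLe : ∀ x ∈ L, x.2.2.erase = x.2.1.tr.dual)
    (hF : F.erase = A.tr) (hsep : Separated v (F ::ₘ L.map (fun x => x.2.2))) {Z : Set Ind}
    (hZ : Z.Finite) :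
    ∃ a : SynJudgement v T Ind, Represents ax base obase g L t A F a ∧
      Disjoint a.term.bound Z := by
  induction h generalizing L F Z with
  | var n A' =>
    obtain ⟨⟨m, A', G⟩, rfl, heq⟩ := Multiset.map_eq_singleton.1 hL
    cases heq
    have hGe := hLe _ (Multiset.mem_singleton_self _)
    obtain ⟨hFw, hFG, hG⟩ := separated_cons.1 hsep
    rw [Multiset.map_singleton] at hG hFG
    have hGw := (separated_cons.1 hG).1
    have hd := hFG _ (Multiset.mem_singleton_self _)
    dsimp only at hGe hGw hd hF
    have he : G.dual.erase = A'.tr := by rw [erase_dual, hGe, TensorSymbol.dual_dual]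
    have hd' : Disjoint G.dual.ind F.ind := by rw [ind_dual]; exact hd.symm
    obtain ⟨a, ha⟩ := exists_derivableIdentity (T := T) hv hGw.dual hFw (he.trans hF.symm) hd'
    have hw := WordSound.var (base := base) (g := g) m A' hGw.dual.fits hFw.fits
      (he.trans hF.symm) ha.word
    have ho := OrderSound.var hb m hGw.dual hFw hd' he hF ha.order
    have hat := ha.types_eq
    rw [dual_dual] at hw ho hat
    exact ⟨a, ⟨hat.trans (Multiset.pair_comm _ _), ⟨0, by simp, ha.derivable⟩, hw, ho⟩, by
      rw [ha.bound_eq]; exact Set.empty_disjoint _⟩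
  | const c =>
    obtain rfl := Multiset.map_eq_zero.1 hL
    have hFw := (separated_cons.1 hsep).1
    obtain ⟨a, ha, hat, haw, hao, hab⟩ := hax c F hFw hF Z hZ
    exact ⟨a, ⟨hat, ⟨{a.toJudgement}, by simpa using ha, .leaf _⟩, haw, hao⟩, hab⟩
  | @app X Y t s A B hdisj h₁ h₂ ih₁ ih₂ =>
    obtain ⟨L₁, L₂, rfl, rfl, rfl⟩ := Multiset.exists_of_map_eq_add hL
    rw [Multiset.map_add] at hsep
    have hW := hZ.union (TensorType.finite_setOf_mem_ind
      (F ::ₘ (L₁.map (fun x => x.2.2) + L₂.map (fun x => x.2.2))))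
    have hdisj' : ∀ S : Set Ind, Disjoint S (Z ∪ {i | ∃ A ∈ F ::ₘ (L₁.map (fun x => x.2.2) +
        L₂.map (fun x => x.2.2)), i ∈ A.ind}) → Disjoint S F.ind ∧
        (∀ B ∈ L₁.map (fun x => x.2.2) + L₂.map (fun x => x.2.2), Disjoint S B.ind) ∧
        Disjoint S Z := fun S hS =>
      ⟨hS.mono_right fun i hi => Or.inr ⟨F, Multiset.mem_cons_self _ _, hi⟩,
        fun B hB => hS.mono_right fun i hi => Or.inr ⟨B, Multiset.mem_cons_of_mem hB, hi⟩,
        hS.mono_right Set.subset_union_left⟩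
    obtain ⟨G, hG, hGe, hGd⟩ := exists_fresh v A.tr hW
    -- An intermediate copy of the conclusion type, at which the function delivers its result; an
    -- identity carries it on to `F`.
    obtain ⟨H, hH, hHe, hHd⟩ := exists_fresh v B.tr (hW.union G.finite_ind)
    rw [Set.disjoint_union_right] at hHd
    obtain ⟨hGF, hGL, hGZ⟩ := hdisj' _ hGd
    obtain ⟨hHF, hHL, hHZ⟩ := hdisj' _ hHd.1
    obtain ⟨hFw, hFL, hLs⟩ := separated_cons.1 hsep
    obtain ⟨hs₁, hs₂, -⟩ := separated_add.1 hLs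
    obtain ⟨a, ha, hab⟩ := ih₁ (L := L₁) (F := .par H G.dual) rfl
      (fun x hx => hLe x (Multiset.mem_add.2 (Or.inl hx)))
      (by rw [erase, hHe, erase_dual, hGe]; rfl)
      (SynJudgement.separated_par.2 (separated_cons.2 ⟨hH, fun K hK => by
        rcases Multiset.mem_cons.1 hK with rfl | hK
        · rw [ind_dual]
          exact hHd.2
        · exact hHL K (Multiset.mem_add.2 (Or.inl hK)),
        separated_cons.2 ⟨hG.dual, fun K hK => by
          rw [ind_dual]
          exact hGL K (Multiset.mem_add.2 (Or.inl hK)), hs₁⟩⟩))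
      ((hW.union G.finite_ind).union H.finite_ind)
    obtain ⟨b, hbr, hbb⟩ := ih₂ (L := L₂) (F := G) rfl
      (fun x hx => hLe x (Multiset.mem_add.2 (Or.inr hx))) hGe
      (separated_cons.2 ⟨hG, fun K hK => hGL K (Multiset.mem_add.2 (Or.inr hK)), hs₂⟩)
      ((hW.union H.finite_ind).union a.term.finite_ind)
    rw [Set.disjoint_union_right, Set.disjoint_union_right] at hab hbb
    obtain ⟨haF, haL, haZ⟩ := hdisj' _ hab.1.1
    obtain ⟨hbF, -, hbZ⟩ := hdisj' _ hbb.1.1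
    obtain ⟨δ, hδ⟩ := exists_derivableIdentity (T := T) hv hH hFw (hHe.trans hF.symm) hHF
    exact ha.app hb hbr hδ hFw hH hHe hF hHF hHd.2.symm hGF hsep hGL hHL haF hab.2 hab.1.2 haL
      hbb.2 hbb.1.2 hbF haZ hbZ hGZ hHZ
  | @lam X t A B h ih =>
    cases F with
    | lit l I J => cases hF
    | tensor H G => cases hF
    | par H G =>
      obtain ⟨hH, hG⟩ := TensorSymbol.par.inj hF
      have hmap : (L.map (fun x => (x.1 + 1, x.2))).map (fun x => x.2.2) =
          L.map (fun x => x.2.2) := by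
        rw [Multiset.map_map]; rfl
      obtain ⟨a, ha, hab⟩ := ih (L := (0, A, G) ::ₘ L.map (fun x => (x.1 + 1, x.2))) (F := H)
        (by rw [← hL, Multiset.map_cons, Multiset.map_map, Multiset.map_map]; rfl) (by
          intro x hx
          rcases Multiset.mem_cons.1 hx with rfl | hx
          · exact hG
          · obtain ⟨y, hy, rfl⟩ := Multiset.mem_map.1 hx
            exact hLe y hy) hH (by
          rw [Multiset.map_cons, hmap]
          exact SynJudgement.separated_par.1 hsep) hZ
      have hat := ha.types_eq
      rw [Multiset.map_cons, hmap] at hat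
      obtain ⟨c, hc, hct⟩ := a.exists_par hat
      have hw := (separated_cons.1 hsep).1
      obtain ⟨Y, hY, hYd⟩ := ha.derivable
      refine ⟨c, ⟨hct, ⟨Y, hY, DerivableFrom.par hat hc hct hYd⟩, ?_, ?_⟩, by rwa [hc]⟩
      · rw [hc]
        exact ha.word.lam hbase
      · rw [hc]
        exact ha.order.lam hb hw.2.1.fits hw.1.fits hG hH

end Existence

/-! ## The language of an abstract categorial grammar is generated by its tensor representation -/

namespace StringACG

open TensorExpr TensorType LamTerm

variable {P C T Ind : Type*} [Finite P] [Finite C] [Finite T] (G : StringACG P C T)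

/-- Shifting `u` by `Nat.succ` frees the variable `0`, which realizes the empty word. Applying the
shifted `u` to it gives the body of `w`, and the η law recovers `u` from this application. -/
theorem betaEta_ofWord_of_base {u : LamTerm T} {w : List T}
    (h : G.base (G.start, [w], [[]]) (u.subst (var ∘ Nat.succ))) : BetaEta u (ofWord w) := by
  rw [base, G.lexicon_start] at h
  have h' : BetaEta (LamTerm.app (rename Nat.succ u) (var 0)) (wordBody w) := by
    rw [← subst_var_comp]
    exact h (var 0) (.refl _)
  exact (BetaEta.eta u).symm.trans h'.lam

theorem exists_edge_of_derivable [Infinite Ind] {t : LamTerm C}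
    (ht : G.sig.Derivable 0 t (.atom G.start)) :
    ∃ (w : List T) (i j : Ind) (a : SynJudgement G.valency T Ind), a.term = .edge w j i ∧
      a.types = {.lit (.pos G.start) [i] [j]} ∧
      (G.tensorSignature Ind).Derivable a.toJudgement ∧
      BetaEta (t.mapConst G.lexicon.onConst) (ofWord w) := by
  classical
  obtain ⟨i, j, hij⟩ := exists_pair_ne Ind
  have hF : TensorType.WF G.valency (.lit (.pos G.start) [i] [j]) := by
    refine ⟨?_, ?_, by simpa using hij⟩ <;> simp [Literal.valency, G.valency_start]
  obtain ⟨a, ha, -⟩ := exists_represents (L := 0) (Z := ∅)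
    (ax := (G.tensorSignature Ind).axioms) G.valency_ne_zero G.base_of_betaEta G.productiveBase
    (fun c F hF he Z hZ => by
      obtain ⟨a, ha, hat, hab⟩ := G.exists_axiomTranslation c hF he hZ
      exact ⟨a, ⟨c, ha⟩, hat, G.wordSound_axiomTranslation c F a ha hat,
        G.orderSound_axiomTranslation c F a ha hat, hab⟩)
    ht rfl (by simp) rfl (separated_cons.2 ⟨hF, by simp, separated_zero⟩) Set.finite_empty
  have hat : a.types = {.lit (.pos G.start) [i] [j]} := ha.types_eq
  obtain ⟨w, hw⟩ := exists_cong_edge (i := i) (j := j) a.term_wf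
    (ha.order.acyclic G.productiveBase)
    (by rw [a.fsup_eq, hat]; ext; simp [TensorType.sub])
    (by rw [a.fsub_eq, hat]; ext; simp [TensorType.sup])
  obtain ⟨b, hb, hbt, hba⟩ := SynJudgement.toJudgement_eq_of_cong hw
  refine ⟨w, i, j, b, hb, hbt.trans hat, hba ▸ ha.derivable, G.betaEta_ofWord_of_base ?_⟩
  -- The edge `[w]^j_i` is satisfied with `w` at `i` and the empty word at `j`. By congruence some
  -- assignment that satisfies `a.term` gives the start type the same value, and there word
  -- soundness of `a` applies.
  have hmem : b.types.map (TensorType.eval (fun k => if k = i then w else [])) ∈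
      a.values suffixRel := by
    rw [← SynJudgement.values_eq isModel_suffixRel hba]
    refine ⟨_, ?_, rfl⟩
    rw [hb]
    simp [Sat, suffixRel, hij.symm]
  obtain ⟨ν, hν, heq⟩ := hmem
  rw [hbt, hat, Multiset.map_singleton, Multiset.map_singleton, Multiset.singleton_inj] at heq
  have := ha.word ν hν (var ∘ Nat.succ) (by simp)
  rw [← heq] at this
  simpa [TensorType.eval, toImp, Realizes, hij.symm] using this

theorem language_subset [Infinite Ind] (hfin : (G.tensorSignature Ind).axioms.Finite) :
    G.language ⊆ (G.tensorRepresentation Ind hfin).language := by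
  rintro w ⟨t, hw, ht⟩
  obtain ⟨w', i, j, a, ha, hat, had, ht'⟩ := G.exists_edge_of_derivable (Ind := Ind) ht
  obtain rfl := ofWord_injective_betaEta (hw.trans ht')
  exact ⟨i, j, a, ha, hat, had⟩

end StringACG

/-! ## Phase semantics -/

namespace ImpType

/-- Linear natural deduction for implicational types, with axioms `ax`. -/
inductive NatDed {Q : Type*} (ax : Set (ImpType Q)) : Multiset (ImpType Q) → ImpType Q → Prop
  | var (A : ImpType Q) : NatDed ax {A} A
  | const {A : ImpType Q} (hA : A ∈ ax) : NatDed ax 0 A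
  | app {Δ Θ : Multiset (ImpType Q)} {A B : ImpType Q} :
      NatDed ax Δ (.imp A B) → NatDed ax Θ A → NatDed ax (Δ + Θ) B
  | lam {Δ : Multiset (ImpType Q)} {A B : ImpType Q} :
      NatDed ax (A ::ₘ Δ) B → NatDed ax Δ (.imp A B)

variable {Q : Type*} {ax : Set (ImpType Q)}

theorem NatDed.cut {Δ Θ : Multiset (ImpType Q)} {A B : ImpType Q} (h : NatDed ax (A ::ₘ Δ) B)
    (h' : NatDed ax Θ A) : NatDed ax (Δ + Θ) B :=
  .app (.lam h) h'

variable (ax) in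
/-- The pairs of a multiset of hypotheses and a single conclusion that are derivable. -/
def pole : Set (Multiset (ImpType Q) × Multiset (ImpType Q)) :=
  {m | ∃ B, m.2 = {B} ∧ NatDed ax m.1 B}

variable (ax) in
/-- The orthogonal of a set with respect to the pole. -/
def orth (S : Set (Multiset (ImpType Q) × Multiset (ImpType Q))) :
    Set (Multiset (ImpType Q) × Multiset (ImpType Q)) :=
  {m | ∀ n ∈ S, m + n ∈ pole ax}

variable {S S' U : Set (Multiset (ImpType Q) × Multiset (ImpType Q))}

theorem subset_orth_comm : S ⊆ orth ax U ↔ U ⊆ orth ax S :=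
  ⟨fun h n hn m hm => add_comm m n ▸ h hm n hn, fun h n hn m hm => add_comm m n ▸ h hm n hn⟩

theorem subset_orth_orth : S ⊆ orth ax (orth ax S) :=
  subset_orth_comm.1 subset_rfl

theorem orth_anti (h : S ⊆ S') : orth ax S' ⊆ orth ax S :=
  fun _ hm n hn => hm n (h hn)

theorem orth_orth_orth : orth ax (orth ax (orth ax S)) = orth ax S :=
  (orth_anti subset_orth_orth).antisymm subset_orth_orth

open scoped Pointwise

theorem add_subset_pole_iff : S + U ⊆ pole ax ↔ U ⊆ orth ax S := by
  rw [Set.add_subset_iff]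
  exact ⟨fun h n hn m hm => add_comm m n ▸ h m hm n hn, fun h m hm n hn => add_comm n m ▸ h hn m hm⟩

end ImpType

namespace TensorType

open ImpType
open scoped Pointwise

variable {P X : Type*} {ax : Set (ImpType (P × List X × List X))}

variable (ax) in
/-- The set of tests for a tensor type. -/
def tests : TensorType P X →
    Set (Multiset (ImpType (P × List X × List X)) × Multiset (ImpType (P × List X × List X)))
  | lit (.neg p) I J => orth ax {(0, {.atom (p, J.reverse, I.reverse)})}
  | lit (.pos p) I J => orth ax (orth ax {(0, {.atom (p, I, J)})})
  | tensor A B => orth ax (orth ax (tests A) + orth ax (tests B))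
  | par A B => orth ax (orth ax (tests A + tests B))

theorem orth_orth_tests (F : TensorType P X) : orth ax (orth ax (F.tests ax)) = F.tests ax := by
  cases F with
  | lit l I J => cases l <;> exact orth_orth_orth
  | tensor A B => exact orth_orth_orth
  | par A B => exact orth_orth_orth

theorem tests_dual (F : TensorType P X) : F.dual.tests ax = orth ax (F.tests ax) := by
  induction F with
  | lit l I J =>
    cases l with
    | neg p => rfl
    | pos p =>
      simp only [dual, Literal.dual, tests, List.reverse_reverse, orth_orth_orth]
  | tensor A B ihA ihB => rw [dual, tests, tests, ihA, ihB, add_comm]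
  | par A B ihA ihB =>
    rw [dual, tests, tests, ihA, ihB, orth_orth_tests, orth_orth_tests, orth_orth_orth, add_comm]

variable (ax) in
/-- A multiset of types is valid if all combinations of tests are in the pole. -/
def Valid (Γ : Multiset (TensorType P X)) : Prop := (Γ.map (tests ax)).sum ⊆ pole ax

variable {Γ Θ : Multiset (TensorType P X)} {A B : TensorType P X}

theorem valid_cons : Valid ax (A ::ₘ Γ) ↔ (Γ.map (tests ax)).sum ⊆ orth ax (A.tests ax) := by
  rw [Valid, Multiset.map_cons, Multiset.sum_cons, add_subset_pole_iff]

theorem valid_pair_dual (A : TensorType P X) : Valid ax {A, A.dual} := by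
  rw [Multiset.insert_eq_cons, valid_cons, Multiset.map_singleton, Multiset.sum_singleton,
    tests_dual]

theorem Valid.par (h : Valid ax (A ::ₘ B ::ₘ Γ)) : Valid ax (.par A B ::ₘ Γ) := by
  rw [Valid, Multiset.map_cons, Multiset.map_cons, Multiset.sum_cons, Multiset.sum_cons,
    ← add_assoc, add_subset_pole_iff] at h
  rwa [valid_cons, tests, orth_orth_orth]

theorem Valid.cut (h : Valid ax (A ::ₘ Γ)) (h' : Valid ax (A.dual ::ₘ Θ)) :
    Valid ax (Γ + Θ) := by
  rw [valid_cons] at h h'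
  rw [tests_dual] at h'
  rw [Valid, Multiset.map_add, Multiset.sum_add, add_subset_pole_iff]
  exact h'.trans (orth_anti h)

theorem Valid.tensor (h : Valid ax (A ::ₘ Γ)) (h' : Valid ax (B ::ₘ Θ)) :
    Valid ax (.tensor A B ::ₘ (Γ + Θ)) := by
  rw [valid_cons] at h h' ⊢
  rw [tests, Multiset.map_add, Multiset.sum_add]
  exact (Set.add_subset_add h h').trans subset_orth_orth

/-- The completeness argument of phase semantics. Both halves are proved together, since passing to
the dual component `K` exchanges their roles. At `A ⊸ B` the first half amounts to abstraction, the
second to application followed by a cut. -/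
theorem mem_tests_and_mem_orth_tests {C : ImpType P} {F : TensorType P X} (h : F.erase = C.tr) :
    (0, {F.toImp}) ∈ F.tests ax ∧ ({F.toImp}, 0) ∈ orth ax (F.tests ax) := by
  induction C generalizing F with
  | atom p =>
    match F, h with
    | .lit (.pos _) I J, rfl =>
      refine ⟨subset_orth_orth rfl, ?_⟩
      rw [tests, orth_orth_orth]
      rintro _ rfl
      exact ⟨_, rfl, .var _⟩
  | imp A B ihA ihB =>
    match F, h with
    | .par H K, h =>
      obtain ⟨hH, hK⟩ := TensorSymbol.par.inj h
      obtain ⟨hB, hB'⟩ := ihB hH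
      obtain ⟨hA, hA'⟩ := ihA (F := K.dual) (by rw [erase_dual, hK, TensorSymbol.dual_dual])
      rw [tests_dual, toImp_dual] at hA hA'
      rw [orth_orth_tests] at hA'
      constructor
      · rintro m hm
        -- The element `m` is combined with the conclusion `B` and the hypothesis `A`. The pole
        -- admits exactly one conclusion, so `m` contributes none of its own.
        obtain ⟨C, hC, hD⟩ := hm _ (Set.add_mem_add hB hA')
        obtain ⟨Δ, Ω⟩ := m
        obtain ⟨rfl, rfl⟩ := (Multiset.singleton_eq_cons_iff _).1
          (show {C} = H.toImp ::ₘ Ω by simpa [← Multiset.singleton_add, add_comm] using hC.symm)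
        refine ⟨(par H K).toImp, by simp, ?_⟩
        have : NatDed ax (K.toImp ::ₘ Δ) H.toImp := by
          simpa [← Multiset.singleton_add, add_comm] using hD
        simpa [toImp] using this.lam
      · rw [tests, orth_orth_orth]
        rintro _ ⟨⟨Δ, Ω⟩, hh, ⟨Θ, Ω'⟩, hk, rfl⟩
        obtain ⟨C, hC, hD⟩ := hB' _ hh
        obtain ⟨C', hC', hD'⟩ := hA _ hk
        obtain ⟨rfl, rfl⟩ := (Multiset.singleton_eq_cons_iff _).1
          (show {C'} = K.toImp ::ₘ Ω' by simpa [← Multiset.singleton_add, add_comm] using hC'.symm)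
        have hΩ : Ω = {C} := by simpa using hC
        refine ⟨C, by simp [hΩ], ?_⟩
        have h₁ : NatDed ax ({(par H K).toImp} + Θ) H.toImp :=
          .app (.var _) (by simpa using hD')
        have h₂ : NatDed ax (H.toImp ::ₘ Δ) C := by simpa using hD
        have h₃ := h₂.cut h₁
        rw [add_left_comm] at h₃
        exact h₃

/-- Every test for `F` becomes derivable once `F.toImp` is added as a hypothesis, and the axiom
discharges this hypothesis by a cut. -/
theorem valid_singleton_of_mem {C : ImpType P} {F : TensorType P X} (h : F.erase = C.tr)
    (hF : F.toImp ∈ ax) : Valid ax {F} := by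
  rw [Valid, Multiset.map_singleton, Multiset.sum_singleton]
  rintro ⟨Δ, Ω⟩ hm
  obtain ⟨B, hB, hD⟩ := (mem_tests_and_mem_orth_tests h).2 _ hm
  refine ⟨B, by simpa using hB, ?_⟩
  have h₁ : NatDed ax (F.toImp ::ₘ Δ) B := by simpa using hD
  simpa using h₁.cut (.const hF)

/-- The type itself, as sole conclusion without hypotheses, is one of its own tests. -/
theorem natDed_of_valid {C : ImpType P} {F : TensorType P X} (h : F.erase = C.tr)
    (hF : Valid ax {F}) : NatDed ax 0 F.toImp := by
  rw [Valid, Multiset.map_singleton, Multiset.sum_singleton] at hF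
  obtain ⟨B, hB, hD⟩ := hF (mem_tests_and_mem_orth_tests h).1
  rw [Multiset.singleton_inj.1 hB]
  exact hD

end TensorType

section Soundness

open TensorExpr TensorType ImpType

variable {P T Ind : Type*} {v : P → ℕ × ℕ} {ax : Set (ImpType (P × List (List T) × List (List T)))}

/-- Soundness is checked under one assignment at a time. An assignment satisfying a product
satisfies both factors, so both premises of a cut give the cut type dual values; in an identity the
two literals receive dual values. -/
theorem DerivableFrom.valid {X : Multiset (TypingJudgement v T Ind)} {j : TypingJudgement v T Ind}
    (h : DerivableFrom X j)
    (hX : ∀ a : SynJudgement v T Ind, a.toJudgement ∈ X → ∀ Γ ∈ a.values suffixRel, Valid ax Γ)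
    {a : SynJudgement v T Ind} (ha : a.toJudgement = j) {Γ : Multiset (TensorType P (List T))}
    (hΓ : Γ ∈ a.values suffixRel) : Valid ax Γ := by
  induction h generalizing a Γ with
  | leaf j => exact hX a (by simp [ha]) Γ hΓ
  | id p I J I' J' c hterm htypes =>
    rw [SynJudgement.values_eq isModel_suffixRel ha] at hΓ
    obtain ⟨ν, hν, rfl⟩ := hΓ
    have hF := (c.types_wf (.lit (.neg p) I J) (by simp [htypes])).fits.dual
    have hG := (c.types_wf (.lit (.pos p) J' I') (by simp [htypes])).fits
    have := eval_eq_of_isIdentity hF hG rfl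
      (SynJudgement.isIdentity_delta suffixRel hF hG rfl hterm) hν
    rw [htypes, Multiset.insert_eq_cons, Multiset.map_cons, Multiset.map_singleton, ← this,
      eval_dual]
    exact valid_pair_dual _
  | cut hat hbt hterm htypes _ _ ih₁ ih₂ =>
    rw [SynJudgement.values_eq isModel_suffixRel ha] at hΓ
    obtain ⟨ν, hν, rfl⟩ := hΓ
    rw [hterm] at hν
    have h₁ := ih₁ (fun a ha => hX a (Multiset.mem_add.2 (Or.inl ha))) rfl ⟨ν, hν.1, rfl⟩
    have h₂ := ih₂ (fun a ha => hX a (Multiset.mem_add.2 (Or.inr ha))) rfl ⟨ν, hν.2, rfl⟩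
    rw [hat, Multiset.map_cons] at h₁
    rw [hbt, Multiset.map_cons, eval_dual] at h₂
    rw [htypes, Multiset.map_add]
    exact h₁.cut h₂
  | par hat hterm htypes _ ih =>
    rw [SynJudgement.values_eq isModel_suffixRel ha] at hΓ
    obtain ⟨ν, hν, rfl⟩ := hΓ
    rw [hterm] at hν
    have h := ih hX rfl ⟨ν, hν, rfl⟩
    rw [hat, Multiset.map_cons, Multiset.map_cons] at h
    rw [htypes, Multiset.map_cons]
    exact h.par
  | tensor hat hbt hterm htypes _ _ ih₁ ih₂ =>
    rw [SynJudgement.values_eq isModel_suffixRel ha] at hΓ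
    obtain ⟨ν, hν, rfl⟩ := hΓ
    rw [hterm] at hν
    have h₁ := ih₁ (fun a ha => hX a (Multiset.mem_add.2 (Or.inl ha))) rfl ⟨ν, hν.1, rfl⟩
    have h₂ := ih₂ (fun a ha => hX a (Multiset.mem_add.2 (Or.inr ha))) rfl ⟨ν, hν.2, rfl⟩
    rw [hat, Multiset.map_cons] at h₁
    rw [hbt, Multiset.map_cons] at h₂
    rw [htypes, Multiset.map_cons, Multiset.map_add]
    exact h₁.tensor h₂

end Soundness

/-! ## Terms from natural deduction proofs -/

namespace ImpType

open LamTerm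

variable {P Y C D : Type*}

/-- Forget the decoration of atoms. -/
def forget : ImpType (P × Y) → ImpType P
  | .atom q => .atom q.1
  | .imp A B => .imp (forget A) (forget B)

theorem forget_toImp {X : Type*} {A : ImpType P} {F : TensorType P X} (h : F.erase = A.tr) :
    F.toImp.forget = A := by
  induction A generalizing F with
  | atom p =>
    match F, h with
    | .lit (.pos _) I J, rfl => rfl
  | imp A B ihA ihB =>
    match F, h with
    | .par H K, h =>
      obtain ⟨hH, hK⟩ := TensorSymbol.par.inj h
      have := ihA (F := K.dual) (by rw [TensorType.erase_dual, hK, TensorSymbol.dual_dual])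
      rw [TensorType.toImp_dual] at this
      rw [TensorType.toImp, forget, this, ihB hH]

/-- The hypotheses are numbered by distinct variables. Without decorations the proof is a typing
derivation of `t`; with them it shows, by the logical predicate, that the image of `t` realizes the
decorated conclusion. -/
theorem NatDed.exists_term {sig : LamSignature P C} {base : P × Y → LamTerm D → Prop}
    {g : C → LamTerm D} {ax : Set (ImpType (P × Y))}
    (hbase : ∀ q u u', BetaEta u u' → base q u → base q u')
    (hax : ∀ A ∈ ax, ∃ c, A.forget = sig.typ c ∧ ∀ σ, Realizes base A (subst σ (g c)))
    {Δ : Multiset (ImpType (P × Y))} {A : ImpType (P × Y)} (h : NatDed ax Δ A)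
    {N : Multiset (ℕ × ImpType (P × Y))} (hN : N.map Prod.snd = Δ)
    (hnd : (N.map Prod.fst).Nodup) :
    ∃ t : LamTerm C, sig.Derivable (N.map fun x => (x.1, x.2.forget)) t A.forget ∧
      ∀ σ, (∀ x ∈ N, Realizes base x.2 (σ x.1)) → Realizes base A ((t.mapConst g).subst σ) := by
  induction h generalizing N with
  | var A =>
    obtain ⟨⟨n, A⟩, rfl, rfl⟩ := Multiset.map_eq_singleton.1 hN
    exact ⟨.var n, .var n A.forget, fun σ hσ => hσ _ (Multiset.mem_singleton_self _)⟩
  | const hA =>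
    obtain rfl := Multiset.map_eq_zero.1 hN
    obtain ⟨c, hc, hr⟩ := hax _ hA
    exact ⟨.const c, hc ▸ .const c, fun σ _ => hr σ⟩
  | app _ _ ih₁ ih₂ =>
    obtain ⟨N₁, N₂, rfl, h₁, h₂⟩ := Multiset.exists_of_map_eq_add hN
    rw [Multiset.map_add, Multiset.nodup_add] at hnd
    obtain ⟨t, ht, htr⟩ := ih₁ h₁ hnd.1
    obtain ⟨s, hs, hsr⟩ := ih₂ h₂ hnd.2.1
    refine ⟨.app t s, ?_, fun σ hσ => ?_⟩
    · rw [Multiset.map_add]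
      refine .app (fun x hx y hy => ?_) ht hs
      obtain ⟨x, hx', rfl⟩ := Multiset.mem_map.1 hx
      obtain ⟨y, hy', rfl⟩ := Multiset.mem_map.1 hy
      intro heq
      have hxy : x.1 = y.1 := heq
      exact Multiset.disjoint_left.1 hnd.2.2 (Multiset.mem_map_of_mem Prod.fst hx')
        (hxy ▸ Multiset.mem_map_of_mem Prod.fst hy')
    · exact htr σ (fun x hx => hσ x (Multiset.mem_add.2 (Or.inl hx))) _
        (hsr σ fun x hx => hσ x (Multiset.mem_add.2 (Or.inr hx)))
  | @lam Δ A B _ ih =>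
    obtain ⟨t, ht, htr⟩ := ih (N := (0, A) ::ₘ N.map fun x => (x.1 + 1, x.2))
      (by rw [Multiset.map_cons, Multiset.map_map, ← hN]; rfl) (by
        rw [Multiset.map_cons, Multiset.map_map, Multiset.nodup_cons]
        refine ⟨fun h => ?_, ?_⟩
        · obtain ⟨x, -, hx⟩ := Multiset.mem_map.1 h
          exact Nat.succ_ne_zero _ hx
        · have := hnd.map Nat.succ_injective
          rwa [Multiset.map_map] at this)
    refine ⟨.lam t, ?_, fun σ hσ => Realizes.lam hbase fun s hs => htr _ fun x hx => ?_⟩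
    · refine .lam ?_
      rw [Multiset.map_cons, Multiset.map_map] at ht
      rw [Multiset.map_map]
      exact ht
    · rcases Multiset.mem_cons.1 hx with rfl | hx
      · exact hs
      · obtain ⟨y, hy, rfl⟩ := Multiset.mem_map.1 hx
        exact hσ y hy

end ImpType

namespace StringACG

open TensorExpr TensorType LamTerm

variable {P C T Ind : Type*} [Finite P] [Finite C] [Finite T] (G : StringACG P C T)

theorem subset_language (hfin : (G.tensorSignature Ind).axioms.Finite) :
    (G.tensorRepresentation Ind hfin).language ⊆ G.language := by
  classical
  rintro w ⟨i, j, a, ha, hat, X, hX, hd⟩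
  have hij : i ≠ j := by
    rintro rfl
    have : TensorType.WF G.valency (.lit (.pos G.start) [i] [i]) :=
      a.types_wf _ (hat ▸ Multiset.mem_singleton_self _)
    simpa using this.2.2
  -- A decorated type is an axiom exactly if it decorates the type of some constant whose image
  -- realizes it, so a proof from `ax` can be read as an abstract term.
  let ax : Set (ImpType (P × List (List T) × List (List T))) := {D | ∃ c,
    D.forget = G.sig.typ c ∧ ∀ σ, Realizes G.base D (subst σ (G.lexicon.onConst c))}
  -- Validity is used at the assignment with `w` at `i` and the empty word at `j`, which satisfies
  -- `[w]^j_i`. The leaves of the derivation are valid since word soundness puts all values of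
  -- axioms into `ax`.
  have hvalid := DerivableFrom.valid (ax := ax) hd (fun b hb Γ hΓ => by
      obtain ⟨c, hc⟩ := hX _ hb
      obtain ⟨I, J, e, b', h, hbb', rfl, hbt⟩ := id hc
      rw [SynJudgement.values_eq isModel_suffixRel hbb'] at hΓ
      obtain ⟨ν, hν, rfl⟩ := hΓ
      rw [hbt, Multiset.map_singleton]
      have he : (((G.sig.typ c).tr.decorate G.valency I J).eval ν).erase = (G.sig.typ c).tr := by
        rw [erase_eval, erase_decorate]
      exact valid_singleton_of_mem he ⟨c, ImpType.forget_toImp he, fun σ =>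
        G.wordSound_axiomTranslation c _ b' (hbb' ▸ hc) hbt ν hν σ (by simp)⟩)
    rfl (Γ := {.lit (.pos G.start) [w] [[]]})
    ⟨fun k => if k = i then w else [], by
      rw [ha]
      simp [Sat, suffixRel, hij.symm], by
      rw [hat]
      simp [TensorType.eval, hij.symm, tensorRepresentation]⟩
  obtain ⟨t, ht, htr⟩ := (natDed_of_valid (C := .atom G.start) rfl hvalid).exists_term
    (sig := G.sig) (g := G.lexicon.onConst) G.base_of_betaEta (fun A hA => hA) (N := 0) rfl
    (by simp)
  exact ⟨t, (G.betaEta_ofWord_of_base (htr _ (by simp))).symm, ht⟩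

end StringACG

theorem mainTheorem2 {P C T : Type*} [Finite P] [Finite C] [Finite T]
    (Ind : Type*) [Infinite Ind] (G : StringACG P C T) :
    ∃ hfin : (G.tensorSignature Ind).axioms.Finite,
      G.language = (G.tensorRepresentation Ind hfin).language :=
  ⟨G.finite_axioms Ind, (G.language_subset _).antisymm (G.subset_language _)⟩
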